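/- Let $1\le p\le d$ and let $x_1,\dots,x_n$ be i.i.d. from a zero-mean distribution on $\mathbb R^d$ with $\|x_i\|^2\le R$ almost surely and covariance $\Omega^*=\mathbb E[x_ix_i^\top]$ satisfying $\alpha^* I\preceq\Omega^*\preceq L^* I$, $\alpha^*>0$. Let $\Omega^{(\infty)}=\sum_{i=1}^n x_ix_i^\top$ and $\psi(\theta)=\frac12\theta^\top\Omega^{(\infty)}\theta$, so that $\mathcal N(0,(\Omega^{(\infty)})^{-1})$ is the (centred) posterior of linear regression with a uniform prior. Run the following stochastic variational inference algorithm, with input matrix $I$, with $0\le\alpha\le n\alpha^*$ and a step $\Delta>0$. Start from $U^{(0)}=[e_1,\dots,e_p]$. For $t=0,\dots,T-1$ draw fresh i.i.d. $\theta^{(t)}_1,\dots,\theta^{(t)}_N\sim\mathcal N(0,I)$ and let $U^{(t+1)}$ be the semi-orthonormal factor in a QR decomposition of $\sum_{j=1}^N\nabla\psi(\theta^{(t)}_j)(\theta^{(t)}_j)^\top U^{(t)}$. Finally draw fresh i.i.d. $\vartheta_1,\dots,\vartheta_M\sim\mathcal N(0,I)$ and, with $u_k$ the $k$-th column of $U^{(T)}$,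 set $$\lambda_k^{(T)}=\frac1M\sum_{j=1}^M u_k^\top\,\frac{\nabla\psi(\vartheta_j+\Delta u_k)-\nabla\psi(\vartheta_j-\Delta u_k)}{2\Delta}-\alpha ,\qquad k=1,\dots,p .$$ All samples are independent of each other and of the data. The precision matrix of the resulting variational posterior is $\Omega^{(T)}=\alpha I+U^{(T)}\mathrm{diag}(\lambda^{(T)}_1,\dots,\lambda^{(T)}_p)(U^{(T)})^\top$. Let $\Pi=NT+2M$ be the number of gradient evaluations, where $N,T,M\ge1$ follow the allocation rule $$N=\Theta\Big(\Pi^{2/3}\tfrac{(pd)^{1/3}}{\delta^{1/6}}\big(\tfrac{L^*}{\alpha^*}\big)^{2/3}\Big),\quad T=\Theta\Big(\Pi^{1/3}\tfrac{\delta^{1/6}}{(pd)^{1/3}}\big(\tfrac{\alpha^*}{L^*}\big)^{2/3}\Big),\quad M=\widetilde\Theta\Big(\Pi^{2/3}\tfrac{p^{1/3}}{d^{2/3}}\big(\tfrac{\alpha^*}{L^*}\big)^{4/3}\delta^{1/3}\Big),$$ the $\widetilde\Theta$ hiding a factor polynomial in $1+\log(\Pi\,p\,d\,(L^*/\alpha^*)/\delta)$.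 Let $\lambda_1^*\ge\dots\ge\lambda_d^*\ge 0$ be the eigenvalues of $\Omega^*-\frac{\alpha}{n}I$ (they are at most those of $\Omega^*$, so that the bound below holds a fortiori with the eigenvalues of $\Omega^*$ itself). Let $m>0$ and $\delta_0<1$. If $0<\delta\le\delta_0$ and $n\ge 8\frac{R^2}{(\alpha^*)^2}\log\frac2\delta$, then, except on an event of probability at most $\delta$, the following implication holds: if the initial overlap of the algorithm is at least $m$, in the sense that for some orthonormal basis $v_1,\dots,v_d$ of eigenvectors of $\Omega^{(\infty)}$, in order of decreasing eigenvalues, $\sigma_{\min}\big([v_1,\dots,v_k]^\top[e_1,\dots,e_k]\big)\ge m$ for all $k\le p$, then $$\Big\|\Omega^*-\frac1n\Omega^{(T)}\Big\|_F^2\le C\left(\sum_{k=p+1}^d(\lambda_k^*)^2+\Big(\frac{pd}{\Pi}\Big)^{1/3}\Big(\frac{L^*}{\alpha^*}\Big)^{2/3}\frac{L^*}{\delta^{1/6}}\sum_{k=1}^p\lambda_k^*+\frac{R^2}{n}\log\frac1\delta\right).$$ The constant $C$ depends only on $m$, on $\delta_0$, and on the constants (and the logarithmic exponent) in the allocation rule.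 -/

import Mathlib

open MeasureTheory ProbabilityTheory
open scoped Matrix

noncomputable section

namespace LowRankSVI

/-- Euclidean space of dimension `d`. -/
abbrev Vec (d : ℕ) : Type := EuclideanSpace ℝ (Fin d)

/-- The rank-one matrix `x yᵀ`. -/
def outer {d : ℕ} (x y : Vec d) : Matrix (Fin d) (Fin d) ℝ :=
  Matrix.vecMulVec x.ofLp y.ofLp

/-- The squared Frobenius norm. -/
def frobSq {d : ℕ} (A : Matrix (Fin d) (Fin d) ℝ) : ℝ := ∑ i, ∑ j, A i j ^ 2

/-- The second moment matrix `𝔼[x xᵀ]` of a distribution on `ℝ^d` (the covariance matrix when the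
distribution has mean zero). -/
def secondMoment {d : ℕ} (μ : Measure (Vec d)) : Matrix (Fin d) (Fin d) ℝ :=
  Matrix.of fun i j => ∫ x, x i * x j ∂μ

/-- The exact posterior precision `∑ᵢ xᵢ xᵢᵀ` of linear regression with a uniform prior. -/
def posteriorPrecision {d n : ℕ} (x : Fin n → Vec d) : Matrix (Fin d) (Fin d) ℝ :=
  ∑ i, outer (x i) (x i)

/-- The potential `ψ(θ) = ½ θᵀ A θ` of the centred Gaussian with precision matrix `A`. -/
def potential {d : ℕ} (A : Matrix (Fin d) (Fin d) ℝ) (θ : Vec d) : ℝ :=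
  (1 / 2) * (θ.ofLp ⬝ᵥ (A *ᵥ θ.ofLp))

/-- The centred Gaussian law `N(0, W⁻¹)` with precision matrix `W`. -/
def gaussianOfPrecision {d : ℕ} (W : Matrix (Fin d) (Fin d) ℝ) : Measure (Vec d) :=
  multivariateGaussian 0 W⁻¹

/-- The initialization `U⁽⁰⁾ = [e₁, …, e_p]`. -/
def initialFrame (d p : ℕ) : Matrix (Fin d) (Fin p) ℝ :=
  Matrix.of fun i k => if i.val = k.val then 1 else 0

/-- `Q` is the semi-orthonormal factor of a (thin) QR decomposition of `A`: the columns of `Q` are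
orthonormal, and `A = Q R` with `R` upper triangular. -/
def IsQRFactor {d p : ℕ} (Q A : Matrix (Fin d) (Fin p) ℝ) : Prop :=
  Qᵀ * Q = 1 ∧ ∃ R : Matrix (Fin p) (Fin p) ℝ, (∀ i j, j < i → R i j = 0) ∧ A = Q * R

/-- The stochastic update `∑ⱼ ∇ψ(θⱼ) θⱼᵀ W U` with input matrix `W` and samples `θ₁, …, θ_N`. -/
def sviUpdate {d p N : ℕ} (ψ : Vec d → ℝ) (W : Matrix (Fin d) (Fin d) ℝ) (θ : Fin N → Vec d)
    (U : Matrix (Fin d) (Fin p) ℝ) : Matrix (Fin d) (Fin p) ℝ :=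
  (∑ j, outer (gradient ψ (θ j)) (θ j) * W) * U

/-- `U 0, …, U T` are the iterates of the first stage of the SVI algorithm for a Gaussian posterior,
run with the samples `θ t j` (iteration `t`, sample `j`). -/
def IsSVIIterates {d p N T : ℕ} (ψ : Vec d → ℝ) (W : Matrix (Fin d) (Fin d) ℝ)
    (θ : Fin T → Fin N → Vec d) (U : ℕ → Matrix (Fin d) (Fin p) ℝ) : Prop :=
  U 0 = initialFrame d p ∧
    ∀ t : Fin T, IsQRFactor (U (t.val + 1)) (sviUpdate ψ W (θ t) (U t.val))

/-- The second stage of the SVI algorithm: the eigenvalue estimates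
`λ_k = (1/M) ∑ⱼ u_kᵀ (∇ψ(ϑⱼ + Δ u_k) - ∇ψ(ϑⱼ - Δ u_k)) / (2Δ) - α`. -/
def sviEigenvalue {d p M : ℕ} (ψ : Vec d → ℝ) (α Δ : ℝ) (ϑ : Fin M → Vec d)
    (U : Matrix (Fin d) (Fin p) ℝ) (k : Fin p) : ℝ :=
  let u : Vec d := WithLp.toLp 2 fun i => U i k
  (1 / (M : ℝ)) * ∑ j, inner ℝ u
    ((1 / (2 * Δ)) • (gradient ψ (ϑ j + Δ • u) - gradient ψ (ϑ j - Δ • u))) - α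

/-- The precision matrix `α I + U diag(λ) Uᵀ` of the rank-`p` variational posterior returned by the
SVI algorithm whose first stage ends in `U`. -/
def variationalPrecision {d p M : ℕ} (ψ : Vec d → ℝ) (α Δ : ℝ) (ϑ : Fin M → Vec d)
    (U : Matrix (Fin d) (Fin p) ℝ) : Matrix (Fin d) (Fin d) ℝ :=
  α • (1 : Matrix (Fin d) (Fin d) ℝ) +
    U * Matrix.diagonal (sviEigenvalue ψ α Δ ϑ U) * Uᵀ

/-- `A = V diag(lam) Vᵀ` with `V` orthogonal and `lam` in decreasing order. -/
def IsSortedEigendecomposition {d : ℕ} (A V : Matrix (Fin d) (Fin d) ℝ) (lam : Fin d → ℝ) : Prop :=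
  Vᵀ * V = 1 ∧ Antitone lam ∧ A = V * Matrix.diagonal lam * Vᵀ

/-- The leading principal `k × k` submatrix. -/
def leadingBlock {d : ℕ} (V : Matrix (Fin d) (Fin d) ℝ) (k : ℕ) (hk : k ≤ d) :
    Matrix (Fin k) (Fin k) ℝ :=
  V.submatrix (Fin.castLE hk) (Fin.castLE hk)

/-- The smallest singular value of the square matrix `B` is at least `m` (where `0 ≤ m`). -/
def SigmaMinGE {k : ℕ} (B : Matrix (Fin k) (Fin k) ℝ) (m : ℝ) : Prop :=
  ∀ y : Fin k → ℝ, m ^ 2 * (y ⬝ᵥ y) ≤ (B *ᵥ y) ⬝ᵥ (B *ᵥ y)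

/-- The initialization `[e₁, …, e_p]` has overlap at least `m` with the leading eigenvectors of `A`:
for some matrix `V` of eigenvectors, ordered by decreasing eigenvalue, every leading principal
`k × k` submatrix with `k ≤ p`, that is `[v₁, …, v_k]ᵀ [e₁, …, e_k]` up to transposition, has
smallest singular value at least `m`. -/
def HasInitialOverlap {d : ℕ} (A : Matrix (Fin d) (Fin d) ℝ) (p : ℕ) (m : ℝ) : Prop :=
  ∃ (V : Matrix (Fin d) (Fin d) ℝ) (lam : Fin d → ℝ), IsSortedEigendecomposition A V lam ∧
    ∀ (k : ℕ) (hk : k ≤ d), k ≤ p → SigmaMinGE (leadingBlock V k hk) m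

/-- The number of gradient evaluations `N T + 2 M` of the SVI algorithm. -/
def budget (N T M : ℕ) : ℝ := (N : ℝ) * T + 2 * M

/-- The polylogarithmic factor `1 + log(Π p d κ / δ)`. -/
def logFactor (p d : ℕ) (κ δ B : ℝ) : ℝ := 1 + Real.log (B * p * d * κ / δ)

/-- The allocation rule, for the budget `Π = N T + 2 M` and the condition number `κ`:
`N = Θ(Π^{2/3} (pd)^{1/3} δ^{-1/6} κ^{2/3})`, `T = Θ(Π^{1/3} δ^{1/6} (pd)^{-1/3} κ^{-2/3})` and, up to
a polylogarithmic factor of order `q`, `M = Θ(Π^{2/3} p^{1/3} d^{-2/3} κ^{-4/3} δ^{1/3})`. The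
constants in `Θ` are `c₁` (below) and `c₂` (above); the three numbers are positive. -/
structure IsAllocation (c₁ c₂ : ℝ) (q p d : ℕ) (κ δ : ℝ) (N T M : ℕ) : Prop where
  N_pos : 0 < N
  T_pos : 0 < T
  M_pos : 0 < M
  N_lower : c₁ * (budget N T M ^ (2 / 3 : ℝ) * (((p : ℝ) * d) ^ (1 / 3 : ℝ) / δ ^ (1 / 6 : ℝ)) *
    κ ^ (2 / 3 : ℝ)) ≤ N
  N_upper : N ≤ c₂ * (budget N T M ^ (2 / 3 : ℝ) * (((p : ℝ) * d) ^ (1 / 3 : ℝ) / δ ^ (1 / 6 : ℝ)) *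
    κ ^ (2 / 3 : ℝ))
  T_lower : c₁ * (budget N T M ^ (1 / 3 : ℝ) * (δ ^ (1 / 6 : ℝ) / ((p : ℝ) * d) ^ (1 / 3 : ℝ)) *
    (1 / κ) ^ (2 / 3 : ℝ)) ≤ T
  T_upper : T ≤ c₂ * (budget N T M ^ (1 / 3 : ℝ) * (δ ^ (1 / 6 : ℝ) / ((p : ℝ) * d) ^ (1 / 3 : ℝ)) *
    (1 / κ) ^ (2 / 3 : ℝ))
  M_lower : c₁ * (budget N T M ^ (2 / 3 : ℝ) * ((p : ℝ) ^ (1 / 3 : ℝ) / (d : ℝ) ^ (2 / 3 : ℝ)) *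
    (1 / κ) ^ (4 / 3 : ℝ) * δ ^ (1 / 3 : ℝ)) / logFactor p d κ δ (budget N T M) ^ q ≤ M
  M_upper : M ≤ c₂ * (budget N T M ^ (2 / 3 : ℝ) * ((p : ℝ) ^ (1 / 3 : ℝ) / (d : ℝ) ^ (2 / 3 : ℝ)) *
    (1 / κ) ^ (4 / 3 : ℝ) * δ ^ (1 / 3 : ℝ)) * logFactor p d κ δ (budget N T M) ^ q

/-- The approximation term: the sum of `lam_k ^ 2` over `k > p`. -/
def tailSq {d : ℕ} (lam : Fin d → ℝ) (p : ℕ) : ℝ := ∑ k : Fin d, if p ≤ k.val then lam k ^ 2 else 0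

/-- The sum of the first `p` entries of `lam`. -/
def headSum {d : ℕ} (lam : Fin d → ℝ) (p : ℕ) : ℝ := ∑ k : Fin d, if k.val < p then lam k else 0

end LowRankSVI

end

noncomputable section

namespace LowRankSVI

/-! Write `A = ∑ xᵢ xᵢᵀ`. The gradient of the potential is linear, so the central differences of the
second stage return `u_kᵀ A u_k` exactly, and one update of the first stage is, up to the factor
`N`, `A (I + E_t) U_t`, where `E_t` is the deviation of the sample covariance of iteration `t` from
`I`. The algorithm is a subspace iteration with multiplicative noise, followed by an exact
compression.

Reduction to Rayleigh quotients. Let `B = (A - α I) / n` have eigenvalues `b_k`, and let `β_k = u_kᵀ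
B u_k`. By Pythagoras the squared distance of `B` to `∑ β_k u_k u_kᵀ` is `‖B‖² - ∑ β_k²`. Thus only
lower bounds `β_k ≥ b_k - D` are needed; eigenvectors need not converge, and no spectral gap enters.
Comparing `b_k` with `λ_k*` by the Hoffman–Wielandt inequality yields the tail sum, `D` times the
head sum, and the sampling error (`sqNorm_sub_compression_le`).

Gap-free convergence. Since the QR factors are triangular, the `k`-th final column can be traced
back to a vector in the span of `e₁, …, e_k`, which overlaps with the top `k` eigenvectors. Its
spectral coordinates follow `c ↦ Λ (c + g)`. A power step raises the Rayleigh quotient by at least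
its spectral variance over `L` (`rayleigh_mul_ge`); noise of relative size `ε` costs half of this
gain plus `6 L ε²` (`rayleigh_perturb`). As long as a fixed share of the mass lies on the top
eigenvectors, the variance dominates the squared deficit, and a Riccati recursion makes the deficit
of order `L / T` (`sub_rayleigh_le`). The mass condition is guaranteed for a fixed fraction of the
`T` steps; afterwards the quotient loses at most the accumulated noise.

Probability. Two events suffice, of probability at most `δ / 2` each. The matrix `A` is close to its
mean in Frobenius norm by a bounded difference inequality for Lipschitz functions of sums. The
scaled noise `T ∑ ‖E_t U_t‖²` is bounded by Markov's inequality for its square, hence by fourth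
moments of `E_t U_t`; the allocation makes `(T² p d / N)²` of order `δ`. Because the frames `U_t`
are arbitrary QR factors, not assumed measurable, the noise is expressed by projections onto the
columns of the unnormalized iteration (`sketch`), a measurable function of data and earlier samples.
-/

/-- The squared Frobenius norm of a rectangular matrix. -/
def sqNorm {ι κ : Type*} [Fintype ι] [Fintype κ] (A : Matrix ι κ ℝ) : ℝ := ∑ i, ∑ j, A i j ^ 2

/-! ### Frobenius norms -/

section SqNorm

variable {ι κ : Type*} [Fintype ι] [Fintype κ]

lemma sqNorm_nonneg (A : Matrix ι κ ℝ) : 0 ≤ sqNorm A :=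
  Finset.sum_nonneg fun _ _ => Finset.sum_nonneg fun _ _ => sq_nonneg _

lemma sqNorm_eq_trace (A : Matrix ι κ ℝ) : sqNorm A = (A * Aᵀ).trace := by
  simp [sqNorm, Matrix.trace, Matrix.mul_apply, sq]

lemma sqNorm_add_le (A B : Matrix ι κ ℝ) : sqNorm (A + B) ≤ 2 * sqNorm A + 2 * sqNorm B := by
  simp only [sqNorm, Finset.mul_sum, ← Finset.sum_add_distrib]
  refine Finset.sum_le_sum fun i _ => Finset.sum_le_sum fun j _ => ?_
  simp only [Matrix.add_apply]
  nlinarith [sq_nonneg (A i j - B i j)]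

lemma sqNorm_smul (c : ℝ) (A : Matrix ι κ ℝ) : sqNorm (c • A) = c ^ 2 * sqNorm A := by
  simp [sqNorm, Finset.mul_sum, mul_pow]

lemma sum_mulVec_sq_le (A : Matrix ι κ ℝ) (y : κ → ℝ) :
    ∑ i, (A *ᵥ y) i ^ 2 ≤ sqNorm A * ∑ j, y j ^ 2 := by
  rw [sqNorm, Finset.sum_mul]
  refine Finset.sum_le_sum fun i _ => ?_
  exact Finset.sum_mul_sq_le_sq_mul_sq Finset.univ (fun j => A i j) y

end SqNorm

/-! ### Orthonormal frames, compressions and eigenvalue comparison -/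

section Orthonormal

variable {ι κ : Type*} [Fintype ι] [Fintype κ] [DecidableEq κ]

lemma sum_mulVec_sq_of_orthonormal {U : Matrix ι κ ℝ} (hU : Uᵀ * U = 1) (y : κ → ℝ) :
    ∑ i, (U *ᵥ y) i ^ 2 = ∑ j, y j ^ 2 := by
  have h : (U *ᵥ y) ⬝ᵥ (U *ᵥ y) = y ⬝ᵥ y := by
    rw [Matrix.dotProduct_mulVec, Matrix.vecMul_mulVec, hU, Matrix.vecMul_one]
  simpa [dotProduct, sq] using h

lemma dotProduct_conj_diagonal {ι : Type*} [Fintype ι] [DecidableEq ι] (V : Matrix ι ι ℝ)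
    (lam : ι → ℝ) (x y : ι → ℝ) :
    x ⬝ᵥ ((V * Matrix.diagonal lam * Vᵀ) *ᵥ y) = ∑ i, lam i * (Vᵀ *ᵥ x) i * (Vᵀ *ᵥ y) i := by
  rw [← Matrix.mulVec_mulVec, ← Matrix.mulVec_mulVec, Matrix.dotProduct_mulVec,
    ← Matrix.mulVec_transpose]
  simp only [dotProduct, Matrix.mulVec_diagonal]
  exact Finset.sum_congr rfl fun i _ => by ring

/-- The distance of a symmetric matrix `B` to its projection onto the span of the `u_k u_kᵀ`. -/
lemma sqNorm_sub_compression {B : Matrix ι ι ℝ} (hB : Bᵀ = B) {U : Matrix ι κ ℝ}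
    (hU : Uᵀ * U = 1) :
    sqNorm (B - U * Matrix.diagonal (fun k => (Uᵀ * B * U) k k) * Uᵀ) =
      sqNorm B - ∑ k, (Uᵀ * B * U) k k ^ 2 := by
  set β : κ → ℝ := fun k => (Uᵀ * B * U) k k with hβ
  set D := Matrix.diagonal β with hD
  -- The inner product of `B` with the compression equals the squared norm of the compression
  -- (`h2`), so the compression is orthogonal to the remainder.
  have h1 : (B * (U * D * Uᵀ)).trace = ∑ k, β k ^ 2 := by
    rw [show B * (U * D * Uᵀ) = (B * U * D) * Uᵀ by simp only [Matrix.mul_assoc],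
      Matrix.trace_mul_comm, show Uᵀ * (B * U * D) = (Uᵀ * B * U) * D by
        simp only [Matrix.mul_assoc]]
    simp [Matrix.trace, hD, Matrix.mul_diagonal, hβ, sq]
  have h2 : ((U * D * Uᵀ) * (U * D * Uᵀ)).trace = ∑ k, β k ^ 2 := by
    rw [show (U * D * Uᵀ) * (U * D * Uᵀ) = (U * D * (Uᵀ * U) * D) * Uᵀ by
        simp only [Matrix.mul_assoc], hU, Matrix.mul_one, Matrix.trace_mul_comm,
      show Uᵀ * (U * D * D) = Uᵀ * U * (D * D) by simp only [Matrix.mul_assoc], hU, Matrix.one_mul,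
      hD, Matrix.diagonal_mul_diagonal]
    simp [Matrix.trace, sq]
  have h3 : (U * D * Uᵀ)ᵀ = U * D * Uᵀ := by
    rw [Matrix.transpose_mul, Matrix.transpose_mul, Matrix.transpose_transpose, hD,
      Matrix.diagonal_transpose, Matrix.mul_assoc]
  rw [sqNorm_eq_trace, sqNorm_eq_trace, Matrix.transpose_sub, h3, hB, Matrix.sub_mul,
    Matrix.mul_sub, Matrix.mul_sub, Matrix.trace_sub, Matrix.trace_sub, Matrix.trace_sub, h1, h2,
    Matrix.trace_mul_comm (U * D * Uᵀ) B, h1]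
  ring

lemma sqNorm_conj_diagonal {ι : Type*} [Fintype ι] [DecidableEq ι] {V : Matrix ι ι ℝ}
    (hV : Vᵀ * V = 1) (b : ι → ℝ) :
    sqNorm (V * Matrix.diagonal b * Vᵀ) = ∑ i, b i ^ 2 := by
  have h3 : (V * Matrix.diagonal b * Vᵀ)ᵀ = V * Matrix.diagonal b * Vᵀ := by
    rw [Matrix.transpose_mul, Matrix.transpose_mul, Matrix.transpose_transpose,
      Matrix.diagonal_transpose, Matrix.mul_assoc]
  rw [sqNorm_eq_trace, h3, show (V * Matrix.diagonal b * Vᵀ) * (V * Matrix.diagonal b * Vᵀ)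
      = (V * Matrix.diagonal b * (Vᵀ * V) * Matrix.diagonal b) * Vᵀ by
        simp only [Matrix.mul_assoc], hV, Matrix.mul_one, Matrix.trace_mul_comm,
      show Vᵀ * (V * Matrix.diagonal b * Matrix.diagonal b) =
        Vᵀ * V * (Matrix.diagonal b * Matrix.diagonal b) by simp only [Matrix.mul_assoc], hV,
      Matrix.one_mul, Matrix.diagonal_mul_diagonal]
  simp [Matrix.trace, sq]

end Orthonormal

lemma IsSortedEigendecomposition.transpose_eq {d : ℕ} {A V : Matrix (Fin d) (Fin d) ℝ}
    {lam : Fin d → ℝ} (h : IsSortedEigendecomposition A V lam) : Aᵀ = A := by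
  rw [h.2.2, Matrix.transpose_mul, Matrix.transpose_mul, Matrix.transpose_transpose,
      Matrix.diagonal_transpose, Matrix.mul_assoc]

/-- The rearrangement inequality for a doubly stochastic weight matrix. -/
lemma sum_mul_doublyStochastic_le {d : ℕ} {a b : Fin d → ℝ} (ha : Antitone a) (hb : Antitone b)
    {S : Matrix (Fin d) (Fin d) ℝ} (hS : S ∈ doublyStochastic ℝ (Fin d)) :
    ∑ i, ∑ j, a i * b j * S i j ≤ ∑ i, a i * b i := by
  -- Birkhoff's theorem reduces the claim to permutation matrices, where it is the classical
  -- rearrangement inequality.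
  obtain ⟨w, hw0, hw1, hwS⟩ := exists_eq_sum_perm_of_mem_doublyStochastic hS
  have hab : Monovary a b := fun i j hij =>
    ha (le_of_not_ge fun h => absurd (hb h) (not_le.mpr hij))
  have key : ∀ σ : Equiv.Perm (Fin d),
      ∑ i, ∑ j, a i * b j * (σ.permMatrix ℝ) i j = ∑ i, a i * b (σ i) := fun σ => by
    refine Finset.sum_congr rfl fun i _ => ?_
    simp [Equiv.Perm.permMatrix, PEquiv.toMatrix_apply, Equiv.toPEquiv_apply]
  calc ∑ i, ∑ j, a i * b j * S i j
      = ∑ σ, w σ * ∑ i, ∑ j, a i * b j * (σ.permMatrix ℝ) i j := by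
        rw [← hwS]
        simp only [Matrix.sum_apply, Matrix.smul_apply, smul_eq_mul, Finset.mul_sum]
        rw [Finset.sum_comm]
        conv_lhs => enter [2, j]; rw [Finset.sum_comm]
        rw [Finset.sum_comm]
        refine Finset.sum_congr rfl fun σ _ => ?_
        rw [Finset.sum_comm]
        exact Finset.sum_congr rfl fun i _ => Finset.sum_congr rfl fun j _ => by ring
    _ ≤ ∑ σ, w σ * ∑ i, a i * b i := by
        refine Finset.sum_le_sum fun σ _ => mul_le_mul_of_nonneg_left ?_ (hw0 σ)
        rw [key]
        exact hab.sum_mul_comp_perm_le_sum_mul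
    _ = ∑ i, a i * b i := by rw [← Finset.sum_mul, hw1, one_mul]

/-- The Hoffman–Wielandt inequality for real symmetric matrices. -/
lemma sum_sub_sq_le_sqNorm_sub {d : ℕ} {A B V W : Matrix (Fin d) (Fin d) ℝ} {a b : Fin d → ℝ}
    (hA : IsSortedEigendecomposition A V a) (hB : IsSortedEigendecomposition B W b) :
    ∑ i, (a i - b i) ^ 2 ≤ sqNorm (A - B) := by
  have hAt := hA.transpose_eq
  have hBt := hB.transpose_eq
  obtain ⟨hV, ha, hA⟩ := hA
  obtain ⟨hW, hb, hB⟩ := hB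
  have hV' : V * Vᵀ = 1 := mul_eq_one_comm.mp hV
  have hW' : W * Wᵀ = 1 := mul_eq_one_comm.mp hW
  set Q := Vᵀ * W with hQ
  have hQ1 : Qᵀ * Q = 1 := by
    rw [hQ, Matrix.transpose_mul, Matrix.transpose_transpose,
      show Wᵀ * V * (Vᵀ * W) = Wᵀ * (V * Vᵀ) * W by simp only [Matrix.mul_assoc], hV',
      Matrix.mul_one, hW]
  have hQ2 : Q * Qᵀ = 1 := mul_eq_one_comm.mp hQ1
  -- The trace of `A * B` is a sum of `a i * b j` with the squared entries of an orthogonal matrix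
  -- as weights; the rows and columns of these weights sum to one.
  have hS : (Matrix.of fun i j => Q i j ^ 2) ∈ doublyStochastic ℝ (Fin d) := by
    rw [mem_doublyStochastic_iff_sum]
    refine ⟨fun i j => sq_nonneg _, fun i => ?_, fun j => ?_⟩
    · have := congrFun (congrFun hQ2 i) i
      simpa [Matrix.mul_apply, sq] using this
    · have := congrFun (congrFun hQ1 j) j
      simpa [Matrix.mul_apply, sq] using this
  have htr : (A * B).trace = ∑ i, ∑ j, a i * b j * (Matrix.of fun i j => Q i j ^ 2) i j := by
    rw [hA, hB, show V * Matrix.diagonal a * Vᵀ * (W * Matrix.diagonal b * Wᵀ) =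
      V * (Matrix.diagonal a * (Vᵀ * W) * Matrix.diagonal b * Wᵀ) by simp only [Matrix.mul_assoc],
      Matrix.trace_mul_comm, Matrix.mul_assoc, show Wᵀ * V = Qᵀ by
        rw [hQ, Matrix.transpose_mul, Matrix.transpose_transpose]]
    simp only [Matrix.trace, Matrix.diag_apply, Matrix.mul_apply (N := Qᵀ), Matrix.mul_diagonal,
      Matrix.diagonal_mul, Matrix.transpose_apply, Matrix.of_apply]
    exact Finset.sum_congr rfl fun i _ => Finset.sum_congr rfl fun j _ => by ring
  have h1 := sum_mul_doublyStochastic_le ha hb hS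
  rw [← htr] at h1
  have h2 : sqNorm (A - B) = ∑ i, a i ^ 2 + ∑ i, b i ^ 2 - 2 * (A * B).trace := by
    rw [← sqNorm_conj_diagonal hV a, ← sqNorm_conj_diagonal hW b, ← hA, ← hB]
    simp only [sqNorm_eq_trace]
    rw [Matrix.transpose_sub, hAt, hBt, Matrix.sub_mul, Matrix.mul_sub, Matrix.mul_sub,
      Matrix.trace_sub, Matrix.trace_sub, Matrix.trace_sub, Matrix.trace_mul_comm B A]
    ring
  rw [h2]
  have h3 : ∑ i, (a i - b i) ^ 2 = ∑ i, a i ^ 2 + ∑ i, b i ^ 2 - 2 * ∑ i, a i * b i := by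
    rw [Finset.mul_sum, ← Finset.sum_add_distrib, ← Finset.sum_sub_distrib]
    exact Finset.sum_congr rfl fun i _ => by ring
  linarith

/-- A square matrix and its transpose have the same smallest singular value. -/
lemma SigmaMinGE.transpose {k : ℕ} {B : Matrix (Fin k) (Fin k) ℝ} {m : ℝ} (hm : 0 < m)
    (h : SigmaMinGE B m) : SigmaMinGE Bᵀ m := by
  have hinj : Function.Injective B.mulVec := by
    rw [← Matrix.coe_mulVecLin, injective_iff_map_eq_zero]
    intro y hy
    have := h y
    rw [Matrix.mulVecLin_apply] at hy
    rw [hy, dotProduct_zero] at this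
    have h0 : y ⬝ᵥ y ≤ 0 := by
      by_contra hc
      have := mul_pos (pow_pos hm 2) (not_le.mp hc)
      linarith
    exact dotProduct_self_eq_zero.mp (le_antisymm h0
      (Finset.sum_nonneg fun i _ => mul_self_nonneg _))
  have hsurj : Function.Surjective B.mulVec := by
    rw [← Matrix.coe_mulVecLin] at hinj ⊢
    exact LinearMap.injective_iff_surjective.mp hinj
  intro z
  -- As `m > 0`, `B` is invertible and each `z` is `B y`. Then `‖z‖² = ⟨Bᵀ z, y⟩ ≤ ‖Bᵀ z‖ ‖y‖` and
  -- `m ‖y‖ ≤ ‖z‖`.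
  obtain ⟨y, rfl⟩ := hsurj z
  set z := B *ᵥ y
  have h1 : z ⬝ᵥ z = (Bᵀ *ᵥ z) ⬝ᵥ y := by
    rw [Matrix.mulVec_transpose, ← Matrix.dotProduct_mulVec]
  have h2 : ((Bᵀ *ᵥ z) ⬝ᵥ y) ^ 2 ≤ ((Bᵀ *ᵥ z) ⬝ᵥ (Bᵀ *ᵥ z)) * (y ⬝ᵥ y) := by
    have := Finset.sum_mul_sq_le_sq_mul_sq Finset.univ (Bᵀ *ᵥ z) y
    simpa [dotProduct, sq] using this
  have h3 := h y
  rw [← h1] at h2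
  have hz : 0 ≤ z ⬝ᵥ z := Finset.sum_nonneg fun i _ => mul_self_nonneg _
  have hb : 0 ≤ (Bᵀ *ᵥ z) ⬝ᵥ (Bᵀ *ᵥ z) := Finset.sum_nonneg fun i _ => mul_self_nonneg _
  rcases hz.eq_or_lt with h0 | h0
  · rw [← h0, mul_zero]; exact hb
  · have : m ^ 2 * (z ⬝ᵥ z) ^ 2 ≤ ((Bᵀ *ᵥ z) ⬝ᵥ (Bᵀ *ᵥ z)) * (z ⬝ᵥ z) := by
      calc m ^ 2 * (z ⬝ᵥ z) ^ 2 ≤ m ^ 2 * (((Bᵀ *ᵥ z) ⬝ᵥ (Bᵀ *ᵥ z)) * (y ⬝ᵥ y)) := by gcongr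
        _ = ((Bᵀ *ᵥ z) ⬝ᵥ (Bᵀ *ᵥ z)) * (m ^ 2 * (y ⬝ᵥ y)) := by ring
        _ ≤ _ := by gcongr
    nlinarith

/-! ### One noisy power step in spectral coordinates -/

section Step

variable {ι : Type*} [Fintype ι]

/-- The Rayleigh quotient of the diagonal matrix `lam` at `c`. -/
def rayleigh (lam c : ι → ℝ) : ℝ := (∑ i, lam i * c i ^ 2) / ∑ i, c i ^ 2

lemma sum_sq_pos_of_ne {c : ι → ℝ} (h : ∑ i, c i ^ 2 ≠ 0) : 0 < ∑ i, c i ^ 2 :=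
  lt_of_le_of_ne (Finset.sum_nonneg fun _ _ => sq_nonneg _) (Ne.symm h)

lemma rayleigh_nonneg {lam c : ι → ℝ} (h0 : ∀ i, 0 ≤ lam i) : 0 ≤ rayleigh lam c :=
  div_nonneg (Finset.sum_nonneg fun i _ => mul_nonneg (h0 i) (sq_nonneg _))
    (Finset.sum_nonneg fun _ _ => sq_nonneg _)

lemma rayleigh_le {lam c : ι → ℝ} {L : ℝ} (hL : 0 ≤ L) (h1 : ∀ i, lam i ≤ L) :
    rayleigh lam c ≤ L := by
  refine div_le_of_le_mul₀ (Finset.sum_nonneg fun _ _ => sq_nonneg _) hL ?_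
  rw [Finset.mul_sum]
  exact Finset.sum_le_sum fun i _ => mul_le_mul_of_nonneg_right (h1 i) (sq_nonneg _)

/-- The spectral variance of `v`, not normalized. -/
def specVar (lam v : ι → ℝ) : ℝ := ∑ i, (lam i - rayleigh lam v) ^ 2 * v i ^ 2

lemma specVar_nonneg (lam v : ι → ℝ) : 0 ≤ specVar lam v :=
  Finset.sum_nonneg fun _ _ => mul_nonneg (sq_nonneg _) (sq_nonneg _)

/-- With the moments `s_j = ∑ lam^j v²`, Cauchy–Schwarz gives `s₃ / s₂ ≥ s₂ / s₁`, and `s₂ / s₁`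
exceeds the old quotient `s₁ / s₀` by exactly the variance over `s₁ ≤ L s₀`. -/
lemma rayleigh_mul_ge {lam v : ι → ℝ} {L : ℝ} (h0 : ∀ i, 0 ≤ lam i)
    (hL : 0 < L) (h1 : ∀ i, lam i ≤ L) (hv : ∑ i, (lam i * v i) ^ 2 ≠ 0) :
    rayleigh lam v + specVar lam v / (L * ∑ i, v i ^ 2) ≤ rayleigh lam fun i => lam i * v i := by
  set s0 := ∑ i, v i ^ 2 with hs0
  set s1 := ∑ i, lam i * v i ^ 2 with hs1
  set s2 := ∑ i, (lam i * v i) ^ 2 with hs2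
  set s3 := ∑ i, lam i * (lam i * v i) ^ 2 with hs3
  have p2 : 0 < s2 := sum_sq_pos_of_ne hv
  have p0 : 0 < s0 := by
    refine sum_sq_pos_of_ne fun h => hv ?_
    rw [Finset.sum_eq_zero_iff_of_nonneg fun _ _ => sq_nonneg _] at h
    refine Finset.sum_eq_zero fun i hi => ?_
    have := h i hi
    rw [mul_pow, this, mul_zero]
  have h21 : s2 ≤ L * s1 := by
    rw [hs1, hs2, Finset.mul_sum]
    refine Finset.sum_le_sum fun i _ => ?_
    have := mul_le_mul_of_nonneg_right (h1 i) (mul_nonneg (h0 i) (sq_nonneg (v i)))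
    nlinarith
  have p1 : 0 < s1 := by
    by_contra h
    have := mul_nonpos_of_nonneg_of_nonpos hL.le (not_lt.mp h)
    linarith
  have hcs : s2 ^ 2 ≤ s1 * s3 := by
    have := Finset.sum_sq_le_sum_mul_sum_of_sq_le_mul Finset.univ
      (r := fun i => (lam i * v i) ^ 2) (f := fun i => lam i * v i ^ 2)
      (g := fun i => lam i * (lam i * v i) ^ 2)
      (fun i _ => mul_nonneg (h0 i) (sq_nonneg _)) (fun i _ => mul_nonneg (h0 i) (sq_nonneg _))
      (fun i _ => le_of_eq (by ring))
    exact this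
  have h10 : s1 ≤ L * s0 := by
    rw [hs1, hs0, Finset.mul_sum]
    exact Finset.sum_le_sum fun i _ => mul_le_mul_of_nonneg_right (h1 i) (sq_nonneg _)
  have hr : rayleigh lam v = s1 / s0 := rfl
  have hvar : specVar lam v = s2 - s1 ^ 2 / s0 := by
    have : specVar lam v = s2 - 2 * rayleigh lam v * s1 + rayleigh lam v ^ 2 * s0 := by
      rw [specVar, hs2, hs1, hs0, Finset.mul_sum, Finset.mul_sum, ← Finset.sum_sub_distrib,
        ← Finset.sum_add_distrib]
      exact Finset.sum_congr rfl fun i _ => by ring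
    rw [this, hr]
    field_simp
    ring
  have hr' : (rayleigh lam fun i => lam i * v i) = s3 / s2 := rfl
  have hvar0 := specVar_nonneg lam v
  rw [hr, hr']
  have e1 : s2 / s1 ≤ s3 / s2 := by
    rw [div_le_div_iff₀ p1 p2]; nlinarith
  have e2 : specVar lam v / (L * s0) ≤ specVar lam v / s1 :=
    div_le_div_of_nonneg_left hvar0 p1 h10
  have e3 : s1 / s0 + specVar lam v / s1 = s2 / s1 := by
    rw [hvar]; field_simp; ring
  linarith

/-- The first-order effect of the perturbation is a cross term `(lam - r) v g`, bounded by the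
standard deviation of `v` times the norm of `g`. Young's inequality trades it for half of the gain
in `rayleigh_mul_ge` and a loss quadratic in `ε`; a loss linear in `ε` would be too large to sum
over the run. -/
lemma rayleigh_perturb {lam c g : ι → ℝ} {L ε : ℝ} (h0 : ∀ i, 0 ≤ lam i)
    (hL : 0 < L) (h1 : ∀ i, lam i ≤ L) (hε : ε ^ 2 ≤ 1 / 4)
    (hg : ∑ i, g i ^ 2 ≤ ε ^ 2 * ∑ i, c i ^ 2) (hc : ∑ i, c i ^ 2 ≠ 0) :
    rayleigh lam c ≤ rayleigh lam (fun i => c i + g i) +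
      specVar lam (fun i => c i + g i) / (2 * (L * ∑ i, (c i + g i) ^ 2)) + 6 * L * ε ^ 2 := by
  set v : ι → ℝ := fun i => c i + g i with hv
  have hvi : ∀ i, v i = c i + g i := fun i => rfl
  simp only [← hvi]
  set r := rayleigh lam v with hr
  set n0 := ∑ i, c i ^ 2 with hn0
  set s0 := ∑ i, v i ^ 2 with hs0
  have pn : 0 < n0 := sum_sq_pos_of_ne hc
  have hV := specVar_nonneg lam v
  set V := specVar lam v with hVdef
  have hr0 : 0 ≤ r := rayleigh_nonneg h0
  have hrL : r ≤ L := rayleigh_le hL.le h1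
  have hs0n : s0 ≤ 5 / 2 * n0 := by
    have : s0 ≤ 2 * n0 + 2 * ∑ i, g i ^ 2 := by
      rw [hs0, hn0, Finset.mul_sum, Finset.mul_sum, ← Finset.sum_add_distrib]
      refine Finset.sum_le_sum fun i _ => ?_
      rw [hvi]; nlinarith [sq_nonneg (c i - g i)]
    nlinarith
  have ps0 : 0 < s0 := by
    have : n0 ≤ 2 * s0 + 2 * ∑ i, g i ^ 2 := by
      rw [hs0, hn0, Finset.mul_sum, Finset.mul_sum, ← Finset.sum_add_distrib]
      refine Finset.sum_le_sum fun i _ => ?_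
      rw [hvi]; nlinarith [sq_nonneg (c i + 2 * g i)]
    nlinarith
  have hzero : ∑ i, (lam i - r) * v i ^ 2 = 0 := by
    have : ∑ i, (lam i - r) * v i ^ 2 = ∑ i, lam i * v i ^ 2 - r * s0 := by
      rw [hs0, Finset.mul_sum, ← Finset.sum_sub_distrib]
      exact Finset.sum_congr rfl fun i _ => by ring
    rw [this, hr, rayleigh, ← hs0]
    field_simp
    ring
  have key : ∑ i, (lam i - r) * c i ^ 2 ≤ 1 / (5 * L) * V + 6 * L * ∑ i, g i ^ 2 := by
    have : ∑ i, (lam i - r) * c i ^ 2 - ∑ i, (lam i - r) * v i ^ 2 ≤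
        1 / (5 * L) * V + 6 * L * ∑ i, g i ^ 2 := by
      rw [hVdef, specVar, Finset.mul_sum, Finset.mul_sum, ← Finset.sum_sub_distrib,
        ← Finset.sum_add_distrib]
      refine Finset.sum_le_sum fun i _ => ?_
      have hci : c i = v i - g i := by rw [hvi]; ring
      rw [hci, ← hr]
      set x := (lam i - r) * v i with hx
      have e1 : (lam i - r) * (v i - g i) ^ 2 - (lam i - r) * v i ^ 2 =
          -2 * x * g i + (lam i - r) * g i ^ 2 := by rw [hx]; ring
      have e2 : (lam i - r) ^ 2 * v i ^ 2 = x ^ 2 := by rw [hx]; ring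
      rw [e1, e2]
      have e3 : (lam i - r) * g i ^ 2 ≤ L * g i ^ 2 :=
        mul_le_mul_of_nonneg_right (by linarith [h1 i]) (sq_nonneg _)
      -- The weight `5 L` matches `s0 ≤ 5/2 * n0`: after division by `n0`, the variance term is at
      -- most `V / (2 L s0)`. The constant 6 is this 5 plus 1 from the term quadratic in `g`.
      have e4 : -2 * x * g i ≤ 1 / (5 * L) * x ^ 2 + 5 * L * g i ^ 2 := by
        have : 1 / (5 * L) * x ^ 2 + 5 * L * g i ^ 2 + 2 * x * g i =
            1 / (5 * L) * (x + 5 * L * g i) ^ 2 := by field_simp; ring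
        have h' : 0 ≤ 1 / (5 * L) * (x + 5 * L * g i) ^ 2 := by positivity
        linarith
      linarith
    linarith
  have hρ : rayleigh lam c - r = (∑ i, (lam i - r) * c i ^ 2) / n0 := by
    have : ∑ i, (lam i - r) * c i ^ 2 = ∑ i, lam i * c i ^ 2 - r * n0 := by
      rw [hn0, Finset.mul_sum, ← Finset.sum_sub_distrib]
      exact Finset.sum_congr rfl fun i _ => by ring
    rw [this, rayleigh, ← hn0]
    field_simp
  have f1 : rayleigh lam c - r ≤ (1 / (5 * L) * V + 6 * L * (ε ^ 2 * n0)) / n0 := by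
    rw [hρ]
    refine div_le_div_of_nonneg_right (key.trans ?_) pn.le
    gcongr
  have f2 : (1 / (5 * L) * V + 6 * L * (ε ^ 2 * n0)) / n0 = V / (5 * L * n0) + 6 * L * ε ^ 2 := by
    field_simp
  have f3 : V / (5 * L * n0) ≤ V / (2 * (L * s0)) :=
    div_le_div_of_nonneg_left hV (by positivity) (by nlinarith)
  linarith

/-- One step of the noisy power iteration: the Rayleigh quotient `ρ` loses at most `O(ε²)`, and the
deficit `lam₀ - ρ` contracts quadratically as long as the iterate has mass on eigenvalues that are
at least `lam₀`. -/
lemma rayleigh_step {lam c g : ι → ℝ} {L ε μ lam₀ : ℝ} {s : Finset ι} (h0 : ∀ i, 0 ≤ lam i)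
    (hL : 0 < L) (h1 : ∀ i, lam i ≤ L) (hε : ε ^ 2 ≤ 1 / 4) (hs : ∀ i ∈ s, lam₀ ≤ lam i)
    (hg : ∑ i, g i ^ 2 ≤ ε ^ 2 * ∑ i, c i ^ 2) (hc : ∑ i, c i ^ 2 ≠ 0)
    (hv : ∑ i, (lam i * (c i + g i)) ^ 2 ≠ 0)
    (hμ : μ * ∑ i, (c i + g i) ^ 2 ≤ ∑ i ∈ s, (c i + g i) ^ 2) :
    (lam₀ - rayleigh lam fun i => lam i * (c i + g i)) +
      μ / (2 * L) * max (lam₀ - rayleigh lam fun i => lam i * (c i + g i)) 0 ^ 2 ≤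
      (lam₀ - rayleigh lam c) + 6 * L * ε ^ 2 := by
  have a1 := rayleigh_mul_ge (v := fun i => c i + g i) h0 hL h1 hv
  have a2 := rayleigh_perturb h0 hL h1 hε hg hc
  have hV := specVar_nonneg lam (fun i => c i + g i)
  set V := specVar lam (fun i => c i + g i) with hVdef
  set r := rayleigh lam (fun i => c i + g i) with hr
  set r' := rayleigh lam fun i => lam i * (c i + g i) with hr'
  set s0 := ∑ i, (c i + g i) ^ 2 with hs0
  have ps0 : 0 < s0 := by
    refine sum_sq_pos_of_ne fun h => hv ?_
    rw [Finset.sum_eq_zero_iff_of_nonneg fun _ _ => sq_nonneg _] at h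
    refine Finset.sum_eq_zero fun i hi => ?_
    rw [mul_pow, h i hi, mul_zero]
  have hD : lam₀ - r' ≤ lam₀ - r := by
    have : 0 ≤ V / (L * s0) := by positivity
    linarith
  -- On `s` each eigenvalue is at distance at least `lam₀ - r` above `r` when this is positive, so
  -- the mass on `s` alone bounds the variance from below. Replacing `r` by the larger `r'` makes
  -- the recursion implicit, the form used in `riccati_bound`.
  have hVl : μ * s0 * max (lam₀ - r') 0 ^ 2 ≤ V := by
    have b1 : max (lam₀ - r') 0 ^ 2 ≤ max (lam₀ - r) 0 ^ 2 := by gcongr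
    calc μ * s0 * max (lam₀ - r') 0 ^ 2 ≤ (∑ i ∈ s, (c i + g i) ^ 2) * max (lam₀ - r) 0 ^ 2 := by
          gcongr
      _ ≤ ∑ i ∈ s, (lam i - r) ^ 2 * (c i + g i) ^ 2 := by
          rw [Finset.sum_mul]
          refine Finset.sum_le_sum fun i hi => ?_
          rw [mul_comm]
          refine mul_le_mul_of_nonneg_right ?_ (sq_nonneg _)
          rcases le_total (lam₀ - r) 0 with h | h
          · rw [max_eq_right h, zero_pow two_ne_zero]; positivity
          · rw [max_eq_left h]
            have := hs i hi
            exact pow_le_pow_left₀ h (by linarith) 2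
      _ ≤ V := Finset.sum_le_sum_of_subset_of_nonneg (Finset.subset_univ _)
          fun _ _ _ => mul_nonneg (sq_nonneg _) (sq_nonneg _)
  have b2 : μ / (2 * L) * max (lam₀ - r') 0 ^ 2 ≤ V / (2 * (L * s0)) := by
    rw [le_div_iff₀ (by positivity)]
    calc μ / (2 * L) * max (lam₀ - r') 0 ^ 2 * (2 * (L * s0))
        = μ * s0 * max (lam₀ - r') 0 ^ 2 := by field_simp
      _ ≤ V := hVl
  have b3 : V / (L * s0) = V / (2 * (L * s0)) + V / (2 * (L * s0)) := by field_simp; ring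
  linarith

end Step

/-- A discrete Riccati inequality. -/
lemma riccati_bound {x : ℕ → ℝ} {c : ℝ} (hc : 0 < c) (hc1 : c ≤ 1) {t : ℕ}
    (h1 : x 0 ≤ 1) (h : ∀ s < t, x (s + 1) + c * max (x (s + 1)) 0 ^ 2 ≤ x s) :
    x t ≤ 2 / (c * (t + 1)) := by
  induction t with
  | zero =>
    refine h1.trans ?_
    rw [le_div_iff₀ (by positivity)]
    push_cast; linarith
  | succ t ih =>
    have ih := ih fun s hs => h s (by omega)
    have hs := h t (by omega)
    by_contra hcon
    rw [not_le] at hcon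
    set B : ℝ := 2 / c with hB
    have hBpos : 0 < B := by positivity
    have hcB : c * B = 2 := by rw [hB]; field_simp
    have e1 : 2 / (c * ((t : ℝ) + 1)) = B / (t + 1) := by rw [hB]; field_simp
    have e2 : 2 / (c * (((t + 1 : ℕ) : ℝ) + 1)) = B / (t + 2) := by
      rw [hB]; push_cast; field_simp; ring
    rw [e1] at ih
    rw [e2] at hcon
    have hpos : 0 < B / ((t : ℝ) + 2) := by positivity
    rw [max_eq_left (hpos.trans hcon).le] at hs
    have f1 : (B / ((t : ℝ) + 2)) ^ 2 ≤ x (t + 1) ^ 2 := by gcongr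
    -- Since `c * B = 2`, this is `t + 2 ≤ 2 (t + 1)`, with equality at `t = 0`; hence the 2 in the
    -- bound.
    have f2 : B / ((t : ℝ) + 1) ≤ B / (t + 2) + c * (B / ((t : ℝ) + 2)) ^ 2 := by
      have : c * (B / ((t : ℝ) + 2)) ^ 2 = 2 * B / (t + 2) ^ 2 := by
        rw [div_pow, mul_div_assoc', show c * B ^ 2 = (c * B) * B by ring, hcB]
      rw [this, div_add_div _ _ (by positivity) (by positivity),
        div_le_div_iff₀ (by positivity) (by positivity)]
      have ht : (0 : ℝ) ≤ t := Nat.cast_nonneg t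
      have : 0 ≤ B * ((t : ℝ) + 2) * (t : ℝ) := by positivity
      nlinarith
    have f3 := mul_le_mul_of_nonneg_left f1 hc.le
    linarith

/-! ### Mass on the leading eigenvectors and convergence without a gap -/

section Head

variable {ι : Type*} [Fintype ι] [DecidableEq ι]

/-- The Euclidean norm of the restriction of `c` to `s`. -/
def restrNorm {ι : Type*} (s : Finset ι) (c : ι → ℝ) : ℝ := √(∑ i ∈ s, c i ^ 2)

lemma restrNorm_nonneg {ι : Type*} (s : Finset ι) (c : ι → ℝ) : 0 ≤ restrNorm s c :=
  Real.sqrt_nonneg _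

lemma restrNorm_sq {ι : Type*} (s : Finset ι) (c : ι → ℝ) :
    restrNorm s c ^ 2 = ∑ i ∈ s, c i ^ 2 :=
  Real.sq_sqrt (Finset.sum_nonneg fun _ _ => sq_nonneg _)

lemma restrNorm_add_le {ι : Type*} (s : Finset ι) (c g : ι → ℝ) :
    restrNorm s (fun i => c i + g i) ≤ restrNorm s c + restrNorm s g := by
  have h1 := restrNorm_nonneg s c
  have h2 := restrNorm_nonneg s g
  refine (Real.sqrt_le_left (by positivity)).mpr ?_
  have h3 : ∑ i ∈ s, c i * g i ≤ restrNorm s c * restrNorm s g :=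
    Real.sum_mul_le_sqrt_mul_sqrt s c g
  have : ∑ i ∈ s, (c i + g i) ^ 2 =
      ∑ i ∈ s, c i ^ 2 + 2 * ∑ i ∈ s, c i * g i + ∑ i ∈ s, g i ^ 2 := by
    rw [Finset.mul_sum, ← Finset.sum_add_distrib, ← Finset.sum_add_distrib]
    exact Finset.sum_congr rfl fun i _ => by ring
  rw [this, ← restrNorm_sq, ← restrNorm_sq]
  nlinarith

lemma restrNorm_neg {ι : Type*} (s : Finset ι) (g : ι → ℝ) :
    restrNorm s (fun i => - g i) = restrNorm s g := by simp [restrNorm]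

lemma restrNorm_mono {ι : Type*} {s t : Finset ι} (h : s ⊆ t) (c : ι → ℝ) :
    restrNorm s c ≤ restrNorm t c :=
  Real.sqrt_le_sqrt (Finset.sum_le_sum_of_subset_of_nonneg h fun _ _ _ => sq_nonneg _)

lemma restrNorm_univ_le (s : Finset ι) (c : ι → ℝ) :
    restrNorm Finset.univ c ≤ restrNorm s c + restrNorm sᶜ c := by
  have h1 := restrNorm_nonneg s c
  have h2 := restrNorm_nonneg sᶜ c
  refine (Real.sqrt_le_left (by positivity)).mpr ?_
  rw [← Finset.sum_add_sum_compl s, ← restrNorm_sq, ← restrNorm_sq]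
  nlinarith

lemma restrNorm_mul_le {ι : Type*} {s : Finset ι} {lam v : ι → ℝ} {lam₀ : ℝ}
    (h0 : ∀ i ∈ s, 0 ≤ lam i)
    (hs : ∀ i ∈ s, lam i ≤ lam₀) (hl : 0 ≤ lam₀) :
    restrNorm s (fun i => lam i * v i) ≤ lam₀ * restrNorm s v := by
  refine (Real.sqrt_le_left (mul_nonneg hl (restrNorm_nonneg _ _))).mpr ?_
  rw [mul_pow, restrNorm_sq, Finset.mul_sum]
  refine Finset.sum_le_sum fun i hi => ?_
  rw [mul_pow]
  exact mul_le_mul_of_nonneg_right (pow_le_pow_left₀ (h0 i hi) (hs i hi) 2) (sq_nonneg _)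

lemma le_restrNorm_mul {ι : Type*} {s : Finset ι} {lam v : ι → ℝ} {lam₀ : ℝ} (hl : 0 ≤ lam₀)
    (hs : ∀ i ∈ s, lam₀ ≤ lam i) :
    lam₀ * restrNorm s v ≤ restrNorm s (fun i => lam i * v i) := by
  refine Real.le_sqrt_of_sq_le ?_
  rw [mul_pow, restrNorm_sq, Finset.mul_sum]
  refine Finset.sum_le_sum fun i hi => ?_
  rw [mul_pow]
  exact mul_le_mul_of_nonneg_right (pow_le_pow_left₀ hl (hs i hi) 2) (sq_nonneg _)

/-- The whole vector is at most `a` times its head, so the noise adds at most `ε a` heads to the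
tail and removes at most as much from the head. The tail-to-head ratio grows only additively, by `2
a² ε`. Multiplication by the eigenvalues does not increase it, so along the run only the sum of the
`ε` matters. -/
lemma tail_le_head_perturb {s : Finset ι} {c g : ι → ℝ} {ρ a ε : ℝ} (hρ : 0 ≤ ρ)
    (ha : 1 + ρ ≤ a) (hε : 0 ≤ ε) (hε' : 2 * a * ε ≤ 1)
    (hc : restrNorm sᶜ c ≤ ρ * restrNorm s c)
    (hg : restrNorm Finset.univ g ≤ ε * restrNorm Finset.univ c) :
    restrNorm sᶜ (fun i => c i + g i) ≤
      (ρ + 2 * a ^ 2 * ε) * restrNorm s (fun i => c i + g i) := by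
  set h := restrNorm s c with hh
  have hh0 : 0 ≤ h := restrNorm_nonneg _ _
  have hn : restrNorm Finset.univ c ≤ a * h := by
    have := restrNorm_univ_le s c
    nlinarith
  have hG : restrNorm Finset.univ g ≤ ε * (a * h) := hg.trans (by gcongr)
  have h1 : restrNorm sᶜ (fun i => c i + g i) ≤ ρ * h + ε * (a * h) :=
    (restrNorm_add_le _ _ _).trans
      (add_le_add hc ((restrNorm_mono (Finset.subset_univ _) g).trans hG))
  have h2 : h ≤ restrNorm s (fun i => c i + g i) + ε * (a * h) := by
    have := restrNorm_add_le s (fun i => c i + g i) (fun i => - g i)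
    rw [restrNorm_neg] at this
    simp only [add_neg_cancel_right] at this
    exact this.trans
      (add_le_add le_rfl ((restrNorm_mono (Finset.subset_univ _) g).trans hG))
  have h3 : (ρ + 2 * a ^ 2 * ε) * (h - ε * (a * h)) ≤
      (ρ + 2 * a ^ 2 * ε) * restrNorm s (fun i => c i + g i) := by
    gcongr; linarith
  refine h1.trans (le_trans ?_ h3)
  have ha0 : 0 < a := by linarith
  have e1 : (ρ + 2 * a ^ 2 * ε) * (1 - ε * a) - (ρ + ε * a) =
      ε * a * (2 * a - 1 - ρ - 2 * a * ε * a) := by ring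
  have e2 : 0 ≤ 2 * a - 1 - ρ - 2 * a * ε * a := by nlinarith
  have e3 : 0 ≤ ((ρ + 2 * a ^ 2 * ε) * (1 - ε * a) - (ρ + ε * a)) * h := by
    rw [e1]; positivity
  nlinarith

/-- The noisy power iteration in spectral coordinates: after an iterate with overlap at least
`1 / ρ₀` with the eigenvalues that are at least `lam₀`, the Rayleigh quotient exceeds `lam₀` up to
the inverse number of steps and the total squared noise. -/
theorem sub_rayleigh_le {lam : ι → ℝ} {s : Finset ι} {lam₀ L : ℝ} (hlam₀ : 0 ≤ lam₀)
    (hL : 0 < L) (hlL : lam₀ ≤ L) (hs : ∀ i ∈ s, lam₀ ≤ lam i) (hs' : ∀ i ∉ s, lam i ≤ lam₀)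
    (h0 : ∀ i, 0 ≤ lam i) (h1 : ∀ i, lam i ≤ L) {c g : ℕ → ι → ℝ} {ε : ℕ → ℝ} {T t₁ : ℕ}
    (ht₁ : t₁ ≤ T) (hstep : ∀ t < T, c (t + 1) = fun i => lam i * (c t i + g t i))
    (hg : ∀ t < T, ∑ i, g t i ^ 2 ≤ ε t ^ 2 * ∑ i, c t i ^ 2) (hcT : ∑ i, c T i ^ 2 ≠ 0)
    {ρ₀ a : ℝ} (hρ₀ : 0 ≤ ρ₀) (hc0 : ∑ i ∈ sᶜ, c 0 i ^ 2 ≤ ρ₀ ^ 2 * ∑ i ∈ s, c 0 i ^ 2)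
    (ha : 1 + (ρ₀ + 2 * a ^ 2 * ∑ t ∈ Finset.range t₁, ε t) ≤ a)
    (hε : ∀ t < T, 0 ≤ ε t) (hε' : ∀ t < T, 2 * a * ε t ≤ 1) :
    lam₀ - rayleigh lam (c T) ≤
      L * (4 * a ^ 2 / (t₁ + 1) + 6 * ∑ t ∈ Finset.range T, ε t ^ 2) := by
  have hsum0 : 0 ≤ ∑ t ∈ Finset.range t₁, ε t :=
    Finset.sum_nonneg fun t ht => hε t (by have := Finset.mem_range.mp ht; omega)
  have ha1 : 1 ≤ a := by
    have : 0 ≤ 2 * a ^ 2 * ∑ t ∈ Finset.range t₁, ε t := by positivity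
    linarith
  -- The noise is relative to the iterate, so a zero iterate would remain zero up to time `T`.
  have hne : ∀ t ≤ T, ∑ i, c t i ^ 2 ≠ 0 := by
    intro t ht
    induction ht using Nat.decreasingInduction with
    | self => exact hcT
    | of_succ t ht ih =>
      intro hzero
      have hgz : ∑ i, g t i ^ 2 = 0 :=
        le_antisymm (by have := hg t ht; rwa [hzero, mul_zero] at this)
          (Finset.sum_nonneg fun _ _ => sq_nonneg _)
      rw [Finset.sum_eq_zero_iff_of_nonneg fun _ _ => sq_nonneg _] at hzero hgz
      refine ih (Finset.sum_eq_zero fun i hi => ?_)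
      have e1 : c t i = 0 := by simpa using hzero i hi
      have e2 : g t i = 0 := by simpa using hgz i hi
      simp [hstep t ht, e1, e2]
  have hεsq : ∀ t < T, ε t ^ 2 ≤ 1 / 4 := fun t ht => by
    have h2 : ε t ≤ 1 / 2 := by nlinarith [hε t ht, hε' t ht]
    nlinarith [hε t ht]
  have hgn : ∀ t < T, restrNorm Finset.univ (g t) ≤ ε t * restrNorm Finset.univ (c t) := by
    intro t ht
    refine (Real.sqrt_le_left (mul_nonneg (hε t ht) (restrNorm_nonneg _ _))).mpr ?_
    rw [mul_pow, restrNorm_sq]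
    exact hg t ht
  have hρle : ∀ t ≤ t₁, 1 + (ρ₀ + 2 * a ^ 2 * ∑ u ∈ Finset.range t, ε u) ≤ a := by
    intro t ht
    refine le_trans ?_ ha
    gcongr
    exact fun i hi _ => hε i (by have := Finset.mem_range.mp hi; omega)
  have hρnn : ∀ t ≤ t₁, 0 ≤ ρ₀ + 2 * a ^ 2 * ∑ u ∈ Finset.range t, ε u := by
    intro t ht
    have : 0 ≤ ∑ u ∈ Finset.range t, ε u :=
      Finset.sum_nonneg fun u hu => hε u (by have := Finset.mem_range.mp hu; omega)
    positivity
  have hhead : ∀ t ≤ t₁, restrNorm sᶜ (c t) ≤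
      (ρ₀ + 2 * a ^ 2 * ∑ u ∈ Finset.range t, ε u) * restrNorm s (c t) := by
    intro t ht
    induction t with
    | zero =>
      simp only [Finset.range_zero, Finset.sum_empty, mul_zero, add_zero]
      refine (Real.sqrt_le_left (mul_nonneg hρ₀ (restrNorm_nonneg _ _))).mpr ?_
      rw [mul_pow, restrNorm_sq]
      exact hc0
    | succ t ih =>
      have htT : t < T := by omega
      have := tail_le_head_perturb (hρnn t (by omega)) (hρle t (by omega)) (hε t htT)
        (hε' t htT) (ih (by omega)) (hgn t htT)
      rw [hstep t htT, Finset.sum_range_succ, mul_add, ← add_assoc]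
      have hnn := hρnn (t + 1) ht
      rw [Finset.sum_range_succ, mul_add, ← add_assoc] at hnn
      calc _ ≤ lam₀ * restrNorm sᶜ (fun i => c t i + g t i) :=
            restrNorm_mul_le (fun i _ => h0 i)
              (fun i hi => hs' i (Finset.mem_compl.mp hi)) hlam₀
        _ ≤ lam₀ * ((ρ₀ + 2 * a ^ 2 * ∑ u ∈ Finset.range t, ε u + 2 * a ^ 2 * ε t) *
              restrNorm s (fun i => c t i + g t i)) := by gcongr
        _ = (ρ₀ + 2 * a ^ 2 * ∑ u ∈ Finset.range t, ε u + 2 * a ^ 2 * ε t) *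
              (lam₀ * restrNorm s (fun i => c t i + g t i)) := by ring
        _ ≤ _ := mul_le_mul_of_nonneg_left (le_restrNorm_mul hlam₀ hs) hnn
  have hvne : ∀ t < T, ∑ i, (lam i * (c t i + g t i)) ^ 2 ≠ 0 := fun t ht => by
    have := hne (t + 1) ht
    rwa [hstep t ht] at this
  have hmass : ∀ t < t₁, 1 / a ^ 2 * ∑ i, (c t i + g t i) ^ 2 ≤
      ∑ i ∈ s, (c t i + g t i) ^ 2 := by
    intro t ht
    have htT : t < T := by omega
    have h3 := tail_le_head_perturb (hρnn t ht.le) (hρle t ht.le) (hε t htT)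
        (hε' t htT) (hhead t ht.le) (hgn t htT)
    have h4 := hρle (t + 1) ht
    have h5 := hρnn (t + 1) ht
    rw [Finset.sum_range_succ, mul_add, ← add_assoc] at h4 h5
    set v : ι → ℝ := fun i => c t i + g t i
    set r := ρ₀ + 2 * a ^ 2 * ∑ u ∈ Finset.range t, ε u + 2 * a ^ 2 * ε t
    have h6 : restrNorm Finset.univ v ≤ a * restrNorm s v := by
      refine (restrNorm_univ_le s v).trans ?_
      have := restrNorm_nonneg s v
      nlinarith
    have h7 : restrNorm Finset.univ v ^ 2 ≤ (a * restrNorm s v) ^ 2 :=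
      pow_le_pow_left₀ (restrNorm_nonneg _ _) h6 2
    rw [mul_pow, restrNorm_sq, restrNorm_sq] at h7
    rw [one_div, inv_mul_le_iff₀ (by positivity)]
    exact h7
  -- The relative deficit, with the losses `6 ε²` accumulated so far subtracted; this removes the
  -- noise from the recursion.
  set x : ℕ → ℝ := fun t =>
    (lam₀ - rayleigh lam (c t)) / L - 6 * ∑ u ∈ Finset.range t, ε u ^ 2 with hx
  -- Used with `μ = 1 / a²` before `t₁`, where `hmass` holds, and with `μ = 0` afterwards, where it
  -- only says that `x` does not increase.
  have hxstep : ∀ μ : ℝ, 0 ≤ μ → ∀ t < T,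
      μ * ∑ i, (c t i + g t i) ^ 2 ≤ ∑ i ∈ s, (c t i + g t i) ^ 2 →
      x (t + 1) + μ / 2 * max (x (t + 1)) 0 ^ 2 ≤ x t := by
    intro μ hμ0 t ht hμ
    have := rayleigh_step h0 hL h1 (hεsq t ht) hs (hg t ht) (hne t (by omega)) (hvne t ht) hμ
    rw [← hstep t ht] at this
    set D' := lam₀ - rayleigh lam (c (t + 1))
    have hle : max (x (t + 1)) 0 ≤ max D' 0 / L := by
      have hS : 0 ≤ 6 * ∑ u ∈ Finset.range (t + 1), ε u ^ 2 := by positivity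
      refine max_le ?_ (by positivity)
      have : D' / L ≤ max D' 0 / L := by gcongr; exact le_max_left _ _
      simp only [hx]; linarith
    have h8 : max (x (t + 1)) 0 ^ 2 ≤ (max D' 0 / L) ^ 2 := by gcongr
    have h9 : μ / 2 * max (x (t + 1)) 0 ^ 2 ≤ μ / 2 * (max D' 0 / L) ^ 2 := by gcongr
    have h10 : (D' + μ / (2 * L) * max D' 0 ^ 2) / L ≤
        ((lam₀ - rayleigh lam (c t)) + 6 * L * ε t ^ 2) / L := by gcongr
    have h11 : (D' + μ / (2 * L) * max D' 0 ^ 2) / L =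
        D' / L + μ / 2 * (max D' 0 / L) ^ 2 := by field_simp
    have h12 : ((lam₀ - rayleigh lam (c t)) + 6 * L * ε t ^ 2) / L =
        (lam₀ - rayleigh lam (c t)) / L + 6 * ε t ^ 2 := by field_simp
    rw [h11, h12] at h10
    have h13 : x (t + 1) = D' / L - 6 * ∑ u ∈ Finset.range t, ε u ^ 2 - 6 * ε t ^ 2 := by
      simp only [hx, Finset.sum_range_succ, D']; ring
    have h14 : x t = (lam₀ - rayleigh lam (c t)) / L - 6 * ∑ u ∈ Finset.range t, ε u ^ 2 := rfl
    linarith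
  have hx0 : x 0 ≤ 1 := by
    simp only [hx, Finset.range_zero, Finset.sum_empty, mul_zero, sub_zero]
    rw [div_le_one hL]
    have := rayleigh_nonneg (c := c 0) h0
    linarith
  have hx1 : x t₁ ≤ 4 * a ^ 2 / (t₁ + 1) := by
    have hc1 : 1 / a ^ 2 / 2 ≤ 1 := by
      rw [div_div, div_le_one (by positivity)]; nlinarith
    have := riccati_bound (x := x) (c := 1 / a ^ 2 / 2) (by positivity) hc1 hx0
      (t := t₁) fun t ht => hxstep _ (by positivity) t (by omega) (hmass t ht)
    refine this.trans (le_of_eq ?_)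
    field_simp
    ring
  have hx2 : ∀ t, t₁ ≤ t → t ≤ T → x t ≤ x t₁ := by
    intro t h
    induction t, h using Nat.le_induction with
    | base => intro _; exact le_rfl
    | succ t h ih =>
      intro ht
      have := hxstep 0 le_rfl t ht (by rw [zero_mul]; positivity)
      have := ih (by omega)
      linarith
  have hxT := (hx2 T ht₁ le_rfl).trans hx1
  simp only [hx] at hxT
  have : (lam₀ - rayleigh lam (c T)) / L ≤
      4 * a ^ 2 / (t₁ + 1) + 6 * ∑ t ∈ Finset.range T, ε t ^ 2 := by linarith
  rwa [div_le_iff₀' hL] at this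

end Head

/-! ### A bounded difference inequality for Lipschitz functions of sums -/

section BoundedDifferences

variable {E : Type*} [NormedAddCommGroup E] [MeasurableSpace E] [BorelSpace E]

lemma integrable_of_lipschitz_of_bounded {α : Type*} [MeasurableSpace α] {ν : Measure α}
    [IsProbabilityMeasure ν] {f : α → E} (hf : AEMeasurable f ν) {B : ℝ}
    (hB : ∀ᵐ x ∂ν, ‖f x‖ ≤ B) {φ : E → ℝ} (hφ : LipschitzWith 1 φ) :
    Integrable (fun x => φ (f x)) ν := by
  refine Integrable.of_bound (C := ‖φ 0‖ + B)
    (hφ.continuous.measurable.comp_aemeasurable hf).aestronglyMeasurable ?_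
  filter_upwards [hB] with x hx
  have h1 := hφ.dist_le_mul (f x) 0
  rw [dist_zero_right, NNReal.coe_one, one_mul, dist_eq_norm] at h1
  have h2 := norm_sub_norm_le (φ (f x)) (φ 0)
  linarith

lemma integrable_exp_lipschitz_of_bounded {α : Type*} [MeasurableSpace α] {ν : Measure α}
    [IsProbabilityMeasure ν] {f : α → E} (hf : AEMeasurable f ν) {B : ℝ}
    (hB : ∀ᵐ x ∂ν, ‖f x‖ ≤ B) {φ : E → ℝ} (hφ : LipschitzWith 1 φ) (t : ℝ) :
    Integrable (fun x => Real.exp (t * φ (f x))) ν := by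
  refine Integrable.of_bound (C := Real.exp (|t| * (‖φ 0‖ + B)))
    ((Real.measurable_exp.comp (measurable_const.mul
      hφ.continuous.measurable)).comp_aemeasurable hf).aestronglyMeasurable ?_
  filter_upwards [hB] with x hx
  have h1 := hφ.dist_le_mul (f x) 0
  rw [dist_zero_right, NNReal.coe_one, one_mul, dist_eq_norm] at h1
  have h2 := norm_sub_norm_le (φ (f x)) (φ 0)
  rw [Real.norm_eq_abs, Real.abs_exp, Real.exp_le_exp]
  calc t * φ (f x) ≤ |t * φ (f x)| := le_abs_self _
    _ = |t| * ‖φ (f x)‖ := by rw [abs_mul, Real.norm_eq_abs]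
    _ ≤ _ := by gcongr; linarith

/-- Hoeffding's lemma for a Lipschitz function of a random vector in a set of diameter `c`. -/
lemma integral_exp_lipschitz_le {ν : Measure E} [IsProbabilityMeasure ν] {K : Set E}
    (hK : ∀ᵐ x ∂ν, x ∈ K) {c : ℝ} (hc : 0 ≤ c) (hdiam : ∀ x ∈ K, ∀ y ∈ K, ‖x - y‖ ≤ c)
    {φ : E → ℝ} (hφ : LipschitzWith 1 φ) (t : ℝ) :
    ∫ x, Real.exp (t * φ x) ∂ν ≤ Real.exp (t * ∫ x, φ x ∂ν + t ^ 2 * c ^ 2 / 8) := by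
  obtain ⟨x₀, hx₀⟩ : K.Nonempty := by
    by_contra h
    rw [Set.not_nonempty_iff_eq_empty] at h
    rw [h] at hK
    simp only [Set.mem_empty_iff_false, Filter.eventually_false_iff_eq_bot, ae_eq_bot] at hK
    exact IsProbabilityMeasure.ne_zero ν hK
  have hd : ∀ x ∈ K, ∀ y ∈ K, φ x ≤ φ y + c := fun x hx y hy => by
    have := hφ.dist_le_mul x y
    rw [NNReal.coe_one, one_mul, dist_eq_norm, dist_eq_norm] at this
    have := (le_abs_self _).trans (this.trans (hdiam x hx y hy))
    linarith
  set a := sInf (φ '' K) with ha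
  have hbdd : BddBelow (φ '' K) := ⟨φ x₀ - c, by
    rintro _ ⟨y, hy, rfl⟩
    linarith [hd x₀ hx₀ y hy]⟩
  have hmem : ∀ᵐ x ∂ν, φ x ∈ Set.Icc a (a + c) := by
    filter_upwards [hK] with x hx
    refine ⟨csInf_le hbdd ⟨x, hx, rfl⟩, ?_⟩
    have : φ x - c ≤ a := le_csInf ⟨_, x₀, hx₀, rfl⟩ (by
      rintro _ ⟨y, hy, rfl⟩
      linarith [hd x hx y hy])
    linarith
  have hsub := (hasSubgaussianMGF_of_mem_Icc hφ.continuous.measurable.aemeasurable hmem).mgf_le t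
  rw [mgf] at hsub
  have e1 : ∫ x, Real.exp (t * φ x) ∂ν =
      Real.exp (t * ∫ x, φ x ∂ν) * ∫ x, Real.exp (t * (φ x - ∫ y, φ y ∂ν)) ∂ν := by
    rw [← integral_const_mul]
    refine integral_congr_ae (Filter.Eventually.of_forall fun x => ?_)
    simp only [← Real.exp_add]
    ring_nf
  rw [e1, Real.exp_add]
  refine mul_le_mul_of_nonneg_left (hsub.trans (le_of_eq ?_)) (Real.exp_pos _).le
  congr 1
  push_cast
  rw [add_sub_cancel_left, Real.norm_of_nonneg hc]
  ring

variable [SecondCountableTopology E]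
  {Ω : Type*} [MeasurableSpace Ω] {P : Measure Ω} [IsProbabilityMeasure P]

/-- The bounded difference inequality for a Lipschitz function of a sum, exponential form. -/
lemma integral_exp_lipschitz_sum_le {ι : Type*} [DecidableEq ι] {Z : ι → Ω → E}
    (hZ : ∀ i, Measurable (Z i)) (hind : iIndepFun Z P) {K : Set E}
    (hK : ∀ i, ∀ᵐ ω ∂P, Z i ω ∈ K) {B c : ℝ} (hB : ∀ x ∈ K, ‖x‖ ≤ B) (hc : 0 ≤ c)
    (hdiam : ∀ x ∈ K, ∀ y ∈ K, ‖x - y‖ ≤ c) (hKm : MeasurableSet K) (s : Finset ι) (t : ℝ) :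
    ∀ φ : E → ℝ, LipschitzWith 1 φ →
      ∫ ω, Real.exp (t * φ (∑ i ∈ s, Z i ω)) ∂P ≤
        Real.exp (t * ∫ ω, φ (∑ i ∈ s, Z i ω) ∂P + s.card * (t ^ 2 * c ^ 2 / 8)) := by
  induction s using Finset.induction_on with
  | empty => intro φ _; simp
  | insert a s ha ih =>
    intro φ hφ
    set S : Ω → E := fun ω => ∑ i ∈ s, Z i ω with hS
    have hSm : Measurable S := Finset.measurable_sum _ fun i _ => hZ i
    have hSX : IndepFun S (Z a) P := by
      have := hind.indepFun_finsetSum_of_notMem hZ ha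
      convert this using 1
      ext ω; simp [hS]
    have hSB : ∀ᵐ ω ∂P, ‖S ω‖ ≤ s.card * B := by
      have : ∀ᵐ ω ∂P, ∀ i ∈ s, Z i ω ∈ K :=
        (Finset.eventually_all s).mpr fun i _ => hK i
      filter_upwards [this] with ω hω
      refine (norm_sum_le _ _).trans ?_
      rw [← nsmul_eq_mul]
      exact Finset.sum_le_card_nsmul _ _ _ fun i hi => hB _ (hω i hi)
    set νS := P.map S with hνS
    set νX := P.map (Z a) with hνX
    have : IsProbabilityMeasure νS := Measure.isProbabilityMeasure_map hSm.aemeasurable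
    have : IsProbabilityMeasure νX := Measure.isProbabilityMeasure_map (hZ a).aemeasurable
    have hprod : P.map (fun ω => (S ω, Z a ω)) = νS.prod νX :=
      (indepFun_iff_map_prod_eq_prod_map_map hSm.aemeasurable (hZ a).aemeasurable).mp hSX
    have hpm : Measurable fun ω => (S ω, Z a ω) := hSm.prodMk (hZ a)
    have hKX : ∀ᵐ x ∂νX, x ∈ K := (ae_map_iff (hZ a).aemeasurable hKm).mpr (hK a)
    have hXB : ∀ᵐ x ∂νX, ‖x‖ ≤ B := hKX.mono fun x hx => hB x hx
    have hSB' : ∀ᵐ x ∂νS, ‖x‖ ≤ s.card * B :=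
      (ae_map_iff hSm.aemeasurable (measurableSet_le measurable_norm measurable_const)).mpr hSB
    have hpB : ∀ᵐ z ∂(νS.prod νX), ‖z.1 + z.2‖ ≤ s.card * B + B := by
      rw [← hprod, ae_map_iff hpm.aemeasurable
        (measurableSet_le (by fun_prop) measurable_const)]
      filter_upwards [hSB, hK a] with ω h1 h2
      exact (norm_add_le _ _).trans (add_le_add h1 (hB _ h2))
    have hLs : ∀ s : E, LipschitzWith 1 fun x => φ (s + x) := fun s => by
      refine LipschitzWith.of_dist_le_mul fun x y => ?_
      have := hφ.dist_le_mul (s + x) (s + y)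
      rwa [dist_add_left] at this
    have hins : ∀ ω, ∑ i ∈ insert a s, Z i ω = S ω + Z a ω := fun ω => by
      rw [Finset.sum_insert ha, add_comm]
    have hi1 : Integrable (fun z : E × E => φ (z.1 + z.2)) (νS.prod νX) :=
      integrable_of_lipschitz_of_bounded (by fun_prop) hpB hφ
    have hi2 : Integrable (fun z : E × E => Real.exp (t * φ (z.1 + z.2))) (νS.prod νX) :=
      integrable_exp_lipschitz_of_bounded (by fun_prop) hpB hφ t
    -- Averaging over the new summand gives another 1-Lipschitz function of the remaining sum, to
    -- which the induction hypothesis applies. This is why `φ` is quantified inside the induction.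
    set ψ : E → ℝ := fun s => ∫ x, φ (s + x) ∂νX with hψ
    have hψL : LipschitzWith 1 ψ := by
      refine LipschitzWith.of_dist_le_mul fun u v => ?_
      have hint : ∀ s, Integrable (fun x => φ (s + x)) νX := fun s =>
        integrable_of_lipschitz_of_bounded aemeasurable_id hXB (hLs s)
      rw [dist_eq_norm, hψ, ← integral_sub (hint u) (hint v), NNReal.coe_one, one_mul]
      refine (norm_integral_le_of_norm_le_const (C := dist u v)
        (Filter.Eventually.of_forall fun x => ?_)).trans (by simp)
      have := hφ.dist_le_mul (u + x) (v + x)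
      rwa [dist_add_right, NNReal.coe_one, one_mul, dist_eq_norm] at this
    have e1 : ∫ ω, Real.exp (t * φ (∑ i ∈ insert a s, Z i ω)) ∂P =
        ∫ u, ∫ x, Real.exp (t * φ (u + x)) ∂νX ∂νS := by
      simp only [hins]
      rw [← integral_prod _ hi2, ← hprod, integral_map hpm.aemeasurable]
      rw [hprod]; exact hi2.aestronglyMeasurable
    have e2 : ∫ ω, φ (∑ i ∈ insert a s, Z i ω) ∂P = ∫ ω, ψ (S ω) ∂P := by
      simp only [hins]
      rw [← integral_map hSm.aemeasurable hψL.continuous.measurable.aestronglyMeasurable,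
        ← integral_prod _ hi1, ← hprod, integral_map hpm.aemeasurable]
      rw [hprod]; exact hi1.aestronglyMeasurable
    rw [e1, e2, Finset.card_insert_of_notMem ha]
    calc ∫ u, ∫ x, Real.exp (t * φ (u + x)) ∂νX ∂νS
        ≤ ∫ u, Real.exp (t * ψ u) * Real.exp (t ^ 2 * c ^ 2 / 8) ∂νS := by
          refine integral_mono hi2.integral_prod_left
            ((integrable_exp_lipschitz_of_bounded aemeasurable_id hSB' hψL t).mul_const _)
            fun u => ?_
          rw [← Real.exp_add]
          exact integral_exp_lipschitz_le hKX hc hdiam (hLs u) t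
      _ = (∫ ω, Real.exp (t * ψ (S ω)) ∂P) * Real.exp (t ^ 2 * c ^ 2 / 8) := by
          rw [integral_mul_const, integral_map hSm.aemeasurable]
          exact (Real.measurable_exp.comp
            (measurable_const.mul hψL.continuous.measurable)).aestronglyMeasurable
      _ ≤ Real.exp (t * ∫ ω, ψ (S ω) ∂P + s.card * (t ^ 2 * c ^ 2 / 8)) *
            Real.exp (t ^ 2 * c ^ 2 / 8) := by
          gcongr
          exact ih ψ hψL
      _ = _ := by
          rw [← Real.exp_add]
          push_cast
          ring_nf

/-- The bounded difference inequality for a Lipschitz function of a sum. -/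
lemma measureReal_lipschitz_sum_ge_le {n : ℕ} (hn : 0 < n) {Z : Fin n → Ω → E}
    (hZ : ∀ i, Measurable (Z i)) (hind : iIndepFun Z P) {K : Set E}
    (hK : ∀ i, ∀ᵐ ω ∂P, Z i ω ∈ K) {B c : ℝ} (hB : ∀ x ∈ K, ‖x‖ ≤ B) (hc : 0 < c)
    (hdiam : ∀ x ∈ K, ∀ y ∈ K, ‖x - y‖ ≤ c) (hKm : MeasurableSet K)
    {φ : E → ℝ} (hφ : LipschitzWith 1 φ) {u : ℝ} (hu : 0 ≤ u) :
    P.real {ω | ∫ ω', φ (∑ i, Z i ω') ∂P + u ≤ φ (∑ i, Z i ω)} ≤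
      Real.exp (-(2 * u ^ 2 / (n * c ^ 2))) := by
  have hn' : (0 : ℝ) < n := Nat.cast_pos.mpr hn
  -- The minimizer of the Chernoff exponent `-t u + n t² c² / 8`.
  set t : ℝ := 4 * u / (n * c ^ 2) with ht
  have hBS : ∀ᵐ ω ∂P, ‖∑ i, Z i ω‖ ≤ n * B := by
    filter_upwards [ae_all_iff.mpr hK] with ω hω
    refine (norm_sum_le _ _).trans ?_
    have := Finset.sum_le_card_nsmul Finset.univ (fun i => ‖Z i ω‖) B fun i _ => hB _ (hω i)
    simpa using this
  have hm : Measurable fun ω => ∑ i, Z i ω := Finset.measurable_sum _ fun i _ => hZ i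
  have h1 := measure_ge_le_exp_mul_mgf (μ := P) (X := fun ω => φ (∑ i, Z i ω)) (t := t)
    (∫ ω', φ (∑ i, Z i ω') ∂P + u) (by positivity)
    (integrable_exp_lipschitz_of_bounded hm.aemeasurable hBS hφ t)
  refine h1.trans ?_
  have h2 := integral_exp_lipschitz_sum_le hZ hind hK hB hc.le hdiam hKm Finset.univ t φ hφ
  rw [mgf]
  refine (mul_le_mul_of_nonneg_left h2 (Real.exp_pos _).le).trans (le_of_eq ?_)
  rw [← Real.exp_add, Finset.card_univ, Fintype.card_fin]
  congr 1
  rw [ht]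
  field_simp
  ring

end BoundedDifferences

/-! ### Concentration of the empirical second moment -/

section SecondMoment

/-- The matrix `x xᵀ` as a vector of its entries. -/
def outerVec {d : ℕ} (x : Vec d) : EuclideanSpace ℝ (Fin d × Fin d) :=
  WithLp.toLp 2 fun ij => x ij.1 * x ij.2

lemma measurable_outerVec {d : ℕ} : Measurable (outerVec (d := d)) := by
  refine (WithLp.measurable_toLp 2 _).comp (measurable_pi_lambda _ fun ij => ?_)
  fun_prop

lemma norm_sq_eq_sqNorm {d : ℕ} (v : EuclideanSpace ℝ (Fin d × Fin d)) :
    ‖v‖ ^ 2 = sqNorm (Matrix.of fun i j => v (i, j)) := by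
  rw [EuclideanSpace.real_norm_sq_eq, Fintype.sum_prod_type]
  rfl

lemma norm_outerVec {d : ℕ} (x : Vec d) : ‖outerVec x‖ = ‖x‖ ^ 2 := by
  have : ‖outerVec x‖ ^ 2 = (‖x‖ ^ 2) ^ 2 := by
    rw [norm_sq_eq_sqNorm, sqNorm, EuclideanSpace.real_norm_sq_eq, sq (∑ i, x i ^ 2),
      Finset.sum_mul_sum]
    exact Finset.sum_congr rfl fun i _ => Finset.sum_congr rfl fun j _ => mul_pow _ _ _
  exact (pow_left_inj₀ (norm_nonneg _) (by positivity) two_ne_zero).mp this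

/-- The inner product of `x xᵀ` and `y yᵀ` is `⟨x, y⟩² ≥ 0`, so the diameter is `√2 R` instead of `2
R`. This makes the exponent in the concentration bound exactly `u²`. -/
lemma norm_outerVec_sub_sq_le {d : ℕ} {x y : Vec d} {R : ℝ} (hx : ‖x‖ ^ 2 ≤ R) (hy : ‖y‖ ^ 2 ≤ R) :
    ‖outerVec x - outerVec y‖ ^ 2 ≤ 2 * R ^ 2 := by
  have hin : 0 ≤ inner ℝ (outerVec x) (outerVec y) := by
    have : inner ℝ (outerVec x) (outerVec y) = (∑ i, x i * y i) ^ 2 := by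
      rw [PiLp.inner_apply, Fintype.sum_prod_type, sq, Finset.sum_mul_sum]
      refine Finset.sum_congr rfl fun i _ => Finset.sum_congr rfl fun j _ => ?_
      simp only [outerVec, RCLike.inner_apply, conj_trivial]
      ring
    rw [this]; positivity
  rw [norm_sub_sq_real, norm_outerVec, norm_outerVec]
  have h1 : (‖x‖ ^ 2) ^ 2 ≤ R ^ 2 := by gcongr
  have h2 : (‖y‖ ^ 2) ^ 2 ≤ R ^ 2 := by gcongr
  linarith

variable {Ω : Type*} [MeasurableSpace Ω] {P : Measure Ω} [IsProbabilityMeasure P]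

lemma sq_integral_le_integral_sq {f : Ω → ℝ} (hf : MemLp f 2 P) :
    (∫ ω, f ω ∂P) ^ 2 ≤ ∫ ω, f ω ^ 2 ∂P := by
  have h := variance_nonneg f P
  rw [variance_eq_sub hf] at h
  simpa using h

/-- The mean deviation of a sum of independent bounded vectors from its mean. -/
lemma integral_norm_sum_sub_le {κ : Type*} [Fintype κ] {n : ℕ}
    {Z : Fin n → Ω → EuclideanSpace ℝ κ} (hZ : ∀ i, Measurable (Z i)) (hind : iIndepFun Z P)
    {R : ℝ} (hR : 0 ≤ R) (hB : ∀ i, ∀ᵐ ω ∂P, ‖Z i ω‖ ≤ R) {a : EuclideanSpace ℝ κ}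
    (ha : ∀ i k, ∫ ω, Z i ω k ∂P = a k) :
    ∫ ω, ‖∑ i, Z i ω - (n : ℝ) • a‖ ∂P ≤ R * √n := by
  have hcoord : ∀ k : κ, Measurable fun v : EuclideanSpace ℝ κ => v k := fun k => by fun_prop
  have hLp : ∀ i k, MemLp (fun ω => Z i ω k) 2 P := fun i k => by
    refine MemLp.of_bound ((hcoord k).comp (hZ i)).aestronglyMeasurable R ?_
    filter_upwards [hB i] with ω hω
    exact (PiLp.norm_apply_le _ k).trans hω
  have hW : Measurable fun ω => ‖∑ i, Z i ω - (n : ℝ) • a‖ :=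
    ((Finset.measurable_sum _ fun i _ => hZ i).sub_const _).norm
  have hbd : ∀ᵐ ω ∂P, ‖‖∑ i, Z i ω - (n : ℝ) • a‖‖ ≤ n * R + ‖(n : ℝ) • a‖ := by
    filter_upwards [ae_all_iff.mpr hB] with ω hω
    rw [norm_norm]
    refine (norm_sub_le _ _).trans (add_le_add ((norm_sum_le _ _).trans ?_) le_rfl)
    have := Finset.sum_le_card_nsmul Finset.univ (fun i => ‖Z i ω‖) R fun i _ => hω i
    simpa using this
  have hWLp : MemLp (fun ω => ‖∑ i, Z i ω - (n : ℝ) • a‖) 2 P :=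
    MemLp.of_bound hW.aestronglyMeasurable _ hbd
  have hvar : ∀ k, ∫ ω, (∑ i, Z i ω - (n : ℝ) • a) k ^ 2 ∂P = ∑ i, Var[fun ω => Z i ω k; P] := by
    intro k
    have hp : Set.Pairwise ↑(Finset.univ : Finset (Fin n)) fun i j =>
        IndepFun (fun ω => Z i ω k) (fun ω => Z j ω k) P := fun i _ j _ hij =>
      (hind.indepFun hij).comp (hcoord k) (hcoord k)
    rw [← IndepFun.variance_sum (fun i _ => hLp i k) hp, variance_eq_integral]
    · refine integral_congr_ae (Filter.Eventually.of_forall fun ω => ?_)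
      have : ∫ ω, ∑ i, Z i ω k ∂P = n * a k := by
        rw [integral_finsetSum _ fun i _ => (hLp i k).integrable one_le_two]
        simp [ha]
      simp [this]
    · have := (Finset.measurable_sum Finset.univ
        fun i _ => (hcoord k).comp (hZ i)).aemeasurable (μ := P)
      convert this using 1
      ext ω; simp
  have hsum : ∫ ω, ‖∑ i, Z i ω - (n : ℝ) • a‖ ^ 2 ∂P ≤ n * R ^ 2 := by
    simp only [EuclideanSpace.real_norm_sq_eq]
    have hint : ∀ k, Integrable (fun ω => (∑ i, Z i ω - (n : ℝ) • a) k ^ 2) P := fun k => by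
      have : MemLp (fun ω => (∑ i, Z i ω - (n : ℝ) • a) k) 2 P := by
        refine hWLp.mono ((hcoord k).comp ((Finset.measurable_sum _ fun i _ =>
          hZ i).sub_const _)).aestronglyMeasurable (Filter.Eventually.of_forall fun ω => ?_)
        rw [norm_norm]
        exact PiLp.norm_apply_le _ k
      exact this.integrable_sq
    rw [integral_finsetSum _ fun k _ => hint k]
    simp only [hvar]
    rw [Finset.sum_comm]
    have hi : ∀ i, ∑ k, Var[fun ω => Z i ω k; P] ≤ R ^ 2 := by
      intro i
      calc ∑ k, Var[fun ω => Z i ω k; P] ≤ ∑ k, ∫ ω, Z i ω k ^ 2 ∂P :=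
            Finset.sum_le_sum fun k _ => variance_le_expectation_sq (hLp i k).1
        _ = ∫ ω, ‖Z i ω‖ ^ 2 ∂P := by
            simp only [EuclideanSpace.real_norm_sq_eq]
            rw [integral_finsetSum _ fun k _ => (hLp i k).integrable_sq]
        _ ≤ ∫ _, R ^ 2 ∂P := by
            refine integral_mono_of_nonneg (Filter.Eventually.of_forall fun ω => by positivity)
              (integrable_const _) ?_
            filter_upwards [hB i] with ω hω
            gcongr
        _ = R ^ 2 := by simp
    refine (Finset.sum_le_sum fun i _ => hi i).trans ?_
    simp
  -- Independence makes the coordinate variances additive; Jensen's inequality passes from the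
  -- second moment to the mean.
  have h := (sq_integral_le_integral_sq hWLp).trans hsum
  refine abs_le_of_sq_le_sq' ?_ (by positivity) |>.2
  rw [mul_pow, Real.sq_sqrt (Nat.cast_nonneg n)]
  linarith

/-- Concentration of the empirical second moment in Frobenius norm. -/
theorem measureReal_posteriorPrecision_sub_ge_le {d n : ℕ} (hn : 0 < n) {μ : Measure (Vec d)}
    {R : ℝ} (hR : 0 < R) (hμ : ∀ᵐ x ∂μ, ‖x‖ ^ 2 ≤ R) {X : Fin n → Ω → Vec d}
    (hX : ∀ i, Measurable (X i)) (hlaw : ∀ i, P.map (X i) = μ) (hind : iIndepFun X P)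
    {u : ℝ} (hu : 0 ≤ u) :
    P.real {ω | (R * √n * (1 + u)) ^ 2 ≤
      sqNorm (posteriorPrecision (fun i => X i ω) - (n : ℝ) • secondMoment μ)} ≤
      Real.exp (-u ^ 2) := by
  have hn' : (0 : ℝ) < n := Nat.cast_pos.mpr hn
  set Z : Fin n → Ω → EuclideanSpace ℝ (Fin d × Fin d) := fun i ω => outerVec (X i ω) with hZdef
  have hZ : ∀ i, Measurable (Z i) := fun i => measurable_outerVec.comp (hX i)
  have hZind : iIndepFun Z P := hind.comp (fun _ => outerVec) fun _ => measurable_outerVec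
  have hXR : ∀ i, ∀ᵐ ω ∂P, ‖X i ω‖ ^ 2 ≤ R := fun i => by
    have hms : MeasurableSet {x : Vec d | ‖x‖ ^ 2 ≤ R} :=
      measurableSet_le (by fun_prop) measurable_const
    have := hμ
    rw [← hlaw i, ae_map_iff (hX i).aemeasurable hms] at this
    exact this
  -- The closure makes `K` measurable and changes neither the norm bound nor the diameter bound.
  set K : Set (EuclideanSpace ℝ (Fin d × Fin d)) :=
    closure (outerVec '' {x : Vec d | ‖x‖ ^ 2 ≤ R}) with hK
  have hZK : ∀ i, ∀ᵐ ω ∂P, Z i ω ∈ K := fun i =>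
    (hXR i).mono fun ω hω => subset_closure ⟨_, hω, rfl⟩
  have hKB : ∀ x ∈ K, ‖x‖ ≤ R := by
    have : K ⊆ {x | ‖x‖ ≤ R} := by
      refine closure_minimal ?_ (isClosed_le continuous_norm continuous_const)
      rintro _ ⟨x, hx, rfl⟩
      simpa [norm_outerVec] using hx
    exact this
  have hdiam : ∀ x ∈ K, ∀ y ∈ K, ‖x - y‖ ≤ √2 * R := by
    have hc1 : IsClosed {z : EuclideanSpace ℝ (Fin d × Fin d) × EuclideanSpace ℝ (Fin d × Fin d) |
        ‖z.1 - z.2‖ ≤ √2 * R} := isClosed_le (by fun_prop) continuous_const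
    have : K ×ˢ K ⊆ {z : EuclideanSpace ℝ (Fin d × Fin d) × EuclideanSpace ℝ (Fin d × Fin d) |
        ‖z.1 - z.2‖ ≤ √2 * R} := by
      rw [hK, ← closure_prod_eq]
      refine closure_minimal ?_ hc1
      rintro ⟨_, _⟩ ⟨⟨x, hx, rfl⟩, ⟨y, hy, rfl⟩⟩
      have h2 : (√2 * R) ^ 2 = 2 * R ^ 2 := by rw [mul_pow, Real.sq_sqrt (by norm_num)]
      have h3 : ‖outerVec x - outerVec y‖ ^ 2 ≤ (√2 * R) ^ 2 := by
        rw [h2]; exact norm_outerVec_sub_sq_le hx hy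
      exact (abs_le_of_sq_le_sq' h3 (by positivity)).2
    intro x hx y hy
    exact @this (x, y) (Set.mk_mem_prod hx hy)
  set a : EuclideanSpace ℝ (Fin d × Fin d) := WithLp.toLp 2 fun ij => secondMoment μ ij.1 ij.2
    with ha
  have hmean : ∀ i k, ∫ ω, Z i ω k ∂P = a k := fun i k => by
    have e : a k = ∫ x, x k.1 * x k.2 ∂μ := rfl
    have hms : Measurable fun x : Vec d => x k.1 * x k.2 := by fun_prop
    rw [e, ← hlaw i, integral_map (hX i).aemeasurable hms.aestronglyMeasurable]
    rfl
  set φ : EuclideanSpace ℝ (Fin d × Fin d) → ℝ := fun x => ‖x - (n : ℝ) • a‖ with hφ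
  have hφL : LipschitzWith 1 φ := LipschitzWith.of_dist_le_mul fun x y => by
    rw [NNReal.coe_one, one_mul, dist_eq_norm, dist_eq_norm, hφ, Real.norm_eq_abs]
    refine (abs_norm_sub_norm_le _ _).trans (le_of_eq ?_)
    congr 1; abel
  have hE : ∫ ω, φ (∑ i, Z i ω) ∂P ≤ R * √n :=
    integral_norm_sum_sub_le hZ hZind hR.le
      (fun i => (hXR i).mono fun ω hω => by rw [hZdef]; simpa [norm_outerVec] using hω) hmean
  have hRn : 0 ≤ R * √n * u := by positivity
  have h2R : (0 : ℝ) < √2 * R := by positivity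
  have hmain := measureReal_lipschitz_sum_ge_le hn hZ hZind hZK hKB h2R hdiam
    isClosed_closure.measurableSet hφL hRn
  have hexp : 2 * (R * √n * u) ^ 2 / (n * (√2 * R) ^ 2) = u ^ 2 := by
    rw [mul_pow, mul_pow, mul_pow, Real.sq_sqrt hn'.le, Real.sq_sqrt zero_le_two]
    field_simp
  rw [hexp] at hmain
  refine (measureReal_mono ?_ (by finiteness)).trans hmain
  intro ω hω
  rw [Set.mem_ofPred_eq] at hω ⊢
  have e : sqNorm (posteriorPrecision (fun i => X i ω) - (n : ℝ) • secondMoment μ) =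
      φ (∑ i, Z i ω) ^ 2 := by
    rw [hφ, norm_sq_eq_sqNorm]
    congr 1
    ext i j
    simp [posteriorPrecision, Matrix.sum_apply, outer, Matrix.vecMulVec_apply, hZdef, outerVec, ha]
  rw [e] at hω
  have := abs_le_of_sq_le_sq' hω (norm_nonneg _) |>.2
  nlinarith

end SecondMoment

/-! ### Moments of linear and quadratic forms of a standard Gaussian -/

section GaussianMoments

variable {d : ℕ}

lemma gaussianOfPrecision_one : gaussianOfPrecision (1 : Matrix (Fin d) (Fin d) ℝ) =
    stdGaussian (Vec d) := by
  rw [gaussianOfPrecision, inv_one, multivariateGaussian_zero_one]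

lemma measurable_inner_left (w : Vec d) : Measurable fun x : Vec d => inner ℝ w x := by fun_prop

lemma memLp_inner_stdGaussian (w : Vec d) (p : ENNReal) (hp : p ≠ ⊤) :
    MemLp (fun x : Vec d => inner ℝ w x) p (stdGaussian (Vec d)) :=
  (IsGaussian.memLp_id (stdGaussian (Vec d)) p hp).const_inner w

lemma integrable_inner_pow_stdGaussian (w : Vec d) (k : ℕ) :
    Integrable (fun x : Vec d => inner ℝ w x ^ k) (stdGaussian (Vec d)) := by
  have := (memLp_inner_stdGaussian w k (by simp)).integrable_norm_pow'
  refine this.mono ((measurable_inner_left w).pow_const k).aestronglyMeasurable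
    (Filter.Eventually.of_forall fun x => ?_)
  simp

lemma map_inner_stdGaussian (w : Vec d) :
    (stdGaussian (Vec d)).map (fun x => inner ℝ w x) = gaussianReal 0 (‖w‖ ^ 2).toNNReal := by
  have h := IsGaussian.map_eq_gaussianReal (μ := stdGaussian (Vec d)) (innerSL ℝ w)
  rw [integral_strongDual_stdGaussian, variance_dual_stdGaussian, innerSL_apply_norm] at h
  exact h

/-- Twice the bound `8! e^{1/2}` on the eighth moment of a Gaussian variable of variance at most
one. -/
def eighthMomentBound : ℝ := 161280

/-- The pointwise bound `y⁸ ≤ 8! (eʸ + e⁻ʸ)` reduces the moment to the moment generating function at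
`±1`, which is at most `e^{1/2} ≤ 2`. -/
lemma integral_inner_pow_eight_le {w : Vec d} (hw : ‖w‖ ^ 2 ≤ 1) :
    ∫ x, inner ℝ w x ^ 8 ∂(stdGaussian (Vec d)) ≤ eighthMomentBound := by
  have hmap := map_inner_stdGaussian w
  set v : NNReal := (‖w‖ ^ 2).toNNReal with hv
  have hv1 : (v : ℝ) ≤ 1 := by
    rw [hv, Real.coe_toNNReal _ (by positivity)]; exact hw
  have h1 : ∫ x, inner ℝ w x ^ 8 ∂(stdGaussian (Vec d)) = ∫ y, y ^ 8 ∂(gaussianReal 0 v) := by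
    rw [← hmap, integral_map (by fun_prop) (by fun_prop)]
  have hmgf : ∀ t : ℝ, t ^ 2 = 1 → ∫ y, Real.exp (t * y) ∂(gaussianReal 0 v) ≤ 2 := by
    intro t ht
    have : ∫ y, Real.exp (t * y) ∂(gaussianReal 0 v) = Real.exp (0 * t + v * t ^ 2 / 2) := by
      have := congrFun (mgf_id_gaussianReal (μ := 0) (v := v)) t
      simpa [mgf] using this
    rw [this, ht]
    calc Real.exp (0 * t + v * 1 / 2) ≤ Real.exp (1 / 2) := by
          rw [Real.exp_le_exp]; linarith
      _ ≤ 2 := by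
          have h2 : Real.exp (1 / 2) ^ 2 ≤ 2 ^ 2 := by
            rw [← Real.exp_nat_mul]
            have := Real.exp_one_lt_d9
            norm_num at this ⊢
            linarith
          exact le_of_sq_le_sq h2 (by norm_num)
  have hpt : ∀ y : ℝ, y ^ 8 ≤ 40320 * (Real.exp (1 * y) + Real.exp (-1 * y)) := by
    intro y
    have h := Real.pow_div_factorial_le_exp |y| (abs_nonneg y) 8
    have e : |y| ^ 8 = y ^ 8 := (even_iff_two_dvd.mpr (by norm_num)).pow_abs y
    have e2 : ((Nat.factorial 8 : ℕ) : ℝ) = 40320 := by norm_num [Nat.factorial]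
    rw [e, e2, div_le_iff₀ (by norm_num)] at h
    have h3 : Real.exp |y| ≤ Real.exp (1 * y) + Real.exp (-1 * y) := by
      rcases abs_choice y with h' | h' <;> rw [h']
      · rw [one_mul]; linarith [Real.exp_pos (-1 * y)]
      · rw [neg_one_mul]; linarith [Real.exp_pos (1 * y)]
    linarith
  rw [h1]
  calc ∫ y, y ^ 8 ∂(gaussianReal 0 v)
      ≤ ∫ y, 40320 * (Real.exp (1 * y) + Real.exp (-1 * y)) ∂(gaussianReal 0 v) := by
        refine integral_mono_of_nonneg (Filter.Eventually.of_forall fun y => by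
          change (0 : ℝ) ≤ y ^ 8; positivity)
          (((integrable_exp_mul_gaussianReal 1).add
            (integrable_exp_mul_gaussianReal _)).const_mul _)
          (Filter.Eventually.of_forall hpt)
    _ = 40320 * (∫ y, Real.exp (1 * y) ∂(gaussianReal 0 v) +
          ∫ y, Real.exp (-1 * y) ∂(gaussianReal 0 v)) := by
        rw [integral_const_mul, integral_add (integrable_exp_mul_gaussianReal 1)
          (integrable_exp_mul_gaussianReal _)]
    _ ≤ 40320 * (2 + 2) := by
        gcongr
        · exact hmgf 1 (by norm_num)
        · exact hmgf (-1) (by norm_num)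
    _ = eighthMomentBound := by norm_num [eighthMomentBound]

lemma integral_inner_mul_inner_stdGaussian (e u : Vec d) :
    ∫ x, inner ℝ e x * inner ℝ u x ∂(stdGaussian (Vec d)) = inner ℝ e u := by
  have h := covarianceBilin_apply (IsGaussian.memLp_two_id (μ := stdGaussian (Vec d))) e u
  rw [covarianceBilin_stdGaussian] at h
  simp only [id_eq, integral_id_stdGaussian, sub_zero] at h
  exact h.symm

/-- A bound on the fourth moment of `⟨e, θ⟩ ⟨u, θ⟩ - ⟨e, u⟩` for a standard Gaussian `θ`. -/
def fourthMomentBound : ℝ := 8 * (eighthMomentBound + 1)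

lemma quadratic_pow_four_le {e u : Vec d} (he : ‖e‖ ^ 2 ≤ 1) (hu : ‖u‖ ^ 2 ≤ 1) (x : Vec d) :
    (inner ℝ e x * inner ℝ u x - inner ℝ e u) ^ 4 ≤
      4 * inner ℝ e x ^ 8 + 4 * inner ℝ u x ^ 8 + 8 := by
  set a : ℝ := inner ℝ e x
  set b : ℝ := inner ℝ u x
  set r : ℝ := inner ℝ e u
  have hr : r ^ 2 ≤ 1 := by
    have h1 : |r| ≤ ‖e‖ * ‖u‖ := abs_real_inner_le_norm e u
    have h2 : |r| ^ 2 ≤ (‖e‖ * ‖u‖) ^ 2 := by gcongr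
    rw [sq_abs, mul_pow] at h2
    exact h2.trans (mul_le_one₀ he (by positivity) hu)
  have h1 : (a * b - r) ^ 2 ≤ 2 * (a * b) ^ 2 + 2 * r ^ 2 := by nlinarith [sq_nonneg (a * b + r)]
  have h2 : (a * b - r) ^ 4 ≤ (2 * (a * b) ^ 2 + 2 * r ^ 2) ^ 2 := by
    have : (a * b - r) ^ 4 = ((a * b - r) ^ 2) ^ 2 := by ring
    rw [this]; gcongr
  have h3 : (2 * (a * b) ^ 2 + 2 * r ^ 2) ^ 2 ≤ 8 * ((a * b) ^ 2) ^ 2 + 8 * (r ^ 2) ^ 2 := by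
    nlinarith [sq_nonneg ((a * b) ^ 2 - r ^ 2)]
  have h4 : (r ^ 2) ^ 2 ≤ 1 := pow_le_one₀ (sq_nonneg r) hr
  have h5 : 8 * ((a * b) ^ 2) ^ 2 ≤ 4 * a ^ 8 + 4 * b ^ 8 := by
    nlinarith [sq_nonneg (a ^ 4 - b ^ 4)]
  linarith

lemma integral_quadratic_pow_four_le {e u : Vec d} (he : ‖e‖ ^ 2 ≤ 1) (hu : ‖u‖ ^ 2 ≤ 1) :
    ∫ x, (inner ℝ e x * inner ℝ u x - inner ℝ e u) ^ 4 ∂(stdGaussian (Vec d)) ≤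
      fourthMomentBound := by
  have i1 := (integrable_inner_pow_stdGaussian e 8).const_mul 4
  have i2 := (integrable_inner_pow_stdGaussian u 8).const_mul 4
  refine (integral_mono_of_nonneg (Filter.Eventually.of_forall fun x => by
    change (0 : ℝ) ≤ (inner ℝ e x * inner ℝ u x - inner ℝ e u) ^ 4; positivity)
    ((i1.add i2).add (integrable_const 8))
    (Filter.Eventually.of_forall (quadratic_pow_four_le he hu))).trans ?_
  have i12 : Integrable (fun x : Vec d => 4 * inner ℝ e x ^ 8 + 4 * inner ℝ u x ^ 8)
    (stdGaussian (Vec d)) := i1.add i2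
  simp only [Pi.add_apply]
  rw [integral_add i12 (integrable_const 8), integral_add i1 i2, integral_const_mul,
    integral_const_mul]
  have h1 := integral_inner_pow_eight_le he
  have h2 := integral_inner_pow_eight_le hu
  simp only [integral_const, probReal_univ, one_smul, fourthMomentBound]
  linarith

end GaussianMoments

/-! ### Fourth moments of independent sums -/

section FourthMoment

variable {Ω : Type*} [MeasurableSpace Ω] {P : Measure Ω}

lemma memLp_four_iff {f : Ω → ℝ} (hf : AEStronglyMeasurable f P) :
    MemLp f 4 P ↔ Integrable (fun ω => f ω ^ 4) P := by
  rw [← integrable_norm_rpow_iff hf (by norm_num) (by norm_num)]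
  have : ∀ ω, ‖f ω‖ ^ (4 : ENNReal).toReal = f ω ^ 4 := fun ω => by
    rw [show (4 : ENNReal).toReal = ((4 : ℕ) : ℝ) by norm_num, Real.rpow_natCast,
      Real.norm_eq_abs]
    exact (even_iff_two_dvd.mpr (by norm_num)).pow_abs _
  simp only [this]

variable [IsProbabilityMeasure P]

lemma MemLp.integrable_pow_of_le_four {f : Ω → ℝ} (hf : MemLp f 4 P) {k : ℕ} (hk : k ≤ 4) :
    Integrable (fun ω => f ω ^ k) P := by
  have h : MemLp f k P := hf.mono_exponent (by exact_mod_cast hk)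
  refine h.integrable_norm_pow'.mono (hf.1.pow k) (Filter.Eventually.of_forall fun x => ?_)
  simp

/-- The fourth moment of a sum of independent centred random variables. -/
lemma integral_sum_pow_four_le {ι : Type*} [DecidableEq ι] {Z : ι → Ω → ℝ}
    (hZ : ∀ i, Measurable (Z i)) (hind : iIndepFun Z P) (hLp : ∀ i, MemLp (Z i) 4 P)
    (hmean : ∀ i, ∫ ω, Z i ω ∂P = 0) {K : ℝ} (hK : ∀ i, ∫ ω, Z i ω ^ 4 ∂P ≤ K)
    (s : Finset ι) :
    MemLp (fun ω => ∑ i ∈ s, Z i ω) 4 P ∧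
      ∫ ω, (∑ i ∈ s, Z i ω) ^ 4 ∂P ≤ 9 * (s.card : ℝ) ^ 2 * K := by
  induction s using Finset.induction_on with
  | empty => simp
  | insert a s ha ih =>
    obtain ⟨hSLp, hS4⟩ := ih
    set S : Ω → ℝ := fun ω => ∑ i ∈ s, Z i ω with hS
    set X := Z a with hX
    have hins : ∀ ω, ∑ i ∈ insert a s, Z i ω = S ω + X ω := fun ω => by
      rw [Finset.sum_insert ha, add_comm]
    simp only [hins]
    refine ⟨hSLp.add (hLp a), ?_⟩
    have hSm : Measurable S := Finset.measurable_sum _ fun i _ => hZ i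
    have hSX : IndepFun S X P := by
      have := hind.indepFun_finsetSum_of_notMem hZ ha
      convert this using 1
      ext ω; simp [hS]
    have hIS : ∀ k ≤ 4, Integrable (fun ω => S ω ^ k) P := fun k hk =>
      MemLp.integrable_pow_of_le_four hSLp hk
    have hIX : ∀ k ≤ 4, Integrable (fun ω => X ω ^ k) P := fun k hk =>
      MemLp.integrable_pow_of_le_four (hLp a) hk
    have hI : ∀ j ≤ 4, ∀ k ≤ 4, Integrable (fun ω => S ω ^ j * X ω ^ k) P := fun j hj k hk =>
      (hSX.comp (measurable_id.pow_const j) (measurable_id.pow_const k)).integrable_mul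
        (hIS j hj) (hIX k hk)
    have hE : ∀ j k, ∫ ω, S ω ^ j * X ω ^ k ∂P = (∫ ω, S ω ^ j ∂P) * ∫ ω, X ω ^ k ∂P :=
      fun j k => hSX.integral_fun_comp_mul_comp hSm.aemeasurable (hZ a).aemeasurable
        (f := fun x => x ^ j) (g := fun x => x ^ k)
        (measurable_id.pow_const j).aestronglyMeasurable
        (measurable_id.pow_const k).aestronglyMeasurable
    have hX1 : ∫ ω, X ω ∂P = 0 := hmean a
    have hS1 : ∫ ω, S ω ∂P = 0 := by
      rw [hS, integral_finsetSum _ fun i _ => (hLp i).integrable (by norm_num)]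
      exact Finset.sum_eq_zero fun i _ => hmean i
    have hexp : ∫ ω, (S ω + X ω) ^ 4 ∂P = ∫ ω, S ω ^ 4 ∂P +
        6 * ((∫ ω, S ω ^ 2 ∂P) * ∫ ω, X ω ^ 2 ∂P) + ∫ ω, X ω ^ 4 ∂P := by
      have e : ∀ ω, (S ω + X ω) ^ 4 = S ω ^ 4 + (4 * (S ω ^ 3 * X ω ^ 1) +
          (6 * (S ω ^ 2 * X ω ^ 2) + (4 * (S ω ^ 1 * X ω ^ 3) + X ω ^ 4))) := fun ω => by ring
      have i31 := (hI 3 (by norm_num) 1 (by norm_num)).const_mul 4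
      have i22 := (hI 2 (by norm_num) 2 (by norm_num)).const_mul 6
      have i13 := (hI 1 (by norm_num) 3 (by norm_num)).const_mul 4
      have iX := hIX 4 le_rfl
      have j1 : Integrable (fun ω => 4 * (S ω ^ 1 * X ω ^ 3) + X ω ^ 4) P := i13.add iX
      have j2 : Integrable (fun ω => 6 * (S ω ^ 2 * X ω ^ 2) +
        (4 * (S ω ^ 1 * X ω ^ 3) + X ω ^ 4)) P := i22.add j1
      have j3 : Integrable (fun ω => 4 * (S ω ^ 3 * X ω ^ 1) + (6 * (S ω ^ 2 * X ω ^ 2) +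
        (4 * (S ω ^ 1 * X ω ^ 3) + X ω ^ 4))) P := i31.add j2
      simp only [e]
      rw [integral_add (hIS 4 le_rfl) j3, integral_add i31 j2, integral_add i22 j1,
        integral_add i13 iX, integral_const_mul, integral_const_mul, integral_const_mul,
        hE, hE, hE]
      simp only [pow_one, hX1, hS1]
      ring
    have hS2 : (∫ ω, S ω ^ 2 ∂P) ^ 2 ≤ 9 * (s.card : ℝ) ^ 2 * K := by
      refine (sq_integral_le_integral_sq ?_).trans (le_trans (le_of_eq ?_) hS4)
      · refine (memLp_two_iff_integrable_sq (hSm.pow_const 2).aestronglyMeasurable).mpr ?_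
        simpa only [← pow_mul] using hIS 4 le_rfl
      · simp only [← pow_mul]; rfl
    have hX2 : (∫ ω, X ω ^ 2 ∂P) ^ 2 ≤ K := by
      refine (sq_integral_le_integral_sq ?_).trans (le_trans (le_of_eq ?_) (hK a))
      · refine (memLp_two_iff_integrable_sq ((hZ a).pow_const 2).aestronglyMeasurable).mpr ?_
        simpa only [← pow_mul] using hIX 4 le_rfl
      · simp only [← pow_mul]; rfl
    have hK0 : 0 ≤ K := (sq_nonneg _).trans hX2
    -- Both second moments are bounded by roots of fourth moments. With this the induction closes,
    -- because `9 n² + 6 * 3 n + 1 ≤ 9 (n + 1)²`.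
    have hprod : (∫ ω, S ω ^ 2 ∂P) * ∫ ω, X ω ^ 2 ∂P ≤ 3 * s.card * K := by
      refine abs_le_of_sq_le_sq' ?_ (by positivity) |>.2
      calc ((∫ ω, S ω ^ 2 ∂P) * ∫ ω, X ω ^ 2 ∂P) ^ 2
          = (∫ ω, S ω ^ 2 ∂P) ^ 2 * (∫ ω, X ω ^ 2 ∂P) ^ 2 := mul_pow _ _ _
        _ ≤ (9 * (s.card : ℝ) ^ 2 * K) * K := by gcongr
        _ = _ := by ring
    rw [hexp, Finset.card_insert_of_notMem ha]
    have := hK a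
    push_cast
    have hc : (0 : ℝ) ≤ s.card := Nat.cast_nonneg _
    nlinarith

end FourthMoment

/-! ### Projections onto column spaces -/

section Projection

variable {d p : ℕ}

/-- The orthogonal projection onto the column space of `Y`, if the columns of `Y` are linearly
independent. -/
def colProj (Y : Matrix (Fin d) (Fin p) ℝ) : Matrix (Fin d) (Fin d) ℝ :=
  Y * (Yᵀ * Y)⁻¹ * Yᵀ

/-- The projection depends only on the column space, so it can be computed from the unnormalized
iteration in place of the QR factors. -/
lemma colProj_mul_of_isUnit {U : Matrix (Fin d) (Fin p) ℝ} (hU : Uᵀ * U = 1)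
    {R : Matrix (Fin p) (Fin p) ℝ} (hR : IsUnit R.det) : colProj (U * R) = U * Uᵀ := by
  have hRt : IsUnit Rᵀ.det := by rwa [Matrix.det_transpose]
  have h1 : (U * R)ᵀ * (U * R) = Rᵀ * R := by
    rw [Matrix.transpose_mul, show Rᵀ * Uᵀ * (U * R) = Rᵀ * (Uᵀ * U) * R by
      simp only [Matrix.mul_assoc], hU, Matrix.mul_one]
  rw [colProj, h1, Matrix.mul_inv_rev, Matrix.transpose_mul,
    show U * R * (R⁻¹ * Rᵀ⁻¹) * (Rᵀ * Uᵀ) = U * (R * R⁻¹) * (Rᵀ⁻¹ * Rᵀ) * Uᵀ by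
      simp only [Matrix.mul_assoc], Matrix.mul_nonsing_inv _ hR, Matrix.nonsing_inv_mul _ hRt,
    Matrix.mul_one, Matrix.mul_one]

-- The Gram matrix is positive semidefinite, hence `Bᵀ B` for some `B`, and `Y B⁻¹` is orthonormal.
-- No triangular shape is needed here.
open scoped MatrixOrder in
lemma exists_orthonormal_factor (Y : Matrix (Fin d) (Fin p) ℝ) (hY : IsUnit (Yᵀ * Y).det) :
    ∃ (U : Matrix (Fin d) (Fin p) ℝ) (R : Matrix (Fin p) (Fin p) ℝ),
      Uᵀ * U = 1 ∧ IsUnit R.det ∧ Y = U * R := by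
  have hpsd : (Yᵀ * Y).PosSemidef := by
    have := Matrix.posSemidef_conjTranspose_mul_self Y
    rwa [Matrix.conjTranspose_eq_transpose_of_trivial] at this
  obtain ⟨B, hB⟩ := CStarAlgebra.nonneg_iff_eq_star_mul_self.mp hpsd.nonneg
  rw [Matrix.star_eq_conjTranspose, Matrix.conjTranspose_eq_transpose_of_trivial] at hB
  have hBdet : IsUnit B.det := by
    rw [hB, Matrix.det_mul] at hY
    exact isUnit_of_mul_isUnit_right hY
  have hBt : IsUnit Bᵀ.det := by rwa [Matrix.det_transpose]
  refine ⟨Y * B⁻¹, B, ?_, hBdet, ?_⟩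
  · rw [Matrix.transpose_mul, Matrix.transpose_nonsing_inv,
      show Bᵀ⁻¹ * Yᵀ * (Y * B⁻¹) = Bᵀ⁻¹ * (Yᵀ * Y) * B⁻¹ by simp only [Matrix.mul_assoc], hB,
      show Bᵀ⁻¹ * (Bᵀ * B) * B⁻¹ = (Bᵀ⁻¹ * Bᵀ) * (B * B⁻¹) by simp only [Matrix.mul_assoc],
      Matrix.nonsing_inv_mul _ hBt, Matrix.mul_nonsing_inv _ hBdet, Matrix.mul_one]
  · rw [Matrix.mul_assoc, Matrix.nonsing_inv_mul _ hBdet, Matrix.mul_one]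

lemma sqNorm_mul_projection (E : Matrix (Fin d) (Fin d) ℝ) {U : Matrix (Fin d) (Fin p) ℝ}
    (hU : Uᵀ * U = 1) : sqNorm (E * (U * Uᵀ)) = sqNorm (E * U) := by
  rw [sqNorm_eq_trace, sqNorm_eq_trace]
  congr 1
  simp only [Matrix.transpose_mul, Matrix.transpose_transpose]
  rw [show E * (U * Uᵀ) * (U * Uᵀ * Eᵀ) = E * U * (Uᵀ * U) * (Uᵀ * Eᵀ) by
    simp only [Matrix.mul_assoc], hU, Matrix.mul_one]

end Projection

/-! ### The noise of one iteration -/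

section Noise

variable {d p N : ℕ}

/-- The deviation `(1/N) ∑ⱼ θⱼ θⱼᵀ - I` of the sample covariance. -/
def noiseMatrix (θ : Fin N → Vec d) : Matrix (Fin d) (Fin d) ℝ :=
  (1 / (N : ℝ)) • ∑ j, outer (θ j) (θ j) - 1

lemma noiseMatrix_mul_apply (hN : 0 < N) (θ : Fin N → Vec d) (U : Matrix (Fin d) (Fin p) ℝ)
    (i : Fin d) (k : Fin p) :
    (noiseMatrix θ * U) i k = (1 / (N : ℝ)) * ∑ j,
      (inner ℝ (EuclideanSpace.single i (1 : ℝ)) (θ j) *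
        inner ℝ (WithLp.toLp 2 fun l => U l k : Vec d) (θ j) -
        inner ℝ (EuclideanSpace.single i (1 : ℝ)) (WithLp.toLp 2 fun l => U l k : Vec d)) := by
  have hN' : (N : ℝ) ≠ 0 := Nat.cast_ne_zero.mpr hN.ne'
  have h1 : ∀ v : Vec d, inner ℝ (EuclideanSpace.single i (1 : ℝ)) v = v i := fun v => by
    simp [EuclideanSpace.inner_single_left]
  have h2 : ∀ j, inner ℝ (WithLp.toLp 2 fun l => U l k : Vec d) (θ j) = ∑ l, U l k * θ j l :=
    fun j => by simp [PiLp.inner_apply, mul_comm]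
  simp only [h1, h2]
  rw [Finset.sum_sub_distrib, mul_sub]
  simp only [Finset.sum_const, Finset.card_univ, Fintype.card_fin, nsmul_eq_mul]
  rw [← mul_assoc, one_div, inv_mul_cancel₀ hN', one_mul, noiseMatrix, Matrix.sub_mul,
    Matrix.one_mul, Matrix.sub_apply, Matrix.smul_mul, Matrix.smul_apply, smul_eq_mul, one_div]
  congr 2
  rw [Matrix.sum_mul, Matrix.sum_apply]
  refine Finset.sum_congr rfl fun j _ => ?_
  simp only [Matrix.mul_apply, outer, Matrix.vecMulVec_apply, Finset.mul_sum]
  exact Finset.sum_congr rfl fun l _ => by ring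

lemma sqNorm_sq_le_sum_pow_four {ι κ : Type*} [Fintype ι] [Fintype κ] (A : Matrix ι κ ℝ) :
    sqNorm A ^ 2 ≤ Fintype.card ι * Fintype.card κ * ∑ i, ∑ k, A i k ^ 4 := by
  have h := sq_sum_le_card_mul_sum_sq (s := (Finset.univ : Finset (ι × κ)))
    (f := fun ik => A ik.1 ik.2 ^ 2)
  rw [Fintype.sum_prod_type, Fintype.sum_prod_type, Finset.card_univ, Fintype.card_prod] at h
  push_cast at h
  refine h.trans (le_of_eq ?_)
  congr 1
  exact Finset.sum_congr rfl fun i _ => Finset.sum_congr rfl fun k _ => by ring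

variable {Ω : Type*} [MeasurableSpace Ω] {P : Measure Ω} [IsProbabilityMeasure P]

/-- The fourth moment of the noise in one iteration, for a fixed orthonormal frame. -/
lemma lintegral_sqNorm_noiseMatrix_mul_sq_le (hN : 0 < N) {θ : Fin N → Ω → Vec d}
    (hθ : ∀ j, Measurable (θ j)) (hlaw : ∀ j, P.map (θ j) = gaussianOfPrecision 1)
    (hind : iIndepFun θ P) {U : Matrix (Fin d) (Fin p) ℝ} (hU : Uᵀ * U = 1) :
    ∫⁻ ω, ENNReal.ofReal (sqNorm (noiseMatrix (fun j => θ j ω) * U) ^ 2) ∂P ≤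
      ENNReal.ofReal (9 * fourthMomentBound * ((p : ℝ) * d / N) ^ 2) := by
  have hN' : (0 : ℝ) < N := Nat.cast_pos.mpr hN
  set e : Fin d → Vec d := fun i => EuclideanSpace.single i (1 : ℝ) with he
  set u : Fin p → Vec d := fun k => WithLp.toLp 2 fun l => U l k with hu
  have he1 : ∀ i, ‖e i‖ ^ 2 ≤ 1 := fun i => by simp [he]
  have hu1 : ∀ k, ‖u k‖ ^ 2 ≤ 1 := fun k => by
    have h := congrFun (congrFun hU k) k
    rw [Matrix.mul_apply, Matrix.one_apply_eq] at h
    rw [EuclideanSpace.real_norm_sq_eq]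
    refine le_of_eq (Eq.trans (Finset.sum_congr rfl fun l _ => ?_) h)
    simp [hu, sq]
  set q : Fin d → Fin p → Vec d → ℝ := fun i k x =>
    inner ℝ (e i) x * inner ℝ (u k) x - inner ℝ (e i) (u k) with hq
  have hqm : ∀ i k, Measurable (q i k) := fun i k => by
    simp only [hq]; fun_prop
  have hq4 : ∀ i k, Integrable (fun x => q i k x ^ 4) (stdGaussian (Vec d)) := fun i k => by
    have hi : Integrable (fun x : Vec d => 4 * inner ℝ (e i) x ^ 8 + 4 * inner ℝ (u k) x ^ 8 + 8)
        (stdGaussian (Vec d)) :=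
      (((integrable_inner_pow_stdGaussian (e i) 8).const_mul 4).add
        ((integrable_inner_pow_stdGaussian (u k) 8).const_mul 4)).add (integrable_const 8)
    refine hi.mono ((hqm i k).pow_const 4).aestronglyMeasurable
      (Filter.Eventually.of_forall fun x => ?_)
    have h0 : 0 ≤ q i k x ^ 4 := by positivity
    rw [Real.norm_of_nonneg h0]
    exact (quadratic_pow_four_le (he1 i) (hu1 k) x).trans (Real.le_norm_self _)
  have hsum : ∀ i k, MemLp (fun ω => ∑ j, q i k (θ j ω)) 4 P ∧
      ∫ ω, (∑ j, q i k (θ j ω)) ^ 4 ∂P ≤ 9 * (N : ℝ) ^ 2 * fourthMomentBound := by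
    intro i k
    have hcomp : ∀ j (f : Vec d → ℝ), Measurable f →
        ∫ ω, f (θ j ω) ∂P = ∫ x, f x ∂(stdGaussian (Vec d)) := fun j f hf => by
      rw [← gaussianOfPrecision_one, ← hlaw j, integral_map (hθ j).aemeasurable
        hf.aestronglyMeasurable]
    have h := integral_sum_pow_four_le (P := P) (Z := fun j ω => q i k (θ j ω))
      (K := fourthMomentBound) (fun j => (hqm i k).comp (hθ j))
      (hind.comp (fun _ => q i k) fun _ => hqm i k) (fun j => ?_) (fun j => ?_) (fun j => ?_)
      Finset.univ
    · simpa using h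
    · refine (memLp_four_iff ((hqm i k).comp (hθ j)).aestronglyMeasurable).mpr ?_
      have := hq4 i k
      rw [← gaussianOfPrecision_one, ← hlaw j] at this
      exact this.comp_measurable (hθ j)
    · rw [hcomp j _ (hqm i k), hq]
      have hi : Integrable (fun x : Vec d => inner ℝ (e i) x * inner ℝ (u k) x)
          (stdGaussian (Vec d)) :=
        (memLp_inner_stdGaussian (e i) 2 (by simp)).integrable_mul
          (memLp_inner_stdGaussian (u k) 2 (by simp))
      rw [integral_sub hi (integrable_const _), integral_inner_mul_inner_stdGaussian]
      simp
    · rw [hcomp j (fun x => q i k x ^ 4) ((hqm i k).pow_const 4)]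
      exact integral_quadratic_pow_four_le (he1 i) (hu1 k)
  have hentry : ∀ ω i k, (noiseMatrix (fun j => θ j ω) * U) i k =
      (1 / (N : ℝ)) * ∑ j, q i k (θ j ω) := fun ω i k =>
    noiseMatrix_mul_apply hN (fun j => θ j ω) U i k
  set F : Ω → ℝ := fun ω => (d : ℝ) * p * ∑ i, ∑ k, (1 / (N : ℝ)) ^ 4 *
    (∑ j, q i k (θ j ω)) ^ 4 with hF
  have hint : ∀ i k, Integrable (fun ω => (1 / (N : ℝ)) ^ 4 * (∑ j, q i k (θ j ω)) ^ 4) P :=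
    fun i k => ((memLp_four_iff (hsum i k).1.1).mp (hsum i k).1).const_mul _
  have hFint : Integrable F P :=
    (integrable_finsetSum _ fun i _ => integrable_finsetSum _ fun k _ => hint i k).const_mul _
  have hle : ∀ ω, sqNorm (noiseMatrix (fun j => θ j ω) * U) ^ 2 ≤ F ω := fun ω => by
    refine (sqNorm_sq_le_sum_pow_four _).trans (le_of_eq ?_)
    simp only [hentry, hF, mul_pow, Fintype.card_fin]
  have hF0 : ∀ ω, 0 ≤ F ω := fun ω => (sq_nonneg _).trans (hle ω)
  calc _ ≤ ∫⁻ ω, ENNReal.ofReal (F ω) ∂P :=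
        lintegral_mono fun ω => ENNReal.ofReal_le_ofReal (hle ω)
    _ = ENNReal.ofReal (∫ ω, F ω ∂P) :=
        (ofReal_integral_eq_lintegral_ofReal hFint (Filter.Eventually.of_forall hF0)).symm
    _ ≤ _ := by
        refine ENNReal.ofReal_le_ofReal ?_
        rw [hF, integral_const_mul, integral_finsetSum _ fun i _ =>
          integrable_finsetSum _ fun k _ => hint i k]
        have h1 : ∀ i k, ∫ ω, (1 / (N : ℝ)) ^ 4 * (∑ j, q i k (θ j ω)) ^ 4 ∂P ≤
            (1 / (N : ℝ)) ^ 4 * (9 * (N : ℝ) ^ 2 * fourthMomentBound) := fun i k => by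
          rw [integral_const_mul]
          exact mul_le_mul_of_nonneg_left (hsum i k).2 (by positivity)
        calc _ ≤ (d : ℝ) * p * ∑ i : Fin d, ∑ k : Fin p,
              (1 / (N : ℝ)) ^ 4 * (9 * (N : ℝ) ^ 2 * fourthMomentBound) := by
              refine mul_le_mul_of_nonneg_left (Finset.sum_le_sum fun i _ => ?_) (by positivity)
              rw [integral_finsetSum _ fun k _ => hint i k]
              exact Finset.sum_le_sum fun k _ => h1 i k
          _ = _ := by
              simp only [Finset.sum_const, Finset.card_univ, Fintype.card_fin, nsmul_eq_mul]
              field_simp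

/-- The fourth moment of the noise in one iteration, for a fixed column space. -/
lemma lintegral_sqNorm_noiseMatrix_mul_colProj_sq_le (hN : 0 < N) {θ : Fin N → Ω → Vec d}
    (hθ : ∀ j, Measurable (θ j)) (hlaw : ∀ j, P.map (θ j) = gaussianOfPrecision 1)
    (hind : iIndepFun θ P) (Y : Matrix (Fin d) (Fin p) ℝ) :
    ∫⁻ ω, ENNReal.ofReal (sqNorm (noiseMatrix (fun j => θ j ω) * colProj Y) ^ 2) ∂P ≤
      ENNReal.ofReal (9 * fourthMomentBound * ((p : ℝ) * d / N) ^ 2) := by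
  by_cases hY : IsUnit (Yᵀ * Y).det
  · obtain ⟨U, R, hU, hR, rfl⟩ := exists_orthonormal_factor Y hY
    simp only [colProj_mul_of_isUnit hU hR, sqNorm_mul_projection _ hU]
    exact lintegral_sqNorm_noiseMatrix_mul_sq_le hN hθ hlaw hind hU
  -- For dependent columns the matrix inverse takes its default value zero, so `colProj Y` and the
  -- noise vanish.
  · have : colProj Y = 0 := by
      rw [colProj, Matrix.nonsing_inv_apply_not_isUnit _ hY, Matrix.mul_zero, Matrix.zero_mul]
    simp [this, sqNorm]

/-- The entries of the inverse are those of the adjugate divided by the determinant, hence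
measurable also across singular Gram matrices, where they are discontinuous. -/
lemma measurable_noiseMatrix_mul_colProj :
    Measurable fun z : (Fin d → Fin p → ℝ) × (Fin N → Vec d) =>
      sqNorm (noiseMatrix z.2 * colProj (Matrix.of z.1)) := by
  have h1 : ∀ i j, Measurable fun θ : Fin N → Vec d => noiseMatrix θ i j := fun i j => by
    have : (fun θ : Fin N → Vec d => noiseMatrix θ i j) = fun θ =>
        (1 / (N : ℝ)) * ∑ l, θ l i * θ l j - (1 : Matrix (Fin d) (Fin d) ℝ) i j := by
      ext θ
      simp [noiseMatrix, Matrix.sum_apply, outer, Matrix.vecMulVec_apply]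
    rw [this]
    have hc : ∀ (l : Fin N) (i : Fin d), Measurable fun θ : Fin N → Vec d => θ l i :=
      fun l i => by fun_prop
    exact ((Finset.measurable_sum _ fun l _ => (hc l i).mul (hc l j)).const_mul _).sub_const _
  have hY : Continuous fun Y : Fin d → Fin p → ℝ => Matrix.of Y := continuous_id
  have hG : Continuous fun Y : Fin d → Fin p → ℝ => (Matrix.of Y)ᵀ * Matrix.of Y :=
    hY.matrix_transpose.matrix_mul hY
  have hinv : ∀ k l, Measurable fun Y : Fin d → Fin p → ℝ =>
      ((Matrix.of Y)ᵀ * Matrix.of Y)⁻¹ k l := fun k l => by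
    simp only [Matrix.inv_def, Matrix.smul_apply, smul_eq_mul, Ring.inverse_eq_inv']
    exact hG.matrix_det.measurable.inv.mul
      (hG.matrix_adjugate.matrix_elem k l).measurable
  have h2 : ∀ i j, Measurable fun Y : Fin d → Fin p → ℝ => colProj (Matrix.of Y) i j :=
    fun i j => by
      have e : (fun Y : Fin d → Fin p → ℝ => colProj (Matrix.of Y) i j) = fun Y =>
          ∑ k, (∑ l, Y i l * ((Matrix.of Y)ᵀ * Matrix.of Y)⁻¹ l k) * Y j k := rfl
      rw [e]
      refine Finset.measurable_sum _ fun k _ => (Finset.measurable_sum _ fun l _ => ?_).mul ?_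
      · exact Measurable.mul (by fun_prop) (hinv l k)
      · fun_prop
  have e : (fun z : (Fin d → Fin p → ℝ) × (Fin N → Vec d) =>
      sqNorm (noiseMatrix z.2 * colProj (Matrix.of z.1))) = fun z =>
        ∑ i, ∑ j, (∑ l, noiseMatrix z.2 i l * colProj (Matrix.of z.1) l j) ^ 2 := rfl
  rw [e]
  refine Finset.measurable_sum _ fun i _ => Finset.measurable_sum _ fun j _ =>
    Measurable.pow_const (Finset.measurable_sum _ fun l _ => ?_) 2
  have m1 : Measurable fun z : (Fin d → Fin p → ℝ) × (Fin N → Vec d) => noiseMatrix z.2 i l :=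
    (h1 i l).comp measurable_snd
  have m2 : Measurable fun z : (Fin d → Fin p → ℝ) × (Fin N → Vec d) =>
      colProj (Matrix.of z.1) l j := (h2 l j).comp measurable_fst
  exact m1.mul m2

/-- Conditioning on `Y`: under independence the joint law is a product, and Tonelli's theorem
carries a bound that is uniform over frozen values of `Y`. -/
lemma lintegral_le_of_indepFun {α β : Type*} [MeasurableSpace α] [MeasurableSpace β] {Y : Ω → α}
    {Θ : Ω → β} (hY : Measurable Y) (hΘ : Measurable Θ) (hYΘ : IndepFun Y Θ P)
    {F : α × β → ENNReal} (hF : Measurable F) {C : ENNReal}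
    (hC : ∀ y, ∫⁻ ω, F (y, Θ ω) ∂P ≤ C) : ∫⁻ ω, F (Y ω, Θ ω) ∂P ≤ C := by
  have hprod := (indepFun_iff_map_prod_eq_prod_map_map hY.aemeasurable hΘ.aemeasurable).mp hYΘ
  have : IsProbabilityMeasure (P.map Y) := Measure.isProbabilityMeasure_map hY.aemeasurable
  have : IsProbabilityMeasure (P.map Θ) := Measure.isProbabilityMeasure_map hΘ.aemeasurable
  calc ∫⁻ ω, F (Y ω, Θ ω) ∂P = ∫⁻ z, F z ∂(P.map fun ω => (Y ω, Θ ω)) :=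
        (lintegral_map hF (hY.prodMk hΘ)).symm
    _ = ∫⁻ y, ∫⁻ t, F (y, t) ∂(P.map Θ) ∂(P.map Y) := by
        rw [hprod, lintegral_prod _ hF.aemeasurable]
    _ ≤ ∫⁻ _, C ∂(P.map Y) := by
        refine lintegral_mono fun y => ?_
        have hFy : Measurable fun t => F (y, t) := hF.comp measurable_prodMk_left
        rw [lintegral_map hFy hΘ]
        exact hC y
    _ = C := by simp

/-- The fourth moment of the noise in one iteration, for a frame that is independent of the samples
of this iteration. -/
lemma lintegral_sqNorm_noiseMatrix_mul_colProj_indep_sq_le (hN : 0 < N) {θ : Fin N → Ω → Vec d}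
    (hθ : ∀ j, Measurable (θ j)) (hlaw : ∀ j, P.map (θ j) = gaussianOfPrecision 1)
    (hind : iIndepFun θ P) {Y : Ω → Fin d → Fin p → ℝ} (hY : Measurable Y)
    (hYθ : IndepFun Y (fun ω j => θ j ω) P) :
    ∫⁻ ω, ENNReal.ofReal (sqNorm (noiseMatrix (fun j => θ j ω) *
        colProj (Matrix.of (Y ω))) ^ 2) ∂P ≤
      ENNReal.ofReal (9 * fourthMomentBound * ((p : ℝ) * d / N) ^ 2) :=
  lintegral_le_of_indepFun (Θ := fun ω j => θ j ω) hY (measurable_pi_lambda _ hθ) hYθ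
    (F := fun z => ENNReal.ofReal (sqNorm (noiseMatrix z.2 * colProj (Matrix.of z.1)) ^ 2))
    (measurable_noiseMatrix_mul_colProj.pow_const 2).ennreal_ofReal
    fun y => lintegral_sqNorm_noiseMatrix_mul_colProj_sq_le hN hθ hlaw hind (Matrix.of y)

end Noise

/-! ### The run of the algorithm on a quadratic potential -/

section Algorithm

variable {d p N T M : ℕ}

lemma gradient_potential {A : Matrix (Fin d) (Fin d) ℝ} (hA : Aᵀ = A) (θ : Vec d) :
    gradient (potential A) θ = WithLp.toLp 2 (A *ᵥ θ.ofLp) := by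
  set L : Vec d →L[ℝ] Vec d := Matrix.toEuclideanCLM (𝕜 := ℝ) A with hL
  have hLx : ∀ x : Vec d, L x = WithLp.toLp 2 (A *ᵥ x.ofLp) := fun x => rfl
  have hsymm : ∀ x y : Vec d, inner ℝ (L x) y = inner ℝ x (L y) := fun x y => by
    rw [hLx, hLx, EuclideanSpace.inner_eq_star_dotProduct, EuclideanSpace.inner_eq_star_dotProduct]
    simp only [star_trivial]
    rw [Matrix.dotProduct_mulVec, ← Matrix.mulVec_transpose, hA, dotProduct_comm]
  have hpot : potential A = fun x : Vec d => (1 / 2 : ℝ) * inner ℝ x (L x) := by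
    ext x
    rw [potential, hLx, EuclideanSpace.inner_eq_star_dotProduct]
    simp only [star_trivial]
    rw [dotProduct_comm]
  have hd : HasFDerivAt (potential A) (innerSL ℝ (L θ)) θ := by
    rw [hpot]
    have h := ((hasFDerivAt_id (𝕜 := ℝ) θ).inner ℝ (L.hasFDerivAt (x := θ))).const_mul (1 / 2 : ℝ)
    refine h.congr_fderiv ?_
    ext y
    simp only [id_eq, smul_apply, ContinuousLinearMap.comp_apply,
      ContinuousLinearMap.prod_apply, ContinuousLinearMap.id_apply, fderivInnerCLM_apply,
      innerSL_apply_apply, smul_eq_mul]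
    rw [← hsymm θ y, real_inner_comm (L θ) y]
    ring
  have hg : HasGradientAt (potential A) (L θ) θ := hd
  rw [hg.gradient, hLx]

/-- As `∇ψ(θ) θᵀ = A θ θᵀ`, the randomness enters only through the sample covariance, on the right
of `A`. The noise is thus relative to the frame and independent of the conditioning of `A`. -/
lemma sviUpdate_eq {A : Matrix (Fin d) (Fin d) ℝ} (hA : Aᵀ = A) (hN : 0 < N)
    (θ : Fin N → Vec d) (U : Matrix (Fin d) (Fin p) ℝ) :
    sviUpdate (potential A) 1 θ U = (N : ℝ) • (A * ((1 + noiseMatrix θ) * U)) := by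
  have hN' : (N : ℝ) ≠ 0 := Nat.cast_ne_zero.mpr hN.ne'
  have h1 : ∀ x : Vec d, outer (gradient (potential A) x) x = A * outer x x := fun x => by
    rw [gradient_potential hA, outer, outer, Matrix.mul_vecMulVec]
  have h2 : ∑ j, outer (θ j) (θ j) = (N : ℝ) • (1 + noiseMatrix θ) := by
    rw [noiseMatrix, add_sub_cancel, smul_smul, mul_one_div_cancel hN', one_smul]
  simp only [sviUpdate, h1, Matrix.mul_one]
  rw [← Matrix.mul_sum, h2, Matrix.mul_smul, Matrix.smul_mul, Matrix.mul_assoc]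

/-- Central differences of a linear gradient are exact for every base point and step, so the second
stage adds no error of its own. -/
lemma sviEigenvalue_eq {A : Matrix (Fin d) (Fin d) ℝ} (hA : Aᵀ = A) (hM : 0 < M) {Δ : ℝ}
    (hΔ : 0 < Δ) (α : ℝ) (ϑ : Fin M → Vec d) (U : Matrix (Fin d) (Fin p) ℝ) (k : Fin p) :
    sviEigenvalue (potential A) α Δ ϑ U k = (Uᵀ * A * U) k k - α := by
  have hM' : (M : ℝ) ≠ 0 := Nat.cast_ne_zero.mpr hM.ne'
  set u : Vec d := WithLp.toLp 2 fun i => U i k with hu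
  have h1 : ∀ x : Vec d, (1 / (2 * Δ)) • (gradient (potential A) (x + Δ • u) -
      gradient (potential A) (x - Δ • u)) = WithLp.toLp 2 (A *ᵥ u.ofLp) := fun x => by
    rw [gradient_potential hA, gradient_potential hA, ← WithLp.toLp_sub, ← Matrix.mulVec_sub,
      ← WithLp.ofLp_sub, show x + Δ • u - (x - Δ • u) = (2 * Δ) • u by module, WithLp.ofLp_smul,
      Matrix.mulVec_smul, WithLp.toLp_smul, smul_smul, one_div_mul_cancel (by positivity), one_smul]
  simp only [sviEigenvalue, ← hu, h1]
  rw [Finset.sum_const, Finset.card_univ, Fintype.card_fin, nsmul_eq_mul, ← mul_assoc,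
    one_div_mul_cancel hM', one_mul]
  congr 1
  rw [EuclideanSpace.inner_eq_star_dotProduct, star_trivial, dotProduct_comm, Matrix.mul_assoc,
    Matrix.mul_apply]
  simp only [dotProduct, Matrix.transpose_apply, Matrix.mul_apply, Matrix.mulVec, hu]

/-- The error of the variational posterior precision is the distance of `(A - α I) / n` to its
compression. -/
lemma smul_sub_variationalPrecision {A : Matrix (Fin d) (Fin d) ℝ} (hA : Aᵀ = A) (hM : 0 < M)
    {Δ : ℝ} (hΔ : 0 < Δ) (α : ℝ) (ϑ : Fin M → Vec d) {U : Matrix (Fin d) (Fin p) ℝ}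
    (hU : Uᵀ * U = 1) (r : ℝ) :
    r • A - r • variationalPrecision (potential A) α Δ ϑ U =
      r • (A - α • (1 : Matrix (Fin d) (Fin d) ℝ)) - U * Matrix.diagonal
        (fun k => (Uᵀ * (r • (A - α • (1 : Matrix (Fin d) (Fin d) ℝ))) * U) k k) * Uᵀ := by
  have h1 : (fun k => (Uᵀ * (r • (A - α • (1 : Matrix (Fin d) (Fin d) ℝ))) * U) k k) =
      r • sviEigenvalue (potential A) α Δ ϑ U := by
    ext k
    have : Uᵀ * (r • (A - α • (1 : Matrix (Fin d) (Fin d) ℝ))) * U =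
        r • (Uᵀ * A * U - α • (1 : Matrix (Fin p) (Fin p) ℝ)) := by
      rw [Matrix.mul_smul, Matrix.smul_mul, Matrix.mul_sub, Matrix.sub_mul, Matrix.mul_smul,
        Matrix.smul_mul, Matrix.mul_one, hU]
    rw [this, Pi.smul_apply, sviEigenvalue_eq hA hM hΔ]
    simp
  rw [h1, Matrix.diagonal_smul, variationalPrecision, Matrix.mul_smul, Matrix.smul_mul, smul_add,
    smul_sub]
  abel

lemma initialFrame_orthonormal (hpd : p ≤ d) : (initialFrame d p)ᵀ * initialFrame d p = 1 := by
  ext k l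
  rw [Matrix.mul_apply, Matrix.one_apply]
  simp only [Matrix.transpose_apply, initialFrame, Matrix.of_apply]
  rw [Finset.sum_eq_single (Fin.castLE hpd k)]
  · simp [Fin.ext_iff]
  · intro i _ hi
    have : i.val ≠ k.val := fun h => hi (Fin.ext h)
    simp [this]
  · simp

/-- The deviation of the sample covariance of the samples of iteration `t`. -/
def noiseAt (θ : Fin T → Fin N → Vec d) (t : ℕ) : Matrix (Fin d) (Fin d) ℝ :=
  if h : t < T then noiseMatrix (θ ⟨t, h⟩) else 0

/-- The power iteration without normalization. -/
def sketch (p : ℕ) (A : Matrix (Fin d) (Fin d) ℝ) (θ : Fin T → Fin N → Vec d) :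
    ℕ → Matrix (Fin d) (Fin p) ℝ
  | 0 => initialFrame d p
  | t + 1 => A * ((1 + noiseAt θ t) * sketch p A θ t)

lemma IsSVIIterates.step {A : Matrix (Fin d) (Fin d) ℝ} (hA : Aᵀ = A) (hN : 0 < N)
    {θ : Fin T → Fin N → Vec d} {U : ℕ → Matrix (Fin d) (Fin p) ℝ}
    (hU : IsSVIIterates (potential A) 1 θ U) {t : ℕ} (ht : t < T) :
    (U (t + 1))ᵀ * U (t + 1) = 1 ∧ ∃ R : Matrix (Fin p) (Fin p) ℝ,
      (∀ i j, j < i → R i j = 0) ∧ A * ((1 + noiseAt θ t) * U t) = U (t + 1) * R := by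
  obtain ⟨h1, R, hR, h2⟩ := hU.2 ⟨t, ht⟩
  have hN' : (N : ℝ) ≠ 0 := Nat.cast_ne_zero.mpr hN.ne'
  rw [sviUpdate_eq hA hN] at h2
  refine ⟨h1, (N : ℝ)⁻¹ • R, fun i j hij => by simp [hR i j hij], ?_⟩
  rw [Matrix.mul_smul, ← h2, smul_smul, inv_mul_cancel₀ hN', one_smul, noiseAt, dif_pos ht]

lemma IsSVIIterates.orthonormal {A : Matrix (Fin d) (Fin d) ℝ} (hA : Aᵀ = A) (hN : 0 < N)
    (hpd : p ≤ d) {θ : Fin T → Fin N → Vec d} {U : ℕ → Matrix (Fin d) (Fin p) ℝ}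
    (hU : IsSVIIterates (potential A) 1 θ U) {t : ℕ} (ht : t ≤ T) : (U t)ᵀ * U t = 1 := by
  cases t with
  | zero => rw [hU.1]; exact initialFrame_orthonormal hpd
  | succ t => exact (hU.step hA hN ht).1

/-- The triangular factor is invertible when the noise is small. -/
lemma isUnit_det_of_factor {A E : Matrix (Fin d) (Fin d) ℝ} (hA : IsUnit A.det)
    {U U' : Matrix (Fin d) (Fin p) ℝ} (hU : Uᵀ * U = 1)
    (hE : sqNorm (E * U) < 1) {R : Matrix (Fin p) (Fin p) ℝ}
    (h : A * ((1 + E) * U) = U' * R) : IsUnit R.det := by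
  rw [← Matrix.isUnit_iff_isUnit_det, ← Matrix.mulVec_injective_iff_isUnit,
    ← Matrix.coe_mulVecLin, injective_iff_map_eq_zero]
  intro y hy
  rw [Matrix.mulVecLin_apply] at hy
  have h1 : A *ᵥ (((1 + E) * U) *ᵥ y) = 0 := by
    rw [Matrix.mulVec_mulVec, h, ← Matrix.mulVec_mulVec, hy, Matrix.mulVec_zero]
  have h2 : ((1 + E) * U) *ᵥ y = 0 := by
    have hinj := Matrix.mulVec_injective_iff_isUnit.mpr ((Matrix.isUnit_iff_isUnit_det A).mpr hA)
    exact hinj (by rw [h1, Matrix.mulVec_zero])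
  rw [Matrix.add_mul, Matrix.one_mul, Matrix.add_mulVec] at h2
  -- A kernel vector of `R` would have `U y = -E U y`, impossible for `y ≠ 0` as `E U` has norm
  -- below one while `U` preserves norms.
  have h3 : ∑ i, (U *ᵥ y) i ^ 2 = ∑ i, ((E * U) *ᵥ y) i ^ 2 := by
    rw [eq_neg_of_add_eq_zero_left h2]
    simp
  rw [sum_mulVec_sq_of_orthonormal hU] at h3
  have h4 := sum_mulVec_sq_le (E * U) y
  rw [← h3] at h4
  have h5 : ∑ j, y j ^ 2 ≤ 0 := by
    by_contra hc
    nlinarith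
  have h6 := (Finset.sum_eq_zero_iff_of_nonneg fun _ _ => sq_nonneg _).mp
    (le_antisymm h5 (Finset.sum_nonneg fun _ _ => sq_nonneg _))
  ext j
  simpa using h6 j (Finset.mem_univ j)

/-- The normalized iterates span the same spaces as the unnormalized power iteration. -/
lemma IsSVIIterates.sketch_eq {A : Matrix (Fin d) (Fin d) ℝ} (hA : Aᵀ = A) (hAdet : IsUnit A.det)
    (hN : 0 < N) (hpd : p ≤ d) {θ : Fin T → Fin N → Vec d} {U : ℕ → Matrix (Fin d) (Fin p) ℝ}
    (hU : IsSVIIterates (potential A) 1 θ U)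
    (hq : ∀ t < T, sqNorm (noiseAt θ t * colProj (sketch p A θ t)) < 1) {t : ℕ} (ht : t ≤ T) :
    ∃ R : Matrix (Fin p) (Fin p) ℝ, IsUnit R.det ∧ sketch p A θ t = U t * R := by
  induction t with
  | zero => exact ⟨1, by simp, by rw [sketch, hU.1, Matrix.mul_one]⟩
  | succ t ih =>
    obtain ⟨R, hR, hY⟩ := ih (by omega)
    have hUt := hU.orthonormal hA hN hpd (t := t) (by omega)
    obtain ⟨-, R', -, hR'⟩ := hU.step hA hN ht
    have hqt := hq t ht
    rw [hY, colProj_mul_of_isUnit hUt hR, sqNorm_mul_projection _ hUt] at hqt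
    refine ⟨R' * R, ?_, ?_⟩
    · rw [Matrix.det_mul]
      exact (isUnit_det_of_factor hAdet hUt hqt hR').mul hR
    · rw [sketch, hY, ← Matrix.mul_assoc (U (t + 1)), ← hR']
      simp only [Matrix.mul_assoc]

lemma IsSVIIterates.sqNorm_noise_eq {A : Matrix (Fin d) (Fin d) ℝ} (hA : Aᵀ = A)
    (hAdet : IsUnit A.det) (hN : 0 < N) (hpd : p ≤ d) {θ : Fin T → Fin N → Vec d}
    {U : ℕ → Matrix (Fin d) (Fin p) ℝ} (hU : IsSVIIterates (potential A) 1 θ U)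
    (hq : ∀ t < T, sqNorm (noiseAt θ t * colProj (sketch p A θ t)) < 1) {t : ℕ} (ht : t ≤ T) :
    sqNorm (noiseAt θ t * colProj (sketch p A θ t)) = sqNorm (noiseAt θ t * U t) := by
  obtain ⟨R, hR, hY⟩ := hU.sketch_eq hA hAdet hN hpd hq ht
  have hUt := hU.orthonormal hA hN hpd ht
  rw [hY, colProj_mul_of_isUnit hUt hR, sqNorm_mul_projection _ hUt]

/-- Used to trace a column of the final frame back to time 0, one triangular factor at a time. -/
lemma exists_backward_chain {α : Type*} {S : α → Prop} {r : ℕ → α → α → Prop} {T : ℕ}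
    (h : ∀ t < T, ∀ y', S y' → ∃ y, S y ∧ r t y y') {y : α} (hy : S y) :
    ∃ f : ℕ → α, f T = y ∧ (∀ t ≤ T, S (f t)) ∧ ∀ t < T, r t (f t) (f (t + 1)) := by
  induction T generalizing y with
  | zero => exact ⟨fun _ => y, rfl, fun _ _ => hy, fun t ht => absurd ht (by omega)⟩
  | succ T ih =>
    obtain ⟨z, hz, hr⟩ := h T (by omega) y hy
    obtain ⟨f, hfT, hfS, hfr⟩ := ih (fun t ht => h t (by omega)) hz
    refine ⟨Function.update f (T + 1) y, by simp, fun t ht => ?_, fun t ht => ?_⟩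
    · rcases eq_or_ne t (T + 1) with rfl | hne
      · simpa using hy
      · rw [Function.update_of_ne hne]; exact hfS t (by omega)
    · rw [Function.update_of_ne (by omega : t ≠ T + 1)]
      rcases eq_or_ne t T with rfl | hne
      · rw [Function.update_self, hfT]; exact hr
      · rw [Function.update_of_ne (by omega)]; exact hfr t (by omega)

lemma sum_castLE {a b : ℕ} (h : a ≤ b) (f : Fin b → ℝ) (hf : ∀ i : Fin b, a ≤ i.val → f i = 0) :
    ∑ j : Fin a, f (Fin.castLE h j) = ∑ i, f i := by
  have e := Finset.sum_map Finset.univ (Fin.castLEEmb h) f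
  rw [show ∑ j : Fin a, f (Fin.castLE h j) = ∑ j, f (Fin.castLEEmb h j) from rfl, ← e]
  refine Finset.sum_subset (Finset.subset_univ _) fun i _ hi => hf i ?_
  by_contra hc
  exact hi (Finset.mem_map.mpr ⟨⟨i.val, not_le.mp hc⟩, Finset.mem_univ _, rfl⟩)

/-- A vector in the span of the first `k + 1` basis vectors has as its first `k + 1` spectral
coordinates the transposed leading block applied to it. The block has size `k + 1` because `k`
counts from zero. -/
lemma sum_head_sq_ge (hpd : p ≤ d) {V : Matrix (Fin d) (Fin d) ℝ} {m : ℝ} (hm : 0 < m) (k : Fin p)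
    (hV : SigmaMinGE (leadingBlock V (k + 1) (by omega)) m) {y : Fin p → ℝ}
    (hy : ∀ j, k < j → y j = 0) :
    m ^ 2 * ∑ j, y j ^ 2 ≤
      ∑ i : Fin d with i.val ≤ k.val, (Vᵀ *ᵥ (initialFrame d p *ᵥ y)) i ^ 2 := by
  have hkp : k.val + 1 ≤ p := k.isLt
  have hkd : k.val + 1 ≤ d := by omega
  set z : Fin (k + 1) → ℝ := fun j => y (Fin.castLE hkp j) with hz
  have h := hV.transpose hm z
  have hyz : ∑ j, y j ^ 2 = z ⬝ᵥ z := by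
    have e : z ⬝ᵥ z = ∑ j : Fin (k + 1), y (Fin.castLE hkp j) ^ 2 := by
      simp [dotProduct, hz, sq]
    rw [e, sum_castLE hkp (fun j => y j ^ 2) fun j hj => ?_]
    rw [hy j (Fin.lt_def.mpr hj), zero_pow two_ne_zero]
  have hent : ∀ i : Fin (k + 1), ((leadingBlock V (k + 1) hkd)ᵀ *ᵥ z) i =
      (Vᵀ *ᵥ (initialFrame d p *ᵥ y)) (Fin.castLE hkd i) := by
    intro i
    have e1 : ∀ l : Fin d, (initialFrame d p *ᵥ y) l =
        if hl : l.val < p then y ⟨l.val, hl⟩ else 0 := by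
      intro l
      simp only [Matrix.mulVec, dotProduct, initialFrame, Matrix.of_apply, ite_mul, one_mul,
        zero_mul]
      split_ifs with hl
      · rw [Finset.sum_eq_single ⟨l.val, hl⟩]
        · simp
        · intro j _ hj
          have : l.val ≠ j.val := fun h => hj (Fin.ext h.symm)
          simp [this]
        · simp
      · refine Finset.sum_eq_zero fun j _ => ?_
        have : l.val ≠ j.val := by omega
        simp [this]
    have e2 : (Vᵀ *ᵥ (initialFrame d p *ᵥ y)) (Fin.castLE hkd i) =
        ∑ l : Fin d, V l (Fin.castLE hkd i) * (initialFrame d p *ᵥ y) l := rfl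
    have e3 : ((leadingBlock V (k + 1) hkd)ᵀ *ᵥ z) i =
        ∑ j : Fin (k + 1), V (Fin.castLE hkd j) (Fin.castLE hkd i) *
          (initialFrame d p *ᵥ y) (Fin.castLE hkd j) := by
      have e4 : ∀ j : Fin (k + 1), z j = (initialFrame d p *ᵥ y) (Fin.castLE hkd j) := fun j => by
        have := j.isLt
        rw [e1, dif_pos (show (Fin.castLE hkd j).val < p by simp only [Fin.val_castLE]; omega)]
        rfl
      simp only [Matrix.mulVec, dotProduct, Matrix.transpose_apply, leadingBlock,
        Matrix.submatrix_apply] at e4 ⊢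
      simp only [e4]
    rw [e2, e3, sum_castLE hkd
      (fun l => V l (Fin.castLE hkd i) * (initialFrame d p *ᵥ y) l) fun l hkl => ?_]
    rw [e1]
    split_ifs with hlp
    · rw [hy ⟨l.val, hlp⟩ (Fin.lt_def.mpr (show k.val < l.val from hkl)), mul_zero]
    · rw [mul_zero]
  rw [hyz]
  refine h.trans (le_of_eq ?_)
  simp only [dotProduct, hent, ← sq]
  set w : Fin d → ℝ := Vᵀ *ᵥ (initialFrame d p *ᵥ y)
  rw [Finset.sum_filter, ← sum_castLE hkd (fun i => if i.val ≤ k.val then w i ^ 2 else 0)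
    fun i hi => if_neg (by omega)]
  refine Finset.sum_congr rfl fun j _ => ?_
  have := j.isLt
  rw [if_pos (by simp only [Fin.val_castLE]; omega)]

/-- The noise level of the run: the scaled sum of the squared noise. -/
def totalNoise (p : ℕ) (A : Matrix (Fin d) (Fin d) ℝ) (θ : Fin T → Fin N → Vec d) : ℝ :=
  T * ∑ t ∈ Finset.range T, sqNorm (noiseAt θ t * colProj (sketch p A θ t))

/-- The inverse of a triangular matrix is triangular, so the preimage of a combination of the first
columns again involves only the first columns. This is why column `k` can be compared with the
`k`-th eigenvalue. -/
lemma noise_backward {A E : Matrix (Fin d) (Fin d) ℝ} (hAdet : IsUnit A.det)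
    {U U' : Matrix (Fin d) (Fin p) ℝ} (hU : Uᵀ * U = 1) (hE : sqNorm (E * U) < 1)
    {R : Matrix (Fin p) (Fin p) ℝ} (hR : ∀ i j, j < i → R i j = 0)
    (h : A * ((1 + E) * U) = U' * R) (k : Fin p) {y' : Fin p → ℝ} (hy' : ∀ j, k < j → y' j = 0) :
    ∃ y : Fin p → ℝ, (∀ j, k < j → y j = 0) ∧ U' *ᵥ y' = A *ᵥ (U *ᵥ y + (E * U) *ᵥ y) := by
  have hRdet := isUnit_det_of_factor hAdet hU hE h
  have htri : R.BlockTriangular id := fun i j hij => hR i j hij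
  have : Invertible R := Matrix.invertibleOfIsUnitDet R hRdet
  have hinv : R⁻¹.BlockTriangular id := Matrix.blockTriangular_inv_of_blockTriangular htri
  refine ⟨R⁻¹ *ᵥ y', fun j hj => ?_, ?_⟩
  · rw [Matrix.mulVec, dotProduct]
    refine Finset.sum_eq_zero fun l _ => ?_
    rcases lt_or_ge l j with hlj | hlj
    · rw [hinv hlj, zero_mul]
    · rw [hy' l (hj.trans_le hlj), mul_zero]
  · rw [← Matrix.add_mulVec, ← Matrix.one_mul U, ← Matrix.mul_assoc, Matrix.mul_one,
      ← Matrix.add_mul, Matrix.mulVec_mulVec, h, Matrix.mulVec_mulVec, Matrix.mul_assoc,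
      Matrix.mul_nonsing_inv _ hRdet, Matrix.mul_one]

/-- The Rayleigh quotients of the final frame, in terms of the total noise of the run. -/
theorem IsSVIIterates.eigenvalue_sub_le {A V : Matrix (Fin d) (Fin d) ℝ} {lam : Fin d → ℝ}
    (hV : IsSortedEigendecomposition A V lam) (hlam : ∀ i, 0 < lam i) {L : ℝ}
    (hL : ∀ i, lam i ≤ L) (hN : 0 < N) (hpd : p ≤ d) {m : ℝ} (hm : 0 < m) (hm1 : m ≤ 1)
    (hover : ∀ (k : ℕ) (hk : k ≤ d), k ≤ p → SigmaMinGE (leadingBlock V k hk) m)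
    {θ : Fin T → Fin N → Vec d} {U : ℕ → Matrix (Fin d) (Fin p) ℝ}
    (hU : IsSVIIterates (potential A) 1 θ U) {K : ℝ} (hK : 1 ≤ K)
    (hnoise : totalNoise p A θ ≤ K ^ 2) (hT : 4 * (1 + 2 / m) ^ 2 * K ^ 2 ≤ T) (k : Fin p) :
    lam (Fin.castLE hpd k) - ((U T)ᵀ * A * U T) k k ≤ L * (22 * (1 + 2 / m) ^ 6 * K ^ 2 / T) := by
  set a : ℝ := 1 + 2 / m with ha
  have hm1' : 1 ≤ 1 / m := by rw [le_div_iff₀ hm]; linarith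
  have ha1 : 1 ≤ a := by
    have : 0 < 2 / m := by positivity
    linarith
  have hA := hV.transpose_eq
  obtain ⟨hVV, hanti, hAV⟩ := hV
  have hT0 : (0 : ℝ) < T := lt_of_lt_of_le (by positivity) hT
  have hVV' : V * Vᵀ = 1 := mul_eq_one_comm.mp hVV
  have hAdet : IsUnit A.det := by
    have h1 : (V * Vᵀ).det = 1 := by rw [hVV', Matrix.det_one]
    rw [Matrix.det_mul] at h1
    rw [hAV, Matrix.det_mul, Matrix.det_mul, Matrix.det_diagonal, mul_right_comm, h1, one_mul]
    exact isUnit_iff_ne_zero.mpr (Finset.prod_ne_zero_iff.mpr fun i _ => (hlam i).ne')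
  set q : ℕ → ℝ := fun t => sqNorm (noiseAt θ t * colProj (sketch p A θ t)) with hq
  have hq0 : ∀ t, 0 ≤ q t := fun t => sqNorm_nonneg _
  have hqsum : ∑ t ∈ Finset.range T, q t ≤ K ^ 2 / T := by
    rw [le_div_iff₀' hT0]; exact hnoise
  have hqt : ∀ t < T, q t ≤ K ^ 2 / T := fun t ht =>
    (Finset.single_le_sum (fun s _ => hq0 s) (Finset.mem_range.mpr ht)).trans hqsum
  have hKT : 4 * a ^ 2 * (K ^ 2 / T) ≤ 1 := by
    rw [mul_div_assoc', div_le_one hT0]; exact hT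
  have hKT0 : 0 ≤ K ^ 2 / T := by positivity
  -- The hypothesis `hT` bounds each `q t` by `1 / (4 a²)`: enough for invertible triangular factors
  -- here and for `2 a √(q t) ≤ 1` below.
  have hq1 : ∀ t < T, q t < 1 := fun t ht => by
    have := hqt t ht
    nlinarith
  have hqU : ∀ t ≤ T, q t = sqNorm (noiseAt θ t * U t) := fun t ht =>
    hU.sqNorm_noise_eq hA hAdet hN hpd hq1 ht
  -- The chain ends at the `k`-th unit vector, so `U T *ᵥ y T` is the `k`-th column. Each `y t` is
  -- supported on the indices up to `k`.
  obtain ⟨y, hyT, hyS, hyr⟩ := exists_backward_chain (T := T)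
    (S := fun y : Fin p → ℝ => ∀ j, k < j → y j = 0)
    (r := fun t y y' => U (t + 1) *ᵥ y' = A *ᵥ (U t *ᵥ y + (noiseAt θ t * U t) *ᵥ y))
    (fun t ht y' hy' => by
      obtain ⟨-, R, hR, hstep⟩ := hU.step hA hN ht
      exact noise_backward hAdet (hU.orthonormal hA hN hpd ht.le)
        (by rw [← hqU t ht.le]; exact hq1 t ht) hR hstep k hy')
    (y := Pi.single k 1) (fun j hj => by simp [hj.ne'])
  set c : ℕ → Fin d → ℝ := fun t => Vᵀ *ᵥ (U t *ᵥ y t) with hc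
  set g : ℕ → Fin d → ℝ := fun t => Vᵀ *ᵥ ((noiseAt θ t * U t) *ᵥ y t) with hg
  have hVt : (Vᵀ)ᵀ * Vᵀ = 1 := by rw [Matrix.transpose_transpose]; exact hVV'
  have hcn : ∀ t ≤ T, ∑ i, c t i ^ 2 = ∑ j, y t j ^ 2 := fun t ht => by
    rw [hc, sum_mulVec_sq_of_orthonormal hVt,
      sum_mulVec_sq_of_orthonormal (hU.orthonormal hA hN hpd ht)]
  have hgn : ∀ t < T, ∑ i, g t i ^ 2 ≤ √(q t) ^ 2 * ∑ i, c t i ^ 2 := fun t ht => by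
    rw [hg, sum_mulVec_sq_of_orthonormal hVt, hcn t ht.le, Real.sq_sqrt (hq0 t), hqU t ht.le]
    exact sum_mulVec_sq_le _ _
  have hcstep : ∀ t < T, c (t + 1) = fun i => lam i * (c t i + g t i) := fun t ht => by
    have e1 : c (t + 1) = Vᵀ *ᵥ (A *ᵥ (U t *ᵥ y t + (noiseAt θ t * U t) *ᵥ y t)) := by
      rw [hc, ← hyr t ht]
    rw [e1, Matrix.mulVec_mulVec, hAV,
      show Vᵀ * (V * Matrix.diagonal lam * Vᵀ) = Vᵀ * V * (Matrix.diagonal lam * Vᵀ) by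
        simp only [Matrix.mul_assoc], hVV, Matrix.one_mul,
          ← Matrix.mulVec_mulVec, Matrix.mulVec_add]
    ext i
    rw [Matrix.mulVec_diagonal]
    rfl
  have hcT : ∑ i, c T i ^ 2 = 1 := by
    rw [hcn T le_rfl, hyT]
    rw [Finset.sum_eq_single k]
    · simp
    · intro j _ hj; simp [hj]
    · simp
  set s : Finset (Fin d) := {i : Fin d | i.val ≤ k.val} with hs
  have hhead : m ^ 2 * ∑ i, c 0 i ^ 2 ≤ ∑ i ∈ s, c 0 i ^ 2 := by
    rw [hcn 0 (Nat.zero_le _), hs]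
    simp only [hc, hU.1]
    exact sum_head_sq_ge hpd hm k (hover _ _ k.isLt) (hyS 0 (Nat.zero_le _))
  have hc0 : ∑ i ∈ sᶜ, c 0 i ^ 2 ≤ (1 / m) ^ 2 * ∑ i ∈ s, c 0 i ^ 2 := by
    have h1 := Finset.sum_add_sum_compl s fun i => c 0 i ^ 2
    have h2 : ∑ i, c 0 i ^ 2 ≤ (1 / m) ^ 2 * ∑ i ∈ s, c 0 i ^ 2 := by
      rw [one_div, inv_pow, ← div_eq_inv_mul, le_div_iff₀ (by positivity), mul_comm]
      exact hhead
    have h3 : 0 ≤ ∑ i ∈ s, c 0 i ^ 2 := Finset.sum_nonneg fun _ _ => sq_nonneg _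
    linarith
  -- Chosen so that, by Cauchy–Schwarz, `2 a² ∑ √(q t)` over the first `t₁` steps is at most `1 ≤ 1
  -- / m`. The tail-to-head ratio then grows from `1 / m` to at most `2 / m = a - 1`.
  set t₁ : ℕ := ⌊(T : ℝ) * (1 / (4 * a ^ 4 * K ^ 2))⌋₊ with ht₁
  have hc41 : 1 ≤ 4 * a ^ 4 * K ^ 2 := by
    have : 1 ≤ a ^ 4 := one_le_pow₀ ha1
    have : 1 ≤ K ^ 2 := one_le_pow₀ hK
    nlinarith
  have ht₁le : (t₁ : ℝ) ≤ (T : ℝ) * (1 / (4 * a ^ 4 * K ^ 2)) := Nat.floor_le (by positivity)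
  have ht₁T : t₁ ≤ T := by
    have : (t₁ : ℝ) ≤ T := ht₁le.trans (mul_le_of_le_one_right hT0.le
      ((div_le_one (by positivity)).mpr hc41))
    exact_mod_cast this
  have ht₁ge : (T : ℝ) * (1 / (4 * a ^ 4 * K ^ 2)) ≤ t₁ + 1 := (Nat.lt_floor_add_one _).le
  have hεsum : 2 * a ^ 2 * ∑ t ∈ Finset.range t₁, √(q t) ≤ 1 / m := by
    have h1 := sq_sum_le_card_mul_sum_sq (s := Finset.range t₁) (f := fun t => √(q t))
    rw [Finset.card_range] at h1
    have h2 : ∑ t ∈ Finset.range t₁, √(q t) ^ 2 ≤ K ^ 2 / T := by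
      refine le_trans ?_ hqsum
      simp only [Real.sq_sqrt (hq0 _)]
      exact Finset.sum_le_sum_of_subset_of_nonneg (Finset.range_mono ht₁T) fun t _ _ => hq0 t
    have h3 : (t₁ : ℝ) * ∑ t ∈ Finset.range t₁, √(q t) ^ 2 ≤
        (T * (1 / (4 * a ^ 4 * K ^ 2))) * (K ^ 2 / T) := by gcongr
    have h4 : ((T : ℝ) * (1 / (4 * a ^ 4 * K ^ 2))) * (K ^ 2 / T) = 1 / (4 * a ^ 4) := by
      field_simp
    have h5 : (2 * a ^ 2 * ∑ t ∈ Finset.range t₁, √(q t)) ^ 2 ≤ 1 ^ 2 := by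
      rw [mul_pow]
      calc _ ≤ (2 * a ^ 2) ^ 2 * (1 / (4 * a ^ 4)) := by
            gcongr; exact h1.trans (h3.trans_eq h4)
        _ = 1 ^ 2 := by field_simp; ring
    exact (abs_le_of_sq_le_sq' h5 zero_le_one).2.trans hm1'
  have hε' : ∀ t < T, 2 * a * √(q t) ≤ 1 := fun t ht => by
    refine (abs_le_of_sq_le_sq' (b := (1 : ℝ)) ?_ zero_le_one).2
    rw [mul_pow, Real.sq_sqrt (hq0 t)]
    have := hqt t ht
    have h4 : (0 : ℝ) < (2 * a) ^ 2 := by positivity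
    nlinarith
  have hlk : ∀ i : Fin d, i.val ≤ k.val → lam (Fin.castLE hpd k) ≤ lam i := fun i hi =>
    hanti (Fin.le_def.mpr hi)
  have hLpos : 0 < L := (hlam (Fin.castLE hpd k)).trans_le (hL _)
  have hmain := sub_rayleigh_le (lam := lam) (s := s) (lam₀ := lam (Fin.castLE hpd k)) (L := L)
    (hlam _).le hLpos (hL _) (fun i hi => hlk i (by simpa [hs] using hi))
    (fun i hi => hanti (Fin.le_def.mpr (by
      have : ¬ i.val ≤ k.val := by simpa [hs] using hi
      simp only [Fin.val_castLE]; omega)))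
    (fun i => (hlam i).le) hL ht₁T hcstep hgn (by rw [hcT]; exact one_ne_zero)
    (ρ₀ := 1 / m) (a := a) (by positivity) hc0
    (by rw [ha] at hεsum ⊢; linarith [hεsum, show 2 / m = 1 / m + 1 / m by ring])
    (fun t _ => Real.sqrt_nonneg _) hε'
  have hray : rayleigh lam (c T) = ((U T)ᵀ * A * U T) k k := by
    have e1 : U T *ᵥ y T = fun i => U T i k := by
      rw [hyT]; ext i; simp
    rw [rayleigh, hcT, div_one]
    have e2 := dotProduct_conj_diagonal V lam (U T *ᵥ y T) (U T *ᵥ y T)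
    rw [← hAV] at e2
    have e3 : ∑ i, lam i * c T i ^ 2 = (U T *ᵥ y T) ⬝ᵥ (A *ᵥ (U T *ᵥ y T)) := by
      rw [e2]
      exact Finset.sum_congr rfl fun i _ => by rw [hc]; ring
    rw [e3, e1, Matrix.mul_assoc, Matrix.mul_apply]
    simp only [dotProduct, Matrix.transpose_apply, Matrix.mul_apply, Matrix.mulVec]
  rw [← hray]
  refine hmain.trans (mul_le_mul_of_nonneg_left ?_ hLpos.le)
  have h1 : 4 * a ^ 2 / ((t₁ : ℝ) + 1) ≤ 16 * a ^ 6 * K ^ 2 / T := by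
    calc 4 * a ^ 2 / ((t₁ : ℝ) + 1) ≤ 4 * a ^ 2 / ((T : ℝ) * (1 / (4 * a ^ 4 * K ^ 2))) :=
          div_le_div_of_nonneg_left (by positivity) (by positivity) ht₁ge
      _ = _ := by field_simp; ring
  have h2 : 6 * ∑ t ∈ Finset.range T, √(q t) ^ 2 ≤ 6 * a ^ 6 * K ^ 2 / T := by
    simp only [Real.sq_sqrt (hq0 _)]
    calc 6 * ∑ t ∈ Finset.range T, q t ≤ 6 * 1 * (K ^ 2 / T) := by linarith
      _ ≤ 6 * a ^ 6 * (K ^ 2 / T) := by gcongr; exact one_le_pow₀ ha1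
      _ = _ := by ring
  calc _ ≤ 16 * a ^ 6 * K ^ 2 / T + 6 * a ^ 6 * K ^ 2 / T := add_le_add h1 h2
    _ = _ := by ring

end Algorithm

/-! ### The total noise with high probability -/

section NoiseProbability

variable {d p n N T : ℕ}

/-- Only samples of steps before `t` are required to be measurable, so the lemma also applies to the
σ-algebra that the data and these samples generate. -/
lemma measurable_sketch {Ω : Type*} [MeasurableSpace Ω] {X : Fin n → Ω → Vec d}
    {θ : Fin T → Fin N → Ω → Vec d} (hX : ∀ i, Measurable (X i)) {t : ℕ}
    (hθ : ∀ s : Fin T, s.val < t → ∀ j, Measurable (θ s j)) :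
    Measurable fun ω (a : Fin d) (b : Fin p) =>
      sketch p (posteriorPrecision fun i => X i ω) (fun s j => θ s j ω) t a b := by
  have hcoord : ∀ {Z : Ω → Vec d}, Measurable Z → ∀ a, Measurable fun ω => Z ω a :=
    fun {Z} hZ a => by fun_prop
  have hA : ∀ a b, Measurable fun ω => posteriorPrecision (fun i => X i ω) a b := fun a b => by
    simp only [posteriorPrecision, Matrix.sum_apply, outer, Matrix.vecMulVec_apply]
    exact Finset.measurable_sum _ fun i _ => (hcoord (hX i) a).mul (hcoord (hX i) b)
  induction t with
  | zero =>
    simp only [sketch]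
    exact measurable_const
  | succ t ih =>
    have ih := ih fun s hs => hθ s (by omega)
    have hY : ∀ a b, Measurable fun ω =>
        sketch p (posteriorPrecision fun i => X i ω) (fun s j => θ s j ω) t a b := fun a b =>
      (measurable_pi_apply b).comp ((measurable_pi_apply a).comp ih)
    have hE : ∀ a b, Measurable fun ω =>
        ((1 : Matrix (Fin d) (Fin d) ℝ) + noiseAt (fun s j => θ s j ω) t) a b := fun a b => by
      refine Measurable.const_add ?_ _
      by_cases ht : t < T
      · simp only [noiseAt, dif_pos ht, noiseMatrix, Matrix.sub_apply, Matrix.smul_apply,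
          Matrix.sum_apply, outer, Matrix.vecMulVec_apply, smul_eq_mul]
        exact ((Finset.measurable_sum _ fun j _ => (hcoord (hθ ⟨t, ht⟩ (by simp) j) a).mul
          (hcoord (hθ ⟨t, ht⟩ (by simp) j) b)).const_mul _).sub_const _
      · simp only [noiseAt, dif_neg ht]
        exact measurable_const
    refine measurable_pi_lambda _ fun a => measurable_pi_lambda _ fun b => ?_
    simp only [sketch, Matrix.mul_apply (M := posteriorPrecision _),
      Matrix.mul_apply (M := 1 + noiseAt _ _)]
    exact Finset.measurable_sum _ fun l _ => (hA a l).mul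
      (Finset.measurable_sum _ fun r _ => (hE l r).mul (hY r b))

variable {Ω : Type*} [MeasurableSpace Ω] {P : Measure Ω}

/-- The iterate of step `t` is independent of the samples of step `t`. -/
lemma indepFun_sketch {X : Fin n → Ω → Vec d} {θ : Fin T → Fin N → Ω → Vec d}
    (hX : ∀ i, Measurable (X i)) (hθ : ∀ t j, Measurable (θ t j))
    (hind : iIndepFun (Sum.elim X fun tj : Fin T × Fin N => θ tj.1 tj.2) P) (t : Fin T) :
    IndepFun (fun ω (a : Fin d) (b : Fin p) =>
      sketch p (posteriorPrecision fun i => X i ω) (fun s j => θ s j ω) t a b)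
      (fun ω j => θ t j ω) P := by
  set Z : Fin n ⊕ Fin T × Fin N → Ω → Vec d := Sum.elim X fun tj => θ tj.1 tj.2 with hZ
  set mZ : Fin n ⊕ Fin T × Fin N → MeasurableSpace Ω := fun i => MeasurableSpace.comap (Z i)
    inferInstance with hmZ
  have hZm : ∀ i, Measurable (Z i) := fun i => by
    cases i with
    | inl i => exact hX i
    | inr tj => exact hθ tj.1 tj.2
  -- All the data and the samples before step `t`; `S'` holds the samples of step `t`. Disjoint
  -- index blocks generate independent σ-algebras.
  set S : Set (Fin n ⊕ Fin T × Fin N) := {i | ∀ tj, i = Sum.inr tj → tj.1 < t} with hS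
  set S' : Set (Fin n ⊕ Fin T × Fin N) := {i | ∃ j, i = Sum.inr (t, j)} with hS'
  have hdisj : Disjoint S S' := by
    rw [Set.disjoint_left]
    rintro i hi ⟨j, rfl⟩
    exact lt_irrefl _ (hi _ rfl)
  have hI := indep_iSup_of_disjoint (fun i => (hZm i).comap_le) hind hdisj
  have hmS : ∀ (S : Set (Fin n ⊕ Fin T × Fin N)), ∀ i ∈ S, Measurable[⨆ i ∈ S, mZ i] (Z i) :=
    fun S i hi => Measurable.mono (comap_measurable (Z i)) (le_iSup₂ (f := fun i _ => mZ i) i hi)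
      le_rfl
  refine indep_of_indep_of_le_left (indep_of_indep_of_le_right hI ?_) ?_
  · refine Measurable.comap_le (m₁ := ⨆ i ∈ S', mZ i) ?_
    exact @measurable_pi_lambda _ _ _ (_) _ _ fun j => hmS S' (Sum.inr (t, j)) ⟨j, rfl⟩
  · refine Measurable.comap_le (m₁ := ⨆ i ∈ S, mZ i) ?_
    exact @measurable_sketch d p n N T Ω (_) X θ
      (fun i => hmS S (Sum.inl i) fun tj h => by simp at h) t
      fun s hs j => hmS S (Sum.inr (s, j)) fun tj h => by
        rw [Sum.inr.injEq] at h; rw [← h]; exact hs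

/-- Markov's inequality for the square of a sum of `T` nonnegative random variables. -/
lemma measure_mul_sum_gt_le {q : Fin T → Ω → ℝ} (hqm : ∀ t, Measurable (q t)) {b : ℝ}
    (hq : ∀ t, ∫⁻ ω, ENNReal.ofReal (q t ω ^ 2) ∂P ≤ ENNReal.ofReal b) {K : ℝ} (hK : 0 < K) :
    P {ω | K < T * ∑ t, q t ω} ≤ ENNReal.ofReal ((T : ℝ) ^ 4 * b / K ^ 2) := by
  -- Cauchy–Schwarz over the steps avoids any assumption on their joint dependence.
  have hsq : ∀ ω, (T * ∑ t, q t ω) ^ 2 ≤ ∑ t, (T : ℝ) ^ 3 * q t ω ^ 2 := fun ω => by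
    rw [mul_pow, ← Finset.mul_sum]
    have := sq_sum_le_card_mul_sum_sq (s := (Finset.univ : Finset (Fin T))) (f := fun t => q t ω)
    rw [Finset.card_univ, Fintype.card_fin] at this
    calc (T : ℝ) ^ 2 * (∑ t, q t ω) ^ 2 ≤ (T : ℝ) ^ 2 * (T * ∑ t, q t ω ^ 2) := by gcongr
      _ = _ := by ring
  have hint : ∫⁻ ω, ENNReal.ofReal ((T * ∑ t, q t ω) ^ 2) ∂P ≤
      ENNReal.ofReal ((T : ℝ) ^ 4 * b) := by
    calc ∫⁻ ω, ENNReal.ofReal ((T * ∑ t, q t ω) ^ 2) ∂P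
        ≤ ∫⁻ ω, ∑ t, ENNReal.ofReal ((T : ℝ) ^ 3) * ENNReal.ofReal (q t ω ^ 2) ∂P := by
          refine lintegral_mono fun ω => ?_
          refine (ENNReal.ofReal_le_ofReal (hsq ω)).trans (le_of_eq ?_)
          rw [ENNReal.ofReal_sum_of_nonneg fun t _ => by positivity]
          exact Finset.sum_congr rfl fun t _ => ENNReal.ofReal_mul (by positivity)
      _ = ∑ t, ENNReal.ofReal ((T : ℝ) ^ 3) * ∫⁻ ω, ENNReal.ofReal (q t ω ^ 2) ∂P := by
          rw [lintegral_finsetSum _ fun t _ =>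
            (((hqm t).pow_const 2).ennreal_ofReal).const_mul _]
          exact Finset.sum_congr rfl fun t _ =>
            lintegral_const_mul _ ((hqm t).pow_const 2).ennreal_ofReal
      _ ≤ ∑ _t : Fin T, ENNReal.ofReal ((T : ℝ) ^ 3) * ENNReal.ofReal b :=
          Finset.sum_le_sum fun t _ => mul_le_mul_right (hq t) _
      _ = _ := by
          rw [Finset.sum_const, Finset.card_univ, Fintype.card_fin, nsmul_eq_mul,
            ← ENNReal.ofReal_mul (by positivity), ← ENNReal.ofReal_natCast,
            ← ENNReal.ofReal_mul (by positivity)]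
          congr 1; ring
  have hm : Measurable fun ω => ENNReal.ofReal ((T * ∑ t, q t ω) ^ 2) :=
    (((Finset.measurable_sum _ fun t _ => hqm t).const_mul _).pow_const 2).ennreal_ofReal
  have hmarkov := meas_ge_le_lintegral_div (μ := P) hm.aemeasurable
    (ε := ENNReal.ofReal (K ^ 2)) (by simp [hK.ne']) (by simp)
  calc P {ω | K < T * ∑ t, q t ω}
      ≤ P {ω | ENNReal.ofReal (K ^ 2) ≤ ENNReal.ofReal ((T * ∑ t, q t ω) ^ 2)} := by
        refine measure_mono fun ω hω => ENNReal.ofReal_le_ofReal ?_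
        exact pow_le_pow_left₀ hK.le (le_of_lt hω) 2
    _ ≤ ENNReal.ofReal ((T : ℝ) ^ 4 * b) / ENNReal.ofReal (K ^ 2) :=
        hmarkov.trans (ENNReal.div_le_div_right hint _)
    _ = _ := (ENNReal.ofReal_div_of_pos (by positivity)).symm

/-- The total noise is bounded with high probability. -/
theorem measure_totalNoise_gt_le [IsProbabilityMeasure P] (hN : 0 < N) {X : Fin n → Ω → Vec d}
    {θ : Fin T → Fin N → Ω → Vec d} (hX : ∀ i, Measurable (X i))
    (hθ : ∀ t j, Measurable (θ t j)) (hlaw : ∀ t j, P.map (θ t j) = gaussianOfPrecision 1)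
    (hind : iIndepFun (Sum.elim X fun tj : Fin T × Fin N => θ tj.1 tj.2) P) {K : ℝ} (hK : 0 < K) :
    P {ω | K < totalNoise p (posteriorPrecision fun i => X i ω) fun t j => θ t j ω} ≤
      ENNReal.ofReal (9 * fourthMomentBound * ((T : ℝ) ^ 2 * (p * d) / N) ^ 2 / K ^ 2) := by
  obtain ⟨Y, hY⟩ : ∃ Y : Fin T → Ω → Fin d → Fin p → ℝ, ∀ t, Y t = fun ω a b =>
      sketch p (posteriorPrecision fun i => X i ω) (fun s j => θ s j ω) t a b :=
    ⟨_, fun _ => rfl⟩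
  have hYm : ∀ t, Measurable (Y t) := fun t => by
    rw [hY t]
    exact measurable_sketch hX fun s _ j => hθ s j
  have hYθ : ∀ t, IndepFun (Y t) (fun ω j => θ t j ω) P := fun t => by
    rw [hY t]
    exact indepFun_sketch hX hθ hind t
  obtain ⟨q, hq⟩ : ∃ q : Fin T → Ω → ℝ, ∀ t, q t = fun ω =>
      sqNorm (noiseMatrix (fun j => θ t j ω) * colProj (Matrix.of (Y t ω))) :=
    ⟨_, fun _ => rfl⟩
  have hqm : ∀ t, Measurable (q t) := fun t => by
    rw [hq t]
    have h1 : Measurable fun ω => (Y t ω, fun j => θ t j ω) :=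
      (hYm t).prodMk (measurable_pi_lambda _ fun j => hθ t j)
    have h2 := measurable_noiseMatrix_mul_colProj.comp h1
    exact h2
  have hq4 : ∀ t, ∫⁻ ω, ENNReal.ofReal (q t ω ^ 2) ∂P ≤
      ENNReal.ofReal (9 * fourthMomentBound * ((p : ℝ) * d / N) ^ 2) := fun t => by
    rw [hq t]
    exact lintegral_sqNorm_noiseMatrix_mul_colProj_indep_sq_le hN (hθ t) (hlaw t)
      (hind.precomp (g := fun j => Sum.inr (t, j)) fun j j' h => by simpa using h) (hYm t) (hYθ t)
  have hτ : ∀ ω, totalNoise p (posteriorPrecision fun i => X i ω) (fun t j => θ t j ω) =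
      T * ∑ t, q t ω := fun ω => by
    rw [totalNoise, Finset.sum_range]
    refine congrArg _ (Finset.sum_congr rfl fun t _ => ?_)
    have e : Matrix.of (Y t ω) =
        sketch p (posteriorPrecision fun i => X i ω) (fun s j => θ s j ω) t := by
      rw [hY t]; rfl
    rw [noiseAt, dif_pos t.isLt, hq t, ← e]
  have h := measure_mul_sum_gt_le hqm hq4 hK
  simp only [hτ]
  refine h.trans (le_of_eq (congrArg ENNReal.ofReal ?_))
  generalize fourthMomentBound = F
  ring

end NoiseProbability

/-! ### From Rayleigh quotients to the compression error -/

section Deterministic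

variable {d p : ℕ}

/-- Unless `4 (b - l)²` already exceeds `b²`, one has `0 ≤ b ≤ 2 l`, and then `(b - β)(b + β) ≤ 2 b
D ≤ 4 D l` for `β ≤ b`. The bound is linear in `l`, which produces the head sum. The alternative `l
≤ D` covers runs too short for the convergence analysis. -/
lemma sq_sub_sq_le_of_near {b β l D : ℝ} (hl : 0 ≤ l) (hD : 0 ≤ D)
    (h : b - β ≤ D ∨ l ≤ D) : b ^ 2 - β ^ 2 ≤ 4 * (b - l) ^ 2 + 4 * D * l := by
  rcases le_total (b ^ 2) (4 * (b - l) ^ 2) with h1 | h1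
  · have : 0 ≤ 4 * D * l := by positivity
    nlinarith [sq_nonneg β]
  · have hb : 0 ≤ b := by
      by_contra hc
      nlinarith
    have hb2 : b ≤ 2 * l := by nlinarith
    rcases h with h | h
    · rcases le_total b β with h2 | h2
      · have : 0 ≤ 4 * D * l := by positivity
        nlinarith [sq_nonneg (b - l)]
      · nlinarith [sq_nonneg (b - l), mul_nonneg hD hl,
          mul_nonneg (sub_nonneg.mpr h2) (sub_nonneg.mpr h2), mul_nonneg (sub_nonneg.mpr h2) hb]
    · nlinarith [sq_nonneg (b - l), sq_nonneg β, mul_nonneg hl hD,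
        mul_nonneg hl (sub_nonneg.mpr h)]

/-- The error of a compression of `B` in terms of the eigenvalues of a nearby matrix `Bs`. -/
lemma sqNorm_sub_compression_le (hpd : p ≤ d) {B Bs V Vs : Matrix (Fin d) (Fin d) ℝ}
    {b lam : Fin d → ℝ} (hB : IsSortedEigendecomposition B V b)
    (hBs : IsSortedEigendecomposition Bs Vs lam) (hlam : ∀ i, 0 ≤ lam i)
    {U : Matrix (Fin d) (Fin p) ℝ} (hU : Uᵀ * U = 1) {D : ℝ} (hD : 0 ≤ D)
    (hβ : (∀ k : Fin p, b (Fin.castLE hpd k) - (Uᵀ * B * U) k k ≤ D) ∨ ∀ i, lam i ≤ D) :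
    sqNorm (B - U * Matrix.diagonal (fun k => (Uᵀ * B * U) k k) * Uᵀ) ≤
      4 * sqNorm (B - Bs) + 2 * tailSq lam p + 4 * D * headSum lam p := by
  have hHW := sum_sub_sq_le_sqNorm_sub hB hBs
  have hBn : sqNorm B = ∑ i, b i ^ 2 := by
    conv_lhs => rw [hB.2.2]
    exact sqNorm_conj_diagonal hB.1 b
  rw [sqNorm_sub_compression hB.transpose_eq hU, hBn]
  set β : Fin p → ℝ := fun k => (Uᵀ * B * U) k k with hβdef
  -- Padding by zero lets the eigenvalues beyond `p` be treated term by term with the others; they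
  -- give the tail sum.
  set β' : Fin d → ℝ := fun i => if h : i.val < p then β ⟨i.val, h⟩ else 0 with hβ'
  have hsum : ∑ k, β k ^ 2 = ∑ i, β' i ^ 2 := by
    rw [← sum_castLE hpd (fun i => β' i ^ 2) fun i hi => by
      simp [hβ', not_lt.mpr hi]]
    exact Finset.sum_congr rfl fun k _ => by simp [hβ']
  have hterm : ∀ i, b i ^ 2 - β' i ^ 2 ≤ 4 * (b i - lam i) ^ 2 +
      2 * (if p ≤ i.val then lam i ^ 2 else 0) + 4 * D * (if i.val < p then lam i else 0) := by
    intro i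
    by_cases hi : i.val < p
    · rw [if_neg (not_le.mpr hi), if_pos hi, mul_zero, add_zero]
      have e : β' i = β ⟨i.val, hi⟩ := dif_pos hi
      rw [e]
      refine sq_sub_sq_le_of_near (hlam i) hD ?_
      rcases hβ with h | h
      · exact Or.inl (h ⟨i.val, hi⟩)
      · exact Or.inr (h i)
    · rw [if_pos (not_lt.mp hi), if_neg hi, mul_zero, add_zero]
      have e : β' i = 0 := dif_neg hi
      rw [e]
      nlinarith [sq_nonneg (b i - 2 * lam i)]
  have h1 := Finset.sum_le_sum fun i (_ : i ∈ (Finset.univ : Finset (Fin d))) => hterm i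
  rw [Finset.sum_sub_distrib, Finset.sum_add_distrib, Finset.sum_add_distrib, ← Finset.mul_sum,
    ← Finset.mul_sum, ← Finset.mul_sum] at h1
  rw [hsum]
  refine h1.trans ?_
  rw [tailSq, headSum]
  linarith

lemma quadForm_sq_le (E : Matrix (Fin d) (Fin d) ℝ) {v : Fin d → ℝ} (hv : v ⬝ᵥ v = 1) :
    (v ⬝ᵥ (E *ᵥ v)) ^ 2 ≤ sqNorm E := by
  have hv' : ∑ i, v i ^ 2 = 1 := by simpa [dotProduct, sq] using hv
  have h1 := Finset.sum_mul_sq_le_sq_mul_sq Finset.univ v (E *ᵥ v)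
  have h2 := sum_mulVec_sq_le E v
  rw [hv', one_mul] at h1
  rw [hv', mul_one] at h2
  exact h1.trans h2

lemma IsSortedEigendecomposition.exists_eigenvector {A V : Matrix (Fin d) (Fin d) ℝ}
    {lam : Fin d → ℝ} (h : IsSortedEigendecomposition A V lam) (i : Fin d) :
    ∃ v : Fin d → ℝ, v ⬝ᵥ v = 1 ∧ v ⬝ᵥ (A *ᵥ v) = lam i := by
  obtain ⟨e, he⟩ : ∃ e : Fin d → ℝ, ∀ j, e j = if j = i then 1 else 0 := ⟨_, fun _ => rfl⟩
  refine ⟨V *ᵥ e, ?_, ?_⟩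
  · have := sum_mulVec_sq_of_orthonormal h.1 e
    simpa [dotProduct, sq, he] using this
  · have h1 : Vᵀ *ᵥ (V *ᵥ e) = e := by rw [Matrix.mulVec_mulVec, h.1, Matrix.one_mulVec]
    have h2 := dotProduct_conj_diagonal V lam (V *ᵥ e) (V *ᵥ e)
    rw [← h.2.2, h1] at h2
    rw [h2]
    simp [he]

lemma quadForm_ge_of_posSemidef {S : Matrix (Fin d) (Fin d) ℝ} {a : ℝ}
    (h : (S - a • (1 : Matrix (Fin d) (Fin d) ℝ)).PosSemidef) {v : Fin d → ℝ} (hv : v ⬝ᵥ v = 1) :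
    a ≤ v ⬝ᵥ (S *ᵥ v) := by
  have := h.dotProduct_mulVec_nonneg v
  rw [star_trivial, Matrix.sub_mulVec, dotProduct_sub, Matrix.smul_mulVec, Matrix.one_mulVec,
    dotProduct_smul, hv] at this
  simpa using this

lemma quadForm_le_of_posSemidef {S : Matrix (Fin d) (Fin d) ℝ} {a : ℝ}
    (h : (a • (1 : Matrix (Fin d) (Fin d) ℝ) - S).PosSemidef) {v : Fin d → ℝ} (hv : v ⬝ᵥ v = 1) :
    v ⬝ᵥ (S *ᵥ v) ≤ a := by
  have := h.dotProduct_mulVec_nonneg v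
  rw [star_trivial, Matrix.sub_mulVec, dotProduct_sub, Matrix.smul_mulVec, Matrix.one_mulVec,
    dotProduct_smul, hv] at this
  simpa using this

lemma IsSortedEigendecomposition.affine {A V : Matrix (Fin d) (Fin d) ℝ} {lam : Fin d → ℝ}
    (h : IsSortedEigendecomposition A V lam) {r : ℝ} (hr : 0 ≤ r) (α : ℝ) :
    IsSortedEigendecomposition (r • (A - α • (1 : Matrix (Fin d) (Fin d) ℝ))) V
      fun i => r * (lam i - α) := by
  obtain ⟨hV, hanti, hA⟩ := h
  refine ⟨hV, fun i j hij => ?_, ?_⟩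
  · have := hanti hij
    dsimp only
    gcongr
  · have hV' : V * Vᵀ = 1 := mul_eq_one_comm.mp hV
    have e : Matrix.diagonal (fun i => r * (lam i - α)) =
        r • (Matrix.diagonal lam - α • (1 : Matrix (Fin d) (Fin d) ℝ)) := by
      ext i j
      by_cases hij : i = j
      · subst hij; simp
      · simp [hij]
    rw [e, Matrix.mul_smul, Matrix.smul_mul, Matrix.mul_sub, Matrix.sub_mul, Matrix.mul_smul,
      Matrix.smul_mul, Matrix.mul_one, hV', ← hA]

end Deterministic

/-! ### The error on the good event -/

section ErrorBound

variable {d p n N T M : ℕ}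

lemma HasInitialOverlap.mono {A : Matrix (Fin d) (Fin d) ℝ} {m m' : ℝ} (hm' : 0 ≤ m')
    (hmm : m' ≤ m) (h : HasInitialOverlap A p m) : HasInitialOverlap A p m' := by
  obtain ⟨V, lam, hV, hover⟩ := h
  refine ⟨V, lam, hV, fun k hk hkp y => le_trans ?_ (hover k hk hkp y)⟩
  have : 0 ≤ y ⬝ᵥ y := Finset.sum_nonneg fun i _ => mul_self_nonneg _
  gcongr

lemma eigenvalue_mem_Icc (hn : 0 < n) {S Vs : Matrix (Fin d) (Fin d) ℝ} {αs Ls α : ℝ}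
    {lam : Fin d → ℝ} (hSl : (S - αs • (1 : Matrix (Fin d) (Fin d) ℝ)).PosSemidef)
    (hSu : (Ls • (1 : Matrix (Fin d) (Fin d) ℝ) - S).PosSemidef)
    (hα : 0 ≤ α) (hαn : α ≤ n * αs)
    (hVs : IsSortedEigendecomposition (S - (α / n) • (1 : Matrix (Fin d) (Fin d) ℝ)) Vs lam)
    (i : Fin d) : 0 ≤ lam i ∧ lam i ≤ Ls := by
  have hn0 : (0 : ℝ) < n := Nat.cast_pos.mpr hn
  obtain ⟨v, hv, hvi⟩ := hVs.exists_eigenvector i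
  have h2 := quadForm_ge_of_posSemidef hSl hv
  have h3 := quadForm_le_of_posSemidef hSu hv
  have h4 : α / n ≤ αs := by rw [div_le_iff₀ hn0]; linarith
  have h5 : 0 ≤ α / n := by positivity
  rw [Matrix.sub_mulVec, dotProduct_sub, Matrix.smul_mulVec, Matrix.one_mulVec,
    dotProduct_smul, hv, smul_eq_mul, mul_one] at hvi
  constructor <;> linarith

/-- The error of the variational posterior when the posterior precision is close to `n` times the
second moment matrix and the total noise of the subspace iteration is bounded. -/
theorem frobSq_sub_variationalPrecision_le (hn : 0 < n) (hN : 0 < N) (hT : 0 < T) (hM : 0 < M)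
    (hpd : p ≤ d) {A S Vs : Matrix (Fin d) (Fin d) ℝ} {αs Ls α Δ : ℝ} {lam : Fin d → ℝ}
    (hLs : αs ≤ Ls)
    (hSl : (S - αs • (1 : Matrix (Fin d) (Fin d) ℝ)).PosSemidef)
    (hSu : (Ls • (1 : Matrix (Fin d) (Fin d) ℝ) - S).PosSemidef)
    (hα : 0 ≤ α) (hαn : α ≤ n * αs) (hΔ : 0 < Δ)
    (hVs : IsSortedEigendecomposition (S - (α / n) • (1 : Matrix (Fin d) (Fin d) ℝ)) Vs lam)
    {m : ℝ} (hm : 0 < m) (hm1 : m ≤ 1) (hover : HasInitialOverlap A p m)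
    {θ : Fin T → Fin N → Vec d} {ϑ : Fin M → Vec d} {U : ℕ → Matrix (Fin d) (Fin p) ℝ}
    (hU : IsSVIIterates (potential A) 1 θ U) {K : ℝ} (hK : 1 ≤ K)
    (hnoise : totalNoise p A θ ≤ K ^ 2)
    (hnear : sqNorm (A - (n : ℝ) • S) < (n * αs) ^ 2) {D : ℝ}
    (hD : Ls * (44 * (1 + 2 / m) ^ 6 * K ^ 2 / T) ≤ D) (hαs : 0 < αs) :
    frobSq (S - (1 / (n : ℝ)) • variationalPrecision (potential A) α Δ ϑ (U T)) ≤
      10 * (sqNorm (A - (n : ℝ) • S) / n ^ 2) + 4 * tailSq lam p + 8 * D * headSum lam p := by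
  obtain ⟨V, lamA, hV, hover⟩ := hover
  have hn0 : (0 : ℝ) < n := Nat.cast_pos.mpr hn
  have hT0 : (0 : ℝ) < T := Nat.cast_pos.mpr hT
  have hLs0 : 0 < Ls := hαs.trans_le hLs
  have hA := hV.transpose_eq
  set a : ℝ := 1 + 2 / m with ha
  have ha1 : 1 ≤ a := by
    have : 0 < 2 / m := by positivity
    linarith
  -- The deviation is below the least eigenvalue of `n S`, so `A` is positive definite with
  -- eigenvalues at most `2 n Ls`. The factor 2 turns 22 into the 44 of `hD`.
  have hdev : ∀ v : Fin d → ℝ, v ⬝ᵥ v = 1 → |v ⬝ᵥ (A *ᵥ v) - n * (v ⬝ᵥ (S *ᵥ v))| < n * αs := by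
    intro v hv
    have h1 := (quadForm_sq_le (A - (n : ℝ) • S) hv).trans_lt hnear
    rw [Matrix.sub_mulVec, dotProduct_sub, Matrix.smul_mulVec, dotProduct_smul, smul_eq_mul] at h1
    exact abs_lt_of_sq_lt_sq h1 (by positivity)
  have hlamA : ∀ i, 0 < lamA i ∧ lamA i ≤ 2 * n * Ls := fun i => by
    obtain ⟨v, hv, hvi⟩ := hV.exists_eigenvector i
    have h1 := abs_lt.mp (hdev v hv)
    have h2 := mul_le_mul_of_nonneg_left (quadForm_ge_of_posSemidef hSl hv) hn0.le
    have h3 := mul_le_mul_of_nonneg_left (quadForm_le_of_posSemidef hSu hv) hn0.le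
    have h4 := mul_le_mul_of_nonneg_left hLs hn0.le
    rw [hvi] at h1
    constructor <;> linarith
  have hlam := eigenvalue_mem_Icc hn hSl hSu hα hαn hVs
  have hUo : (U T)ᵀ * U T = 1 := hU.orthonormal hA hN hpd le_rfl
  have hB := hV.affine (r := 1 / (n : ℝ)) (by positivity) α
  set B := (1 / (n : ℝ)) • (A - α • (1 : Matrix (Fin d) (Fin d) ℝ)) with hBdef
  have hD0 : 0 ≤ D := le_trans (by positivity) hD
  have hβ : (∀ k : Fin p, 1 / (n : ℝ) * (lamA (Fin.castLE hpd k) - α) -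
      ((U T)ᵀ * B * U T) k k ≤ D) ∨ ∀ i, lam i ≤ D := by
    -- If `T` is too small for the convergence theorem, then `D` is at least `Ls`, hence at least
    -- every `lam i`.
    by_cases hTK : 4 * a ^ 2 * K ^ 2 ≤ T
    · left
      intro k
      have h1 := hU.eigenvalue_sub_le hV (fun i => (hlamA i).1) (fun i => (hlamA i).2) hN hpd hm
        hm1 hover hK hnoise hTK k
      have e : ((U T)ᵀ * B * U T) k k = 1 / (n : ℝ) * (((U T)ᵀ * A * U T) k k - α) := by
        have : (U T)ᵀ * B * U T =
            (1 / (n : ℝ)) • ((U T)ᵀ * A * U T - α • (1 : Matrix (Fin p) (Fin p) ℝ)) := by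
          rw [hBdef, Matrix.mul_smul, Matrix.smul_mul, Matrix.mul_sub, Matrix.sub_mul,
            Matrix.mul_smul, Matrix.smul_mul, Matrix.mul_one, hUo]
        rw [this]
        simp
      rw [e, ← mul_sub, sub_sub_sub_cancel_right]
      calc 1 / (n : ℝ) * (lamA (Fin.castLE hpd k) - ((U T)ᵀ * A * U T) k k)
          ≤ 1 / (n : ℝ) * (2 * n * Ls * (22 * a ^ 6 * K ^ 2 / T)) := by gcongr
        _ = Ls * (44 * a ^ 6 * K ^ 2 / T) := by field_simp; ring
        _ ≤ D := hD
    · right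
      intro i
      refine (hlam i).2.trans (le_trans ?_ hD)
      refine le_mul_of_one_le_right hLs0.le ?_
      rw [le_div_iff₀ hT0, one_mul]
      refine (not_le.mp hTK).le.trans ?_
      have : a ^ 2 ≤ a ^ 6 := pow_le_pow_right₀ ha1 (by norm_num)
      have : a ^ 2 * K ^ 2 ≤ a ^ 6 * K ^ 2 := by gcongr
      have : 0 ≤ a ^ 6 * K ^ 2 := by positivity
      linarith
  have hmain := sqNorm_sub_compression_le hpd hB hVs (fun i => (hlam i).1) hUo hD0 hβ
  have hdiff : B - (S - (α / n) • (1 : Matrix (Fin d) (Fin d) ℝ)) =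
      (1 / (n : ℝ)) • (A - (n : ℝ) • S) := by
    rw [hBdef, smul_sub, smul_sub, smul_smul, smul_smul, one_div_mul_cancel hn0.ne', one_smul,
      one_div_mul_eq_div]
    abel
  have hE : sqNorm ((1 / (n : ℝ)) • (A - (n : ℝ) • S)) = sqNorm (A - (n : ℝ) • S) / n ^ 2 := by
    rw [sqNorm_smul]; ring
  rw [hdiff, hE, ← smul_sub_variationalPrecision hA hM hΔ α ϑ hUo] at hmain
  have hsplit : S - (1 / (n : ℝ)) • variationalPrecision (potential A) α Δ ϑ (U T) =
      (-1 : ℝ) • ((1 / (n : ℝ)) • (A - (n : ℝ) • S)) + ((1 / (n : ℝ)) • A -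
        (1 / (n : ℝ)) • variationalPrecision (potential A) α Δ ϑ (U T)) := by
    rw [smul_sub (1 / (n : ℝ)), smul_smul (1 / (n : ℝ)), one_div_mul_cancel hn0.ne', one_smul,
      neg_one_smul]
    abel
  have h := sqNorm_add_le ((-1 : ℝ) • ((1 / (n : ℝ)) • (A - (n : ℝ) • S)))
    ((1 / (n : ℝ)) • A - (1 / (n : ℝ)) • variationalPrecision (potential A) α Δ ϑ (U T))
  rw [← hsplit, sqNorm_smul, hE] at h
  refine le_trans (show frobSq _ ≤ _ from h) ?_
  linarith

end ErrorBound

/-! ### Consequences of the allocation rule -/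

section Allocation

variable {p d N T M q : ℕ} {c₁ c₂ κ δ : ℝ}

/-- The consequences of the allocation rule for the lengths of the first stage. -/
lemma IsAllocation.bounds (h : IsAllocation c₁ c₂ q p d κ δ N T M) (hc₁ : 0 < c₁) (hp : 0 < p)
    (hd : 0 < d) (hκ : 1 ≤ κ) (hδ : 0 < δ) :
    c₁ ≤ T * (((p : ℝ) * d / budget N T M) ^ (1 / 3 : ℝ) * κ ^ (2 / 3 : ℝ) / δ ^ (1 / 6 : ℝ)) ∧
      ((T : ℝ) ^ 2 * (p * d) / N) ^ 2 ≤ c₂ ^ 4 / c₁ ^ 2 * δ := by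
  have hp0 : (0 : ℝ) < p := Nat.cast_pos.mpr hp
  have hd0 : (0 : ℝ) < d := Nat.cast_pos.mpr hd
  have hN0 : (0 : ℝ) < N := Nat.cast_pos.mpr h.N_pos
  have hT0 : (0 : ℝ) < T := Nat.cast_pos.mpr h.T_pos
  have hκ0 : 0 < κ := by linarith
  have hB : 0 < budget N T M := by unfold budget; positivity
  have hNl := h.N_lower
  have hTl := h.T_lower
  have hTu := h.T_upper
  generalize budget N T M = B at hB hNl hTl hTu ⊢
  have hx : (((p : ℝ) * d) ^ (1 / 3 : ℝ)) ^ 3 = p * d := by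
    rw [← Real.rpow_mul_natCast (by positivity)]; norm_num
  have hy : B ^ (2 / 3 : ℝ) = (B ^ (1 / 3 : ℝ)) ^ 2 := by
    rw [← Real.rpow_mul_natCast hB.le]; norm_num
  have hz : (δ ^ (1 / 6 : ℝ)) ^ 6 = δ := by
    rw [← Real.rpow_mul_natCast hδ.le]; norm_num
  have hw1 : 1 ≤ κ ^ (2 / 3 : ℝ) := Real.one_le_rpow hκ (by norm_num)
  rw [Real.div_rpow (by positivity) hB.le]
  rw [Real.div_rpow zero_le_one hκ0.le, Real.one_rpow] at hTl hTu
  rw [hy] at hNl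
  have hx0 : 0 < ((p : ℝ) * d) ^ (1 / 3 : ℝ) := by positivity
  have hy0 : 0 < B ^ (1 / 3 : ℝ) := by positivity
  have hz0 : 0 < δ ^ (1 / 6 : ℝ) := by positivity
  -- With `x³ = p d` and `z⁶ = δ` only rational algebra remains. The exponent `1/6` is what makes
  -- the squared noise level proportional to `δ`.
  generalize ((p : ℝ) * d) ^ (1 / 3 : ℝ) = x at *
  generalize B ^ (1 / 3 : ℝ) = y at *
  generalize δ ^ (1 / 6 : ℝ) = z at *
  generalize κ ^ (2 / 3 : ℝ) = w at *
  have hw0 : 0 < w := by linarith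
  constructor
  · calc c₁ = c₁ * (y * (z / x) * (1 / w)) * (x / y * w / z) := by field_simp
      _ ≤ T * (x / y * w / z) := by gcongr
  · rw [← hx]
    have h1 : (T : ℝ) ^ 2 * x ^ 3 / N ≤
        (c₂ * (y * (z / x) * (1 / w))) ^ 2 * x ^ 3 / (c₁ * (y ^ 2 * (x / z) * w)) := by
      gcongr
    have h2 : (c₂ * (y * (z / x) * (1 / w))) ^ 2 * x ^ 3 / (c₁ * (y ^ 2 * (x / z) * w)) =
        c₂ ^ 2 / c₁ * (z / w) ^ 3 := by
      field_simp
    have h3 : (z / w) ^ 3 ≤ z ^ 3 := by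
      gcongr
      exact div_le_self hz0.le hw1
    calc ((T : ℝ) ^ 2 * x ^ 3 / N) ^ 2 ≤ (c₂ ^ 2 / c₁ * z ^ 3) ^ 2 := by
          gcongr
          exact h1.trans (h2.le.trans (by gcongr))
      _ = c₂ ^ 4 / c₁ ^ 2 * z ^ 6 := by ring
      _ = _ := by rw [hz]

end Allocation

/-! ### A bound on the diagonal of the covariance -/

section SecondMoment

variable {d : ℕ} {μ : Measure (Vec d)} [IsProbabilityMeasure μ]

lemma secondMoment_apply_self_le {R : ℝ} (hμ : ∀ᵐ x ∂μ, ‖x‖ ^ 2 ≤ R) (i : Fin d) :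
    secondMoment μ i i ≤ R := by
  have h : ∫ x : Vec d, x i * x i ∂μ ≤ ∫ _x : Vec d, R ∂μ := by
    refine integral_mono_of_nonneg (Filter.Eventually.of_forall fun x => mul_self_nonneg _)
      (integrable_const _) ?_
    filter_upwards [hμ] with x hx
    refine le_trans ?_ hx
    rw [EuclideanSpace.real_norm_sq_eq, ← sq]
    exact Finset.single_le_sum (f := fun j => x j ^ 2) (fun j _ => sq_nonneg _) (Finset.mem_univ i)
  simpa [secondMoment] using h

end SecondMoment

/-! ### The bad event -/

section Concentration

variable {d p n N T : ℕ} {Ω : Type*} [MeasurableSpace Ω] {P : Measure Ω} [IsProbabilityMeasure P]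

/-- With high probability both the posterior precision and the noise of the first stage are well
behaved (for measurable samples). -/
lemma measure_bad_event_le_of_measurable (hn : 0 < n) (hN : 0 < N) {μ : Measure (Vec d)} {R : ℝ}
    (hR : 0 < R) (hμ : ∀ᵐ x ∂μ, ‖x‖ ^ 2 ≤ R) {X : Fin n → Ω → Vec d}
    {θ : Fin T → Fin N → Ω → Vec d} (hX : ∀ i, Measurable (X i)) (hθ : ∀ t j, Measurable (θ t j))
    (hXlaw : ∀ i, P.map (X i) = μ) (hθlaw : ∀ t j, P.map (θ t j) = gaussianOfPrecision 1)
    (hind : iIndepFun (Sum.elim X fun tj : Fin T × Fin N => θ tj.1 tj.2) P) {δ : ℝ} (hδ : 0 < δ)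
    (hδ1 : δ ≤ 1) {c K : ℝ} (hc : 0 ≤ c) (halloc : ((T : ℝ) ^ 2 * (p * d) / N) ^ 2 ≤ c * δ)
    (hK : K = 1 + 18 * fourthMomentBound * c) :
    P {ω | (R * √n * (1 + √(Real.log (2 / δ)))) ^ 2 ≤
          sqNorm (posteriorPrecision (fun i => X i ω) - (n : ℝ) • secondMoment μ) ∨
        K ^ 2 < totalNoise p (posteriorPrecision fun i => X i ω) fun t j => θ t j ω} ≤
      ENNReal.ofReal δ := by
  have hF : (0 : ℝ) ≤ fourthMomentBound := by norm_num [fourthMomentBound, eighthMomentBound]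
  have hlog : 0 ≤ Real.log (2 / δ) := Real.log_nonneg (by rw [le_div_iff₀ hδ]; linarith)
  have h1 := measureReal_posteriorPrecision_sub_ge_le hn hR hμ hX hXlaw
    (hind.precomp (g := Sum.inl) Sum.inl_injective) (Real.sqrt_nonneg (Real.log (2 / δ)))
  rw [Real.sq_sqrt hlog, Real.exp_neg, Real.exp_log (by positivity), inv_div] at h1
  have h1' := ENNReal.ofReal_le_ofReal h1
  rw [ofReal_measureReal] at h1'
  have h2 := measure_totalNoise_gt_le (p := p) hN hX hθ hθlaw hind
    (K := (1 + 18 * fourthMomentBound * c) ^ 2) (by positivity)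
  subst hK
  generalize fourthMomentBound = F at hF h2 ⊢
  have hK1 : 1 ≤ 1 + 18 * F * c := by
    have : 0 ≤ 18 * F * c := by positivity
    linarith
  -- The 18 in `K` is twice the moment constant 9, so that the noise takes half of `δ`; the data
  -- take the other half by the choice `u² = log (2 / δ)`.
  have h3 : 9 * F * ((T : ℝ) ^ 2 * (p * d) / N) ^ 2 / ((1 + 18 * F * c) ^ 2) ^ 2 ≤ δ / 2 := by
    rw [div_le_iff₀ (by positivity)]
    calc 9 * F * ((T : ℝ) ^ 2 * (p * d) / N) ^ 2 ≤ 9 * F * (c * δ) := by gcongr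
      _ ≤ δ / 2 * (1 + 18 * F * c) := by nlinarith
      _ ≤ δ / 2 * ((1 + 18 * F * c) ^ 2) ^ 2 := by
        gcongr
        rw [← pow_mul]
        exact le_self_pow₀ hK1 (by norm_num)
  calc _ ≤ _ := measure_union_le _ _
    _ ≤ ENNReal.ofReal (δ / 2) + ENNReal.ofReal (δ / 2) :=
        add_le_add h1' (h2.trans (ENNReal.ofReal_le_ofReal h3))
    _ = ENNReal.ofReal δ := by
        rw [← ENNReal.ofReal_add (by positivity) (by positivity), add_halves]

/-- With high probability both the posterior precision and the noise of the first stage are well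
behaved. -/
theorem measure_bad_event_le (hn : 0 < n) (hN : 0 < N) {μ : Measure (Vec d)} {R : ℝ}
    (hR : 0 < R) (hμ : ∀ᵐ x ∂μ, ‖x‖ ^ 2 ≤ R) {X : Fin n → Ω → Vec d}
    {θ : Fin T → Fin N → Ω → Vec d} (hX : ∀ i, HasLaw (X i) μ P)
    (hθ : ∀ t j, HasLaw (θ t j) (gaussianOfPrecision 1) P)
    (hind : iIndepFun (Sum.elim X fun tj : Fin T × Fin N => θ tj.1 tj.2) P) {δ : ℝ} (hδ : 0 < δ)
    (hδ1 : δ ≤ 1) {c K : ℝ} (hc : 0 ≤ c) (halloc : ((T : ℝ) ^ 2 * (p * d) / N) ^ 2 ≤ c * δ)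
    (hK : K = 1 + 18 * fourthMomentBound * c) :
    P {ω | (R * √n * (1 + √(Real.log (2 / δ)))) ^ 2 ≤
          sqNorm (posteriorPrecision (fun i => X i ω) - (n : ℝ) • secondMoment μ) ∨
        K ^ 2 < totalNoise p (posteriorPrecision fun i => X i ω) fun t j => θ t j ω} ≤
      ENNReal.ofReal δ := by
  -- `HasLaw` gives only a.e. measurability. Measurable versions have the same laws and
  -- independence, and the events agree almost everywhere.
  obtain ⟨X', hX'm, hX'⟩ : ∃ X' : Fin n → Ω → Vec d, (∀ i, Measurable (X' i)) ∧
      ∀ i, X i =ᵐ[P] X' i :=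
    ⟨fun i => (hX i).aemeasurable.mk, fun i => (hX i).aemeasurable.measurable_mk,
      fun i => (hX i).aemeasurable.ae_eq_mk⟩
  obtain ⟨θ', hθ'm, hθ'⟩ : ∃ θ' : Fin T → Fin N → Ω → Vec d, (∀ t j, Measurable (θ' t j)) ∧
      ∀ t j, θ t j =ᵐ[P] θ' t j :=
    ⟨fun t j => (hθ t j).aemeasurable.mk, fun t j => (hθ t j).aemeasurable.measurable_mk,
      fun t j => (hθ t j).aemeasurable.ae_eq_mk⟩
  refine le_trans (measure_mono_ae ?_) (measure_bad_event_le_of_measurable (p := p) hn hN hR hμ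
    hX'm hθ'm (fun i => (Measure.map_congr (hX' i)).symm.trans (hX i).map_eq)
    (fun t j => (Measure.map_congr (hθ' t j)).symm.trans (hθ t j).map_eq)
    (hind.congr fun i => ?_) hδ hδ1 hc halloc hK)
  · filter_upwards [ae_all_iff.mpr hX', ae_all_iff.mpr fun t => ae_all_iff.mpr (hθ' t)]
      with ω h1 h2
    have e1 : (fun i => X i ω) = fun i => X' i ω := funext h1
    have e2 : (fun t j => θ t j ω) = fun t j => θ' t j ω := funext fun t => funext (h2 t)
    intro h
    change _ ∨ _ at h
    change _ ∨ _
    rwa [e1, e2] at h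
  · cases i with
    | inl i => exact hX' i
    | inr tj => exact hθ' tj.1 tj.2

end Concentration

/-! ### Constants -/

section Arithmetic

/-- The deviation at level `δ`, relative to the sample size. -/
lemma sample_deviation_bounds {n : ℕ} (hn0 : 0 < n) {R αs l L₀ C₁ lδ : ℝ} (hαs : 0 < αs)
    (hn : 8 * (R ^ 2 / αs ^ 2) * l ≤ n) (hl2 : 1 / 2 ≤ l) (hl3 : l ≤ 1 + lδ) (hL₀ : 0 < L₀)
    (hδL : L₀ ≤ lδ) (hC₁ : C₁ = 4 / L₀ + 2) :
    (R * √n * (1 + √l)) ^ 2 ≤ (n * αs) ^ 2 ∧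
      (R * √n * (1 + √l)) ^ 2 / n ^ 2 ≤ C₁ * (R ^ 2 / n * lδ) := by
  have hn0' : (0 : ℝ) < n := Nat.cast_pos.mpr hn0
  have hsq : (R * √n * (1 + √l)) ^ 2 ≤ R ^ 2 * n * (2 + 2 * l) := by
    rw [mul_pow, mul_pow, Real.sq_sqrt hn0'.le]
    have h1 := Real.sq_sqrt (show 0 ≤ l by linarith)
    have h2 : (1 + √l) ^ 2 ≤ 2 + 2 * l := by linarith [sq_nonneg (1 - √l)]
    gcongr
  constructor
  · have h1 : 8 * R ^ 2 * l ≤ n * αs ^ 2 := by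
      calc 8 * R ^ 2 * l = 8 * (R ^ 2 / αs ^ 2) * l * αs ^ 2 := by field_simp
        _ ≤ n * αs ^ 2 := by gcongr
    have h2 : 2 + 2 * l ≤ 8 * l := by linarith
    calc _ ≤ R ^ 2 * n * (2 + 2 * l) := hsq
      _ ≤ R ^ 2 * n * (8 * l) := by gcongr
      _ = n * (8 * R ^ 2 * l) := by ring
      _ ≤ n * (n * αs ^ 2) := by gcongr
      _ = _ := by ring
  · rw [div_le_iff₀ (by positivity)]
    have h1 : 4 ≤ 4 / L₀ * lδ := by
      calc 4 = 4 / L₀ * L₀ := by field_simp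
        _ ≤ _ := by gcongr
    have h2 : 2 + 2 * l ≤ C₁ * lδ := by
      rw [hC₁, add_mul]
      linarith
    calc _ ≤ R ^ 2 * n * (2 + 2 * l) := hsq
      _ ≤ R ^ 2 * n * (C₁ * lδ) := by gcongr
      _ = _ := by field_simp

lemma le_mul_sum_of_le {F E t Y s r C₁ C₂ : ℝ} (hmain : F ≤ 10 * E + 4 * t + 8 * (C₂ * Y) * s)
    (hE : E ≤ C₁ * r) (hC₁ : 0 ≤ C₁) (hC₂ : 0 ≤ C₂) (ht : 0 ≤ t) (hs : 0 ≤ Y * s) (hr : 0 ≤ r) :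
    F ≤ (10 * C₁ + 4 + 8 * C₂) * (t + Y * s + r) := by
  linarith [mul_nonneg hC₁ ht, mul_nonneg hC₂ ht, mul_nonneg hC₁ hs, mul_nonneg hC₂ hr]

end Arithmetic

end LowRankSVI

end

/-! ### The main theorem -/

open LowRankSVI in
theorem theorem2 (c₁ c₂ : ℝ) (hc₁ : 0 < c₁) (hc₂ : 0 < c₂) (q : ℕ)
    (m : ℝ) (hm : 0 < m) (δ₀ : ℝ) (hδ₀ : δ₀ < 1) :
    ∃ C : ℝ, 0 < C ∧
      ∀ (d p n N T M : ℕ) (δ R αs Ls α Δ : ℝ) (μ : Measure (Vec d)) [IsProbabilityMeasure μ]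
        (Vs : Matrix (Fin d) (Fin d) ℝ) (lam : Fin d → ℝ)
        (Ω : Type*) [MeasurableSpace Ω] (P : Measure Ω) [IsProbabilityMeasure P]
        (X : Fin n → Ω → Vec d) (θ : Fin T → Fin N → Ω → Vec d) (ϑ : Fin M → Ω → Vec d)
        (U : ℕ → Ω → Matrix (Fin d) (Fin p) ℝ),
        1 ≤ p → p ≤ d → 0 < δ → δ ≤ δ₀ →
        -- the data distribution: mean zero, bounded support, and well conditioned covariance
        (∫ x, x ∂μ = 0) → (∀ᵐ x ∂μ, ‖x‖ ^ 2 ≤ R) → 0 < αs →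
        (secondMoment μ - αs • (1 : Matrix (Fin d) (Fin d) ℝ)).PosSemidef →
        (Ls • (1 : Matrix (Fin d) (Fin d) ℝ) - secondMoment μ).PosSemidef →
        -- the sample size
        8 * (R ^ 2 / αs ^ 2) * Real.log (2 / δ) ≤ n →
        -- the diagonal part `α I` of the variational family, and the finite difference step
        0 ≤ α → α ≤ n * αs → 0 < Δ →
        -- the eigenvalues of the covariance net of that diagonal part
        IsSortedEigendecomposition
          (secondMoment μ - (α / n) • (1 : Matrix (Fin d) (Fin d) ℝ)) Vs lam →
        -- the computational budget
        IsAllocation c₁ c₂ q p d (Ls / αs) δ N T M →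
        -- the data and the algorithm's samples, with input matrix `I`
        (∀ i, HasLaw (X i) μ P) →
        (∀ t j, HasLaw (θ t j) (gaussianOfPrecision 1) P) →
        (∀ j, HasLaw (ϑ j) (gaussianOfPrecision 1) P) →
        iIndepFun (Sum.elim X (Sum.elim (fun tj : Fin T × Fin N => θ tj.1 tj.2) ϑ)) P →
        -- the run of the algorithm on the posterior of the observed data
        (∀ ω, IsSVIIterates (potential (posteriorPrecision fun i => X i ω)) 1
          (fun t j => θ t j ω) (fun t => U t ω)) →
        P {ω | HasInitialOverlap (posteriorPrecision fun i => X i ω) p m ∧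
            ¬ (frobSq (secondMoment μ - (1 / (n : ℝ)) •
                  variationalPrecision (potential (posteriorPrecision fun i => X i ω)) α Δ
                    (fun j => ϑ j ω) (U T ω)) ≤
                C * (tailSq lam p +
                  ((p : ℝ) * d / budget N T M) ^ (1 / 3 : ℝ) * (Ls / αs) ^ (2 / 3 : ℝ) *
                    (Ls / δ ^ (1 / 6 : ℝ)) * headSum lam p +
                  R ^ 2 / n * Real.log (1 / δ)))}
          ≤ ENNReal.ofReal δ := by
  have hF : (0 : ℝ) ≤ fourthMomentBound := by norm_num [fourthMomentBound, eighthMomentBound]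
  -- The convergence theorem needs an overlap level at most one, and lowering `m` only weakens the
  -- overlap assumption.
  obtain ⟨a, ha⟩ : ∃ a : ℝ, a = 1 + 2 / min m 1 := ⟨_, rfl⟩
  obtain ⟨c, hc⟩ : ∃ c : ℝ, c = c₂ ^ 4 / c₁ ^ 2 := ⟨_, rfl⟩
  obtain ⟨K, hK⟩ : ∃ K : ℝ, K = 1 + 18 * fourthMomentBound * c := ⟨_, rfl⟩
  -- A positive lower bound for `log (1 / δ)`, used to absorb additive constants into that
  -- logarithm. The maximum keeps it meaningful for any `δ₀ < 1`.
  obtain ⟨L₀, hL₀⟩ : ∃ L₀ : ℝ, L₀ = Real.log (1 / max δ₀ (1 / 2)) := ⟨_, rfl⟩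
  have hm' : 0 < min m 1 := lt_min hm one_pos
  have hc0 : 0 ≤ c := by rw [hc]; positivity
  have hK1 : 1 ≤ K := by
    have : 0 ≤ 18 * fourthMomentBound * c := by positivity
    linarith
  have hL₀0 : 0 < L₀ := by
    rw [hL₀]
    refine Real.log_pos ?_
    rw [lt_div_iff₀ (lt_max_of_lt_right (by norm_num)), one_mul]
    exact max_lt hδ₀ (by norm_num)
  obtain ⟨C₁, hC₁⟩ : ∃ C₁ : ℝ, C₁ = 4 / L₀ + 2 := ⟨_, rfl⟩
  obtain ⟨C₂, hC₂⟩ : ∃ C₂ : ℝ, C₂ = 44 * a ^ 6 * K ^ 2 / c₁ := ⟨_, rfl⟩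
  have ha0 : 0 < a := by rw [ha]; positivity
  have hC₁0 : 0 < C₁ := by rw [hC₁]; positivity
  have hC₂0 : 0 < C₂ := by rw [hC₂]; positivity
  refine ⟨10 * C₁ + 4 + 8 * C₂, by positivity, ?_⟩
  intro d p n N T M δ R αs Ls α Δ μ _ Vs lam Ω _ P _ X θ ϑ U hp hpd hδ hδδ₀ _ hμ hαs hSl hSu hn hα
    hαn hΔ hVs halloc hX hθ _ hind hU
  have hd : 0 < d := by omega
  have hδ1 : δ < 1 := hδδ₀.trans_lt hδ₀
  have hδL : L₀ ≤ Real.log (1 / δ) := by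
    rw [hL₀]
    refine Real.log_le_log (by positivity) ?_
    gcongr
    exact hδδ₀.trans (le_max_left _ _)
  -- A unit test vector, available because `d ≥ 1`; it yields `αs ≤ Ls` and `0 < R`.
  obtain ⟨e, he⟩ : ∃ e : Fin d → ℝ, ∀ j, e j = if j = ⟨0, hd⟩ then 1 else 0 := ⟨_, fun _ => rfl⟩
  have he1 : e ⬝ᵥ e = 1 := by simp [dotProduct, he]
  have heS : e ⬝ᵥ (secondMoment μ *ᵥ e) = secondMoment μ ⟨0, hd⟩ ⟨0, hd⟩ := by
    simp [dotProduct, Matrix.mulVec, he]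
  have h1 := quadForm_ge_of_posSemidef hSl he1
  have hαL : αs ≤ Ls := h1.trans (quadForm_le_of_posSemidef hSu he1)
  have hR : 0 < R := by
    rw [heS] at h1
    exact hαs.trans_le (h1.trans (secondMoment_apply_self_le hμ _))
  have hLs : 0 < Ls := hαs.trans_le hαL
  obtain ⟨l, hl⟩ : ∃ l : ℝ, l = Real.log (2 / δ) := ⟨_, rfl⟩
  rw [← hl] at hn
  have hl1 : l = Real.log 2 + Real.log (1 / δ) := by
    rw [hl, ← Real.log_mul (by norm_num) (by positivity)]
    ring_nf
  have hl2 : 1 / 2 ≤ l := by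
    have := Real.log_two_gt_d9
    linarith
  have hl3 : l ≤ 1 + Real.log (1 / δ) := by
    have := Real.log_two_lt_d9
    linarith
  have hn0' : (0 : ℝ) < n := lt_of_lt_of_le (by positivity) hn
  have hn0 : 0 < n := Nat.cast_pos.mp hn0'
  obtain ⟨hTl, hNT⟩ := halloc.bounds hc₁ hp hd ((one_le_div hαs).mpr hαL) hδ
  have hindXθ : iIndepFun (Sum.elim X fun tj : Fin T × Fin N => θ tj.1 tj.2) P := by
    have := hind.precomp (g := Sum.map id Sum.inl)
      (Function.injective_id.sumMap Sum.inl_injective)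
    convert this using 1
    ext i
    cases i <;> rfl
  -- The failure event may be nonmeasurable, since the QR factors are arbitrary. It suffices to
  -- include it in the bad event, outside of which the error bound is deterministic.
  refine le_trans (measure_mono ?_) (measure_bad_event_le (p := p) hn0 halloc.N_pos hR hμ hX hθ
    hindXθ hδ hδ1.le hc0 (hc ▸ hNT) hK)
  rintro ω ⟨hover, hfail⟩
  change _ ∨ _
  by_contra hgood
  rw [not_or, not_le, not_lt] at hgood
  obtain ⟨hnear, hnoise⟩ := hgood
  rw [← hl] at hnear
  refine hfail ?_
  obtain ⟨η, hη⟩ : ∃ η : ℝ, η =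
    ((p : ℝ) * d / budget N T M) ^ (1 / 3 : ℝ) * (Ls / αs) ^ (2 / 3 : ℝ) /
    δ ^ (1 / 6 : ℝ) := ⟨_, rfl⟩
  rw [← hη] at hTl
  have hT0 : (0 : ℝ) < T := Nat.cast_pos.mpr halloc.T_pos
  obtain ⟨hdev1, hdev2⟩ := sample_deviation_bounds hn0 hαs hn hl2 hl3 hL₀0 hδL hC₁
  have hD : Ls * (44 * a ^ 6 * K ^ 2 / T) ≤ C₂ * (η * Ls) := by
    have : 1 / (T : ℝ) ≤ η / c₁ := by
      rw [div_le_div_iff₀ hT0 hc₁]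
      linarith
    calc Ls * (44 * a ^ 6 * K ^ 2 / T) = Ls * (44 * a ^ 6 * K ^ 2) * (1 / T) := by ring
      _ ≤ Ls * (44 * a ^ 6 * K ^ 2) * (η / c₁) := by gcongr
      _ = _ := by rw [hC₂]; ring
  have hmain := frobSq_sub_variationalPrecision_le hn0 halloc.N_pos halloc.T_pos halloc.M_pos hpd
    hαL hSl hSu hα hαn hΔ hVs hm' (min_le_right _ _) (hover.mono hm'.le (min_le_left _ _))
    (ϑ := fun j => ϑ j ω) (hU ω) hK1 hnoise (hnear.trans_le hdev1) (ha ▸ hD) hαs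
  have hmid : ((p : ℝ) * d / budget N T M) ^ (1 / 3 : ℝ) * (Ls / αs) ^ (2 / 3 : ℝ) *
      (Ls / δ ^ (1 / 6 : ℝ)) * headSum lam p = η * Ls * headSum lam p := by
    rw [hη]; ring
  rw [hmid]
  have ht : 0 ≤ tailSq lam p := Finset.sum_nonneg fun k _ => by split_ifs <;> positivity
  have hh : 0 ≤ η * Ls * headSum lam p := by
    have h2 : 0 ≤ headSum lam p := Finset.sum_nonneg fun k _ => by
      split_ifs
      exacts [(eigenvalue_mem_Icc hn0 hSl hSu hα hαn hVs k).1, le_rfl]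
    have h3 : 0 ≤ η := by
      rw [hη, budget]
      positivity
    positivity
  have hr : 0 ≤ R ^ 2 / n * Real.log (1 / δ) :=
    mul_nonneg (by positivity) (hL₀0.le.trans hδL)
  refine le_mul_sum_of_le hmain (le_trans ?_ hdev2) hC₁0.le hC₂0.le ht hh hr
  gcongr
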